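/- **Theorem 2.1.** Let $N\ge 1$ be an integer and let $1<p<q$ be real numbers, with in addition $q<\frac{2N}{N-2}-1$ if $N\ge 3$. Let $\omega\ge 0$, and set $X_\omega:=H^1(\mathbb R^N)$ if $\omega>0$ and $X_0:=\dot H^1(\mathbb R^N)\cap L^{p+1}(\mathbb R^N)=\{v\in L^{p+1}(\mathbb R^N):\nabla v\in L^2(\mathbb R^N)\}$ (complex-valued functions, weak gradients, with the norms $\|\nabla v\|_{L^2}+\|v\|_{L^2}$ and $\|\nabla v\|_{L^2}+\|v\|_{L^{p+1}}$ respectively). For $v\in X_\omega$ let $$S_\omega(v)=\tfrac12\|\nabla v\|_{L^2}^2+\tfrac{\omega}{2}\|v\|_{L^2}^2+\tfrac1{p+1}\|v\|_{L^{p+1}}^{p+1}-\tfrac1{q+1}\|v\|_{L^{q+1}}^{q+1},$$ $$K_\omega(v)=\|\nabla v\|_{L^2}^2+\omega\|v\|_{L^2}^2+\|v\|_{L^{p+1}}^{p+1}-\|v\|_{L^{q+1}}^{q+1},$$ where for $\omega=0$ the terms with $\|v\|_{L^2}^2$ are absent. Let $S_\omega'$ be the Fréchet derivative of $S_\omega$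 on $X_\omega$, regarded as a real Banach space, and define $$\mathscr A_\omega=\{v\in X_\omega\setminus\{0\}:S_\omega'(v)=0\},\quad d(\omega)=\inf_{v\in\mathscr A_\omega}S_\omega(v),\quad \mathscr G_\omega=\{v\in\mathscr A_\omega:S_\omega(v)=d(\omega)\},$$ $$\mathscr K_\omega=\{v\in X_\omega\setminus\{0\}:K_\omega(v)=0\},\quad \mu(\omega)=\inf_{v\in\mathscr K_\omega}S_\omega(v),\quad \mathscr M_\omega=\{v\in\mathscr K_\omega:S_\omega(v)=\mu(\omega)\}.$$ Then $\mathscr G_\omega=\mathscr M_\omega\neq\emptyset$ and $d(\omega)=\mu(\omega)>0$. Moreover, if $(v_n)\subset X_\omega$ is a sequence with $K_\omega(v_n)\to 0$ and $S_\omega(v_n)\to\mu(\omega)$, then there exist $(y_n)\subset\mathbb R^N$, a subsequence $(v_{n_j})$ and $v_0\in\mathscr M_\omega$ such that $v_{n_j}(\cdot-y_{n_j})\to v_0$ strongly in $X_\omega$. -/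

import Mathlib

open MeasureTheory Filter Topology
open scoped ENNReal

noncomputable section

namespace DoublePowerNLS

/-- The Euclidean space `ℝ^N`. -/
abbrev RN (N : ℕ) : Type := EuclideanSpace ℝ (Fin N)

/-- The space `L^r(ℝ^N; ℂ)`. -/
abbrev LpFun (N : ℕ) (r : ℝ≥0∞) : Type := Lp ℂ r (volume : Measure (RN N))

/-- The space `L^2(ℝ^N; ℂ^N)`, in which the gradients live. -/
abbrev GradFun (N : ℕ) : Type := Lp (EuclideanSpace ℂ (Fin N)) 2 (volume : Measure (RN N))

/-- `g` is the weak (distributional) gradient of `v`: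
`∫ v ∂ᵢφ = - ∫ gᵢ φ` for all `φ ∈ C_c^∞(ℝ^N)` and all `i`. -/
def IsWeakGradient {N : ℕ} (v : RN N → ℂ) (g : RN N → EuclideanSpace ℂ (Fin N)) : Prop :=
  ∀ φ : RN N → ℝ, ContDiff ℝ ((⊤ : ℕ∞) : WithTop ℕ∞) φ → HasCompactSupport φ → ∀ i : Fin N,
    ∫ x, fderiv ℝ φ x (EuclideanSpace.single i (1 : ℝ)) • v x = - ∫ x, φ x • g x i

theorem integrable_test_smul {N : ℕ} {F : Type*} [NormedAddCommGroup F] [NormedSpace ℝ F]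
    {r : ℝ≥0∞} [hr : Fact (1 ≤ r)] (f : Lp F r (volume : Measure (RN N)))
    {φ : RN N → ℝ} (hφ : Continuous φ) (hc : HasCompactSupport φ) :
    Integrable (fun x => φ x • f x) :=
  ((Lp.memLp f).locallyIntegrable hr.out).integrable_smul_left_of_hasCompactSupport hφ hc

theorem integrable_test_smul_coord {N : ℕ} (g : GradFun N)
    {φ : RN N → ℝ} (hφ : Continuous φ) (hc : HasCompactSupport φ) (i : Fin N) :
    Integrable (fun x => φ x • g x i) := by
  have h := integrable_test_smul g hφ hc
  exact ((EuclideanSpace.proj i : EuclideanSpace ℂ (Fin N) →L[ℂ] ℂ).restrictScalars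
    ℝ).integrable_comp h

theorem continuous_partial {N : ℕ} {φ : RN N → ℝ} (hφ : ContDiff ℝ ((⊤ : ℕ∞) : WithTop ℕ∞) φ) (w : RN N) :
    Continuous (fun x => fderiv ℝ φ x w) :=
  (hφ.continuous_fderiv (by simp)).clm_apply continuous_const

theorem hasCompactSupport_partial {N : ℕ} {φ : RN N → ℝ} (hc : HasCompactSupport φ) (w : RN N) :
    HasCompactSupport (fun x => fderiv ℝ φ x w) :=
  hc.fderiv_apply ℝ w

/-- The space of all `v ∈ L^r(ℝ^N; ℂ)` whose weak gradient belongs to `L^2`, that is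
`H^1(ℝ^N)` for `r = 2` and `Ḣ^1(ℝ^N) ∩ L^{p+1}(ℝ^N)` for `r = p + 1`, as a real vector space.
An element is stored as the pair `(v, ∇v)` (`∇v` is determined by `v`), so that the norm inherited
from the product is `max (‖v‖_{L^r}) (‖∇v‖_{L^2})`, which is equivalent to the usual one. -/
def sobolevSubmodule (N : ℕ) (r : ℝ≥0∞) [Fact (1 ≤ r)] :
    Submodule ℝ (LpFun N r × GradFun N) where
  carrier := {u | IsWeakGradient (u.1 : RN N → ℂ) (u.2 : RN N → EuclideanSpace ℂ (Fin N))}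
  zero_mem' := by
    intro φ hφ hc i
    have h1 : ∫ x, fderiv ℝ φ x (EuclideanSpace.single i (1 : ℝ)) •
        ((0 : LpFun N r × GradFun N).1 : RN N → ℂ) x = 0 := by
      refine integral_eq_zero_of_ae ?_
      filter_upwards [Lp.coeFn_zero ℂ r (volume : Measure (RN N))] with x hx
      simp
    have h2 : ∫ x, φ x • ((0 : LpFun N r × GradFun N).2 : RN N → EuclideanSpace ℂ (Fin N)) x i
        = 0 := by
      refine integral_eq_zero_of_ae ?_
      filter_upwards [Lp.coeFn_zero (EuclideanSpace ℂ (Fin N)) 2 (volume : Measure (RN N))]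
        with x hx
      simp
    rw [h1, h2, neg_zero]
  add_mem' := by
    intro a b ha hb φ hφ hc i
    have h1 : ∫ x, fderiv ℝ φ x (EuclideanSpace.single i (1 : ℝ)) • ((a + b).1 : RN N → ℂ) x
        = (∫ x, fderiv ℝ φ x (EuclideanSpace.single i (1 : ℝ)) • (a.1 : RN N → ℂ) x)
          + ∫ x, fderiv ℝ φ x (EuclideanSpace.single i (1 : ℝ)) • (b.1 : RN N → ℂ) x := by
      rw [← integral_add
        (integrable_test_smul a.1 (continuous_partial hφ _) (hasCompactSupport_partial hc _))
        (integrable_test_smul b.1 (continuous_partial hφ _) (hasCompactSupport_partial hc _))]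
      refine integral_congr_ae ?_
      filter_upwards [Lp.coeFn_add a.1 b.1] with x hx
      simp only [Prod.fst_add, hx, Pi.add_apply, smul_add]
    have h2 : ∫ x, φ x • ((a + b).2 : RN N → EuclideanSpace ℂ (Fin N)) x i
        = (∫ x, φ x • (a.2 : RN N → EuclideanSpace ℂ (Fin N)) x i)
          + ∫ x, φ x • (b.2 : RN N → EuclideanSpace ℂ (Fin N)) x i := by
      rw [← integral_add (integrable_test_smul_coord a.2 hφ.continuous hc i)
        (integrable_test_smul_coord b.2 hφ.continuous hc i)]
      refine integral_congr_ae ?_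
      filter_upwards [Lp.coeFn_add a.2 b.2] with x hx
      simp only [Prod.snd_add, hx, Pi.add_apply, PiLp.add_apply, smul_add]
    rw [h1, h2, ha φ hφ hc i, hb φ hφ hc i]
    ring
  smul_mem' := by
    intro c a ha φ hφ hc i
    have h1 : ∫ x, fderiv ℝ φ x (EuclideanSpace.single i (1 : ℝ)) • ((c • a).1 : RN N → ℂ) x
        = c • ∫ x, fderiv ℝ φ x (EuclideanSpace.single i (1 : ℝ)) • (a.1 : RN N → ℂ) x := by
      rw [← integral_smul]
      refine integral_congr_ae ?_
      filter_upwards [Lp.coeFn_smul c a.1] with x hx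
      simp only [Prod.smul_fst, hx, Pi.smul_apply]
      exact smul_comm _ _ _
    have h2 : ∫ x, φ x • ((c • a).2 : RN N → EuclideanSpace ℂ (Fin N)) x i
        = c • ∫ x, φ x • (a.2 : RN N → EuclideanSpace ℂ (Fin N)) x i := by
      rw [← integral_smul]
      refine integral_congr_ae ?_
      filter_upwards [Lp.coeFn_smul c a.2] with x hx
      simp only [Prod.smul_snd, hx, Pi.smul_apply, PiLp.smul_apply]
      exact smul_comm _ _ _
    rw [h1, h2, ha φ hφ hc i, smul_neg]

/-- The Lebesgue exponent attached to the frequency `ω ≥ 0`: `p + 1` if `ω = 0`,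
and `2` if `ω > 0`. -/
def massExponent (p ω : ℝ) : ℝ≥0∞ := if ω = 0 then ENNReal.ofReal p + 1 else 2

instance massExponent_fact (p ω : ℝ) : Fact (1 ≤ massExponent p ω) :=
  ⟨by unfold massExponent; split_ifs <;> simp⟩

/-- The energy space `X_ω`: `Ḣ^1(ℝ^N) ∩ L^{p+1}(ℝ^N)` if `ω = 0`, `H^1(ℝ^N)` if `ω > 0`. -/
abbrev X (N : ℕ) (p ω : ℝ) : Type := sobolevSubmodule N (massExponent p ω)

variable {N : ℕ} {p ω : ℝ}

/-- The function underlying an element of `X_ω`. -/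
def X.toFun (v : X N p ω) : RN N → ℂ := (v.1.1 : RN N → ℂ)

/-- The weak gradient of an element of `X_ω`, as an element of `L^2`. -/
def X.grad (v : X N p ω) : GradFun N := v.1.2

/-- `‖v‖_{L^s}^s`. -/
def X.normPow (s : ℝ) (v : X N p ω) : ℝ := ∫ x, ‖v.toFun x‖ ^ s

/-- The action `S_ω`. -/
def action (q : ℝ) (v : X N p ω) : ℝ :=
  1 / 2 * ‖v.grad‖ ^ 2 + ω / 2 * v.normPow 2
    + 1 / (p + 1) * v.normPow (p + 1) - 1 / (q + 1) * v.normPow (q + 1)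

/-- The Nehari functional `K_ω`. -/
def nehari (q : ℝ) (v : X N p ω) : ℝ :=
  ‖v.grad‖ ^ 2 + ω * v.normPow 2 + v.normPow (p + 1) - v.normPow (q + 1)

/-- `𝒜_ω`: the nontrivial critical points of `S_ω`; the derivative `S_ω'` is the (real) Fréchet
derivative on `X_ω`. -/
def criticalPoints (N : ℕ) (p q ω : ℝ) : Set (X N p ω) :=
  {v | v ≠ 0 ∧ HasFDerivAt (action q) (0 : X N p ω →L[ℝ] ℝ) v}

/-- `d(ω)`: the least action of a nontrivial critical point. -/
def groundLevel (N : ℕ) (p q ω : ℝ) : ℝ := sInf (action q '' criticalPoints N p q ω)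

/-- `𝒢_ω`: the ground states. -/
def groundStates (N : ℕ) (p q ω : ℝ) : Set (X N p ω) :=
  {v | v ∈ criticalPoints N p q ω ∧ action q v = groundLevel N p q ω}

/-- `𝒦_ω`: the Nehari manifold. -/
def nehariManifold (N : ℕ) (p q ω : ℝ) : Set (X N p ω) := {v | v ≠ 0 ∧ nehari q v = 0}

/-- `μ(ω)`: the infimum of the action on the Nehari manifold. -/
def nehariLevel (N : ℕ) (p q ω : ℝ) : ℝ := sInf (action q '' nehariManifold N p q ω)

/-- `ℳ_ω`: the minimizers of the action on the Nehari manifold. -/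
def nehariMinimizers (N : ℕ) (p q ω : ℝ) : Set (X N p ω) :=
  {v | v ∈ nehariManifold N p q ω ∧ action q v = nehariLevel N p q ω}

/-- Translation `f ↦ f(· - y)` on a Lebesgue space. -/
def translateLp {F : Type*} [NormedAddCommGroup F] {r : ℝ≥0∞} (y : RN N)
    (f : Lp F r (volume : Measure (RN N))) : Lp F r (volume : Measure (RN N)) :=
  Lp.compMeasurePreserving (fun x => x - y) (measurePreserving_sub_right volume y) f

theorem coeFn_translateLp {F : Type*} [NormedAddCommGroup F] {r : ℝ≥0∞} (y : RN N)
    (f : Lp F r (volume : Measure (RN N))) :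
    translateLp y f =ᵐ[volume] fun x => f (x - y) :=
  Lp.coeFn_compMeasurePreserving f (measurePreserving_sub_right volume y)

theorem translate_mem {r : ℝ≥0∞} [Fact (1 ≤ r)] (y : RN N) {u : LpFun N r × GradFun N}
    (hu : u ∈ sobolevSubmodule N r) :
    (translateLp y u.1, translateLp y u.2) ∈ sobolevSubmodule N r := by
  intro φ hφ hc i
  have hφ' : ContDiff ℝ ((⊤ : ℕ∞) : WithTop ℕ∞) (fun x => φ (x + y)) := hφ.comp (contDiff_id.add contDiff_const)
  have hc' : HasCompactSupport (fun x => φ (x + y)) :=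
    hc.comp_homeomorph (Homeomorph.addRight y)
  have key := hu (fun x => φ (x + y)) hφ' hc' i
  have h1 : ∫ x, fderiv ℝ φ x (EuclideanSpace.single i (1 : ℝ)) • (translateLp y u.1) x
      = ∫ x, fderiv ℝ (fun x => φ (x + y)) x (EuclideanSpace.single i (1 : ℝ)) • u.1 x := by
    rw [← integral_sub_right_eq_self (fun x => fderiv ℝ (fun x => φ (x + y)) x
      (EuclideanSpace.single i (1 : ℝ)) • u.1 x) y]
    refine integral_congr_ae ?_
    filter_upwards [coeFn_translateLp y u.1] with x hx
    rw [hx, fderiv_comp_add_right, sub_add_cancel]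
  have h2 : ∫ x, φ x • (translateLp y u.2) x i = ∫ x, φ (x + y) • u.2 x i := by
    rw [← integral_sub_right_eq_self (fun x => φ (x + y) • u.2 x i) y]
    refine integral_congr_ae ?_
    filter_upwards [coeFn_translateLp y u.2] with x hx
    rw [hx, sub_add_cancel]
  exact h1.trans (key.trans (congrArg Neg.neg h2.symm))

/-- Translation `v ↦ v(· - y)` on `X_ω`. -/
def X.translate (y : RN N) (v : X N p ω) : X N p ω :=
  ⟨(translateLp y v.1.1, translateLp y v.1.2), translate_mem y v.2⟩

end DoublePowerNLS

end

/-! Write A for the quadratic part of the action, B and C for the integrals of the powers p+1 and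
q+1. Then S = I + K/(q+1), where I = αA + βB with α, β > 0, so S = I on the Nehari manifold. The
degrees satisfy 2 < p+1 < q+1; hence a ray through v with C(v) > 0 meets the manifold exactly once,
K is positive before and negative after that point, and S is maximal there along the ray. Since I
increases along rays, K(v) ≤ 0 with v ≠ 0 forces I(v) ≥ μ, strictly if K(v) < 0
(`IsNehariTriple.level_le`). The Sobolev inequality bounds A + B from below on the manifold, whence
μ > 0.

Compactness (`Admissible.exists_tendsto_translate`): I(v_n) → μ bounds the sequence and K(v_n) → 0
keeps C(v_n) away from zero. Some mean over a ball of fixed radius therefore stays large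
(`exists_ballAvg_ge`), and translating that ball to the origin yields a nonzero weak limit v₀. The
functionals split asymptotically into their values at v₀ and at the remainder: by the Brezis–Lieb
lemma for the powers, by Hilbert space geometry for the gradient. If K(v₀) > 0, the remainder has K
< 0, hence I ≥ μ, which leaves nothing for I(v₀) > 0. So K(v₀) ≤ 0 and I(v₀) ≥ μ; then I(v₀) = μ,
K(v₀) = 0 and I of the remainder tends to 0, which is strong convergence.

A minimizer v is critical (`IsNehariTriple.hasFDerivAt_zero`): if t brings v + εw back to the
manifold, then S(tv) ≤ S(v) ≤ S(t(v + εw)), and dividing by ε gives S'(v)w ≥ 0 for every w.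
Conversely, differentiating S along the ray through a critical point gives K = 0. Critical points
thus lie on the manifold and minimizers are critical, so the two levels and the two sets of
minimizers coincide.

The analysis rests on one estimate: a function with gradient in L² differs from its means over balls
of radius ε by O(ε^θ) in subcritical L^σ (`eLpNorm_sub_ballAvg_le`). The Sobolev embedding and
nonvanishing follow from it, and its case σ = 2 gives local compactness. -/

noncomputable section

namespace DoublePowerNLS

variable {N : ℕ}

/-! ### Means over balls. -/

/-- The uniform probability measure on the unit ball. -/
def unitBallMeasure (N : ℕ) : Measure (RN N) :=
  (volume (Metric.ball (0 : RN N) 1))⁻¹ • (volume : Measure (RN N)).restrict (Metric.ball 0 1)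

/-- The constant `|B|⁻¹`. -/
def invBallVolume (N : ℕ) : ℝ≥0∞ := (volume (Metric.ball (0 : RN N) 1))⁻¹

theorem invBallVolume_ne_top : invBallVolume N ≠ ∞ :=
  ENNReal.inv_ne_top.2 (Metric.measure_ball_pos volume _ one_pos).ne'

instance : IsProbabilityMeasure (unitBallMeasure N) := by
  refine ⟨?_⟩
  simp only [unitBallMeasure, Measure.smul_apply, smul_eq_mul, Measure.restrict_apply_univ]
  exact ENNReal.inv_mul_cancel (Metric.measure_ball_pos volume _ one_pos).ne'
    measure_ball_lt_top.ne

theorem ae_unitBallMeasure : ∀ᵐ y ∂(unitBallMeasure N), ‖y‖ < 1 := by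
  refine Measure.ae_smul_measure ?_ _
  filter_upwards [ae_restrict_mem measurableSet_ball] with y hy
  simpa using hy

theorem lintegral_comp_add_smul (F : RN N → ℝ≥0∞) (hF : Measurable F) (x : RN N) {s : ℝ}
    (hs : 0 < s) :
    ∫⁻ y, F (x + s • y) = ENNReal.ofReal (s ^ N)⁻¹ * ∫⁻ z, F z := by
  have h1 : ∫⁻ y, F (x + s • y) = ∫⁻ z, F (x + z) ∂(Measure.map (s • ·) (volume : Measure (RN N))) := by
    rw [lintegral_map (by fun_prop) (by fun_prop)]
  rw [h1, Measure.map_addHaar_smul _ hs.ne', lintegral_smul_measure, lintegral_add_left_eq_self]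
  simp [abs_of_pos hs]

/-- The substitution z = x + sy turns the mean into an integral over the ball of radius s, at the
price of the factor s^(-N). -/
theorem lintegral_unitBallMeasure_le (F : RN N → ℝ≥0∞) (hF : Measurable F) (x : RN N) {s : ℝ}
    (hs : 0 < s) :
    ∫⁻ y, F (x + s • y) ∂(unitBallMeasure N)
      ≤ invBallVolume N * ENNReal.ofReal (s ^ N)⁻¹ * ∫⁻ z in Metric.closedBall x s, F z := by
  rw [unitBallMeasure, lintegral_smul_measure, smul_eq_mul, mul_assoc]
  refine mul_le_mul_right ?_ _
  rw [← lintegral_indicator measurableSet_closedBall, ← lintegral_comp_add_smul _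
    (hF.indicator measurableSet_closedBall) x hs, ← lintegral_indicator measurableSet_ball]
  refine lintegral_mono fun y => ?_
  by_cases hy : y ∈ Metric.ball (0 : RN N) 1
  · rw [Set.indicator_of_mem hy, Set.indicator_of_mem]
    have : ‖y‖ ≤ 1 := by simpa using (Metric.mem_ball.1 hy).le
    simp only [Metric.mem_closedBall, dist_self_add_left, norm_smul, Real.norm_eq_abs, abs_of_pos hs]
    nlinarith
  · rw [Set.indicator_of_notMem hy]; exact zero_le

/-- Tonelli and translation invariance: averaging over shifts preserves the total integral. -/
theorem lintegral_lintegral_unitBallMeasure (F : RN N → ℝ≥0∞) (hF : Measurable F) (s : ℝ) :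
    ∫⁻ x, ∫⁻ y, F (x + s • y) ∂(unitBallMeasure N) = ∫⁻ x, F x := by
  rw [lintegral_lintegral_swap (by fun_prop)]
  simp [lintegral_add_right_eq_self]

/-- The mean of `v` over the ball of radius `ε` about `x`. -/
def ballAvg (ε : ℝ) (v : RN N → ℂ) (x : RN N) : ℂ := ∫ y, v (x + ε • y) ∂(unitBallMeasure N)

theorem integrable_ballAvg {v : RN N → ℂ} (hm : StronglyMeasurable v) (hv : LocallyIntegrable v)
    {ε : ℝ} (hε : 0 < ε) (x : RN N) :
    Integrable (fun y => v (x + ε • y)) (unitBallMeasure N) := by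
  refine ⟨(hm.comp_measurable (by fun_prop)).aestronglyMeasurable, ?_⟩
  refine (lintegral_unitBallMeasure_le (fun z => ‖v z‖ₑ) hm.measurable.enorm x hε).trans_lt ?_
  refine ENNReal.mul_lt_top (ENNReal.mul_lt_top invBallVolume_ne_top.lt_top ENNReal.ofReal_lt_top) ?_
  exact (hv.integrableOn_isCompact (isCompact_closedBall x ε)).2

theorem stronglyMeasurable_ballAvg {v : RN N → ℂ} (hm : StronglyMeasurable v) (ε : ℝ) :
    StronglyMeasurable (ballAvg ε v) := by
  have h : StronglyMeasurable (Function.uncurry fun (x y : RN N) => v (x + ε • y)) :=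
    hm.comp_measurable (by fun_prop)
  exact h.integral_prod_right

/-- Jensen's inequality for powers with respect to a probability measure. -/
theorem lintegral_rpow_le_of_isProbabilityMeasure {α : Type*} [MeasurableSpace α] (P : Measure α)
    [IsProbabilityMeasure P] {f : α → ℝ≥0∞} (hf : AEMeasurable f P) {r : ℝ} (hr : 1 ≤ r) :
    (∫⁻ y, f y ∂P) ^ r ≤ ∫⁻ y, f y ^ r ∂P := by
  have h := eLpNorm_le_eLpNorm_of_exponent_le (μ := P) (f := f) (p := 1) (q := ENNReal.ofReal r)
    (by simpa using hr) hf.aestronglyMeasurable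
  rw [eLpNorm_one_eq_lintegral_enorm, eLpNorm_eq_lintegral_rpow_enorm_toReal
    (by simpa using by linarith) ENNReal.ofReal_ne_top,
    ENNReal.toReal_ofReal (by linarith)] at h
  simp only [enorm_eq_self] at h
  calc _ ≤ _ := ENNReal.rpow_le_rpow h (by linarith)
    _ = _ := by rw [← ENNReal.rpow_mul, one_div, inv_mul_cancel₀ (by linarith), ENNReal.rpow_one]

theorem enorm_ballAvg_le (v : RN N → ℂ) (ε : ℝ) (x : RN N) :
    ‖ballAvg ε v x‖ₑ ≤ ∫⁻ y, ‖v (x + ε • y)‖ₑ ∂(unitBallMeasure N) :=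
  enorm_integral_le_lintegral_enorm _

theorem enorm_ballAvg_rpow_le {v : RN N → ℂ} (hm : StronglyMeasurable v) (ε : ℝ) {r : ℝ}
    (hr : 1 ≤ r) (x : RN N) :
    ‖ballAvg ε v x‖ₑ ^ r ≤ ∫⁻ y, ‖v (x + ε • y)‖ₑ ^ r ∂(unitBallMeasure N) :=
  (ENNReal.rpow_le_rpow (enorm_ballAvg_le v ε x) (by linarith)).trans
    (lintegral_rpow_le_of_isProbabilityMeasure _
      (hm.comp_measurable (by fun_prop)).measurable.enorm.aemeasurable hr)

theorem lintegral_ballAvg_rpow_le {v : RN N → ℂ} (hm : StronglyMeasurable v) (ε : ℝ) {r : ℝ}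
    (hr : 1 ≤ r) : ∫⁻ x, ‖ballAvg ε v x‖ₑ ^ r ≤ ∫⁻ x, ‖v x‖ₑ ^ r :=
  (lintegral_mono fun x => enorm_ballAvg_rpow_le hm ε hr x).trans_eq
    (lintegral_lintegral_unitBallMeasure _ (hm.measurable.enorm.pow_const r) ε)

theorem enorm_ballAvg_rpow_le_lintegral {v : RN N → ℂ} (hm : StronglyMeasurable v) {ε : ℝ}
    (hε : 0 < ε) {r : ℝ} (hr : 1 ≤ r) (x : RN N) :
    ‖ballAvg ε v x‖ₑ ^ r
      ≤ invBallVolume N * ENNReal.ofReal (ε ^ N)⁻¹ * ∫⁻ z, ‖v z‖ₑ ^ r :=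
  (enorm_ballAvg_rpow_le hm ε hr x).trans <|
    (lintegral_unitBallMeasure_le _ (hm.measurable.enorm.pow_const r) x hε).trans
      (mul_le_mul_right (setLIntegral_le_lintegral _ _) _)

/-! ### Approximation of a function by its means, in terms of the gradient. -/

/-- The difference between a `C¹` function and its mean over a ball is controlled by means of the
gradient. -/
theorem enorm_sub_ballAvg_le {u : RN N → ℂ} (hu : ContDiff ℝ 1 u) {ε : ℝ} (hε : 0 < ε) (x : RN N) :
    ‖u x - ballAvg ε u x‖ₑ ≤ ENNReal.ofReal ε * ∫⁻ s in Set.Ioo (0 : ℝ) 1,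
      ∫⁻ y, ‖fderiv ℝ u (x + (s * ε) • y)‖ₑ ∂(unitBallMeasure N) := by
  have hc := hu.continuous_fderiv one_ne_zero
  have hi := integrable_ballAvg hu.continuous.stronglyMeasurable
    (hu.continuous.locallyIntegrable) hε x
  have h1 : ballAvg ε u x - u x = ∫ y, (u (x + ε • y) - u x) ∂(unitBallMeasure N) := by
    rw [integral_sub hi (integrable_const _)]; simp [ballAvg]
  rw [← enorm_neg, neg_sub, h1]
  refine (enorm_integral_le_lintegral_enorm _).trans ?_
  have hmeas : Measurable (Function.uncurry fun (s : ℝ) (y : RN N) =>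
      ‖fderiv ℝ u (x + (s * ε) • y)‖ₑ) := by
    refine Continuous.measurable ?_
    fun_prop
  rw [lintegral_lintegral_swap hmeas.aemeasurable, ← lintegral_const_mul' _ _ ENNReal.ofReal_ne_top]
  refine lintegral_mono_ae ?_
  -- For fixed y the increment is the integral of the derivative along the segment from x to x + εy,
  -- and |y| < 1 bounds the direction by ε.
  filter_upwards [ae_unitBallMeasure] with y hy
  have hder : ∀ s : ℝ, HasDerivAt (fun s : ℝ => u (x + (s * ε) • y))
      (fderiv ℝ u (x + (s * ε) • y) (ε • y)) s := by
    intro s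
    have h2 : HasDerivAt (fun s : ℝ => x + (s * ε) • y) (ε • y) s := by
      simpa using (((hasDerivAt_id s).mul_const ε).smul_const y).const_add x
    exact (hu.differentiable one_ne_zero _).hasFDerivAt.comp_hasDerivAt s h2
  have hcont : Continuous fun s : ℝ => fderiv ℝ u (x + (s * ε) • y) (ε • y) := by fun_prop
  have hftc := intervalIntegral.integral_eq_sub_of_hasDerivAt (a := 0) (b := 1)
    (fun s _ => hder s) (hcont.intervalIntegrable _ _)
  simp only [one_mul, zero_mul, zero_smul, add_zero] at hftc
  rw [← hftc, intervalIntegral.integral_of_le zero_le_one, integral_Ioc_eq_integral_Ioo]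
  refine (enorm_integral_le_lintegral_enorm _).trans ?_
  rw [← lintegral_const_mul' _ _ ENNReal.ofReal_ne_top]
  refine lintegral_mono fun s => ?_
  refine (ContinuousLinearMap.le_opENorm _ _).trans ?_
  rw [mul_comm]
  refine mul_le_mul_left ?_ _
  rw [← ofReal_norm]
  refine ENNReal.ofReal_le_ofReal ?_
  rw [norm_smul, Real.norm_eq_abs, abs_of_pos hε]
  nlinarith

/-- Hölder's inequality on the unit interval with a power weight. -/
theorem lintegral_unitInterval_rpow_le {σ b : ℝ} (hσ : 1 < σ) (hb : b < σ - 1) :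
    ∃ K : ℝ≥0∞, K ≠ ∞ ∧ ∀ a : ℝ → ℝ≥0∞, Measurable a →
      (∫⁻ s in Set.Ioo (0 : ℝ) 1, a s) ^ σ
        ≤ K * ∫⁻ s in Set.Ioo (0 : ℝ) 1, ENNReal.ofReal (s ^ b) * a s ^ σ := by
  have hσ0 : 0 < σ := by linarith
  have hconj : (σ.conjExponent).HolderConjugate σ := (Real.HolderConjugate.conjExponent hσ).symm
  set τ := σ.conjExponent with hτ
  have hτ0 : 0 < τ := hconj.pos
  refine ⟨(∫⁻ s in Set.Ioo (0 : ℝ) 1, ENNReal.ofReal (s ^ (-(b / σ))) ^ τ) ^ (σ / τ), ?_, ?_⟩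
  · refine ENNReal.rpow_ne_top_of_nonneg (by positivity) ?_
    have h1 : ∫⁻ s in Set.Ioo (0 : ℝ) 1, ENNReal.ofReal (s ^ (-(b / σ))) ^ τ
        = ∫⁻ s in Set.Ioo (0 : ℝ) 1, ENNReal.ofReal (s ^ (-(b / σ) * τ)) := by
      refine setLIntegral_congr_fun measurableSet_Ioo fun s hs => ?_
      rw [ENNReal.ofReal_rpow_of_pos (Real.rpow_pos_of_pos hs.1 _), ← Real.rpow_mul hs.1.le]
    rw [h1]
    -- The dual weight has exponent -b/(σ-1), which is integrable at 0 exactly when b < σ - 1.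
    have h2 : -1 < -(b / σ) * τ := by
      have : τ = σ / (σ - 1) := by rw [hτ]; rfl
      rw [this, show -(b / σ) * (σ / (σ - 1)) = -(b / (σ - 1)) by field_simp]
      have : b / (σ - 1) < 1 := by rw [div_lt_one (by linarith)]; exact hb
      linarith
    have h3 := (intervalIntegral.integrableOn_Ioo_rpow_iff (s := -(b / σ) * τ) one_pos).2 h2
    refine (lt_of_le_of_lt (lintegral_mono fun s => ?_) h3.2).ne
    exact Real.ofReal_le_enorm _
  · intro a ha
    have h := ENNReal.lintegral_mul_le_Lp_mul_Lq (volume.restrict (Set.Ioo (0 : ℝ) 1)) hconj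
      (f := fun s => ENNReal.ofReal (s ^ (-(b / σ)))) (g := fun s => ENNReal.ofReal (s ^ (b / σ)) * a s)
      (by fun_prop) (by fun_prop)
    have h1 : ∫⁻ s in Set.Ioo (0 : ℝ) 1, a s = ∫⁻ s in Set.Ioo (0 : ℝ) 1,
        ((fun s => ENNReal.ofReal (s ^ (-(b / σ)))) *
          fun s => ENNReal.ofReal (s ^ (b / σ)) * a s) s := by
      refine setLIntegral_congr_fun measurableSet_Ioo fun s hs => ?_
      simp only [Pi.mul_apply]
      rw [← mul_assoc, ← ENNReal.ofReal_mul (Real.rpow_pos_of_pos hs.1 _).le,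
        ← Real.rpow_add hs.1]
      simp
    have h2 : ∫⁻ s in Set.Ioo (0 : ℝ) 1, ENNReal.ofReal (s ^ b) * a s ^ σ
        = ∫⁻ s in Set.Ioo (0 : ℝ) 1, (ENNReal.ofReal (s ^ (b / σ)) * a s) ^ σ := by
      refine setLIntegral_congr_fun measurableSet_Ioo fun s hs => ?_
      rw [ENNReal.mul_rpow_of_nonneg _ _ hσ0.le,
        ENNReal.ofReal_rpow_of_pos (Real.rpow_pos_of_pos hs.1 _), ← Real.rpow_mul hs.1.le,
        div_mul_cancel₀ _ hσ0.ne']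
    rw [h1, h2]
    refine (ENNReal.rpow_le_rpow h hσ0.le).trans_eq ?_
    rw [ENNReal.mul_rpow_of_nonneg _ _ hσ0.le, ← ENNReal.rpow_mul, ← ENNReal.rpow_mul]
    congr 2
    · field_simp
    · rw [one_div, inv_mul_cancel₀ hσ0.ne', ENNReal.rpow_one]

-- Let a(s,x) be the mean of |∇u| over the ball of radius sε. By Jensen, a² is bounded pointwise by
-- a multiple of (sε)^(-N)‖∇u‖², and its integral over x by ‖∇u‖². Writing a^σ = (a²)^k a² with k =
-- (σ-2)/2, the integral of a^σ is at most a multiple of (sε)^(-τ)‖∇u‖^σ, τ = Nk. Subcriticality τ <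
-- σ is what makes the remaining integral over s in (0,1) converge.
set_option maxHeartbeats 1000000 in
theorem lintegral_sub_ballAvg_rpow_le_of_contDiff {σ : ℝ} (hσ : 2 ≤ σ)
    (hsub : (N : ℝ) * ((σ - 2) / 2) < σ) :
    ∃ C : ℝ≥0∞, C ≠ ∞ ∧ ∀ ε : ℝ, 0 < ε → ∀ u : RN N → ℂ, ContDiff ℝ 1 u →
      ∫⁻ x, ‖u x - ballAvg ε u x‖ₑ ^ σ
        ≤ C * ENNReal.ofReal (ε ^ (σ - N * ((σ - 2) / 2)))
          * (∫⁻ x, ‖fderiv ℝ u x‖ₑ ^ (2 : ℝ)) ^ (σ / 2) := by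
  set τ : ℝ := N * ((σ - 2) / 2) with hτ
  set k : ℝ := (σ - 2) / 2 with hk
  have hk0 : 0 ≤ k := by rw [hk]; linarith
  have hσ0 : 0 < σ := by linarith
  -- Midway between τ - 1 and σ - 1: b < σ - 1 is needed for Hölder in s, and b - τ > -1 for the
  -- integrability of s^(b-τ). Both amount to τ < σ.
  set b : ℝ := (τ + σ) / 2 - 1 with hb
  obtain ⟨K, hK, hKle⟩ := lintegral_unitInterval_rpow_le (σ := σ) (b := b) (by linarith)
    (by rw [hb]; linarith)
  set J : ℝ≥0∞ := ∫⁻ s in Set.Ioo (0 : ℝ) 1, ENNReal.ofReal (s ^ (b - τ)) with hJ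
  have hJtop : J ≠ ∞ := by
    have h2 : -1 < b - τ := by rw [hb]; linarith
    have h3 := (intervalIntegral.integrableOn_Ioo_rpow_iff (s := b - τ) one_pos).2 h2
    exact (lt_of_le_of_lt (lintegral_mono fun s => Real.ofReal_le_enorm _) h3.2).ne
  refine ⟨K * invBallVolume N ^ k * J, ENNReal.mul_ne_top (ENNReal.mul_ne_top hK
    (ENNReal.rpow_ne_top_of_nonneg hk0 invBallVolume_ne_top)) hJtop, ?_⟩
  intro ε hε u hu
  have hc := hu.continuous_fderiv one_ne_zero
  set H : ℝ≥0∞ := ∫⁻ x, ‖fderiv ℝ u x‖ₑ ^ (2 : ℝ) with hH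
  set a : ℝ → RN N → ℝ≥0∞ := fun s x =>
    ∫⁻ y, ‖fderiv ℝ u (x + (s * ε) • y)‖ₑ ∂(unitBallMeasure N) with ha
  have hameas : Measurable (Function.uncurry a) := by
    have : Measurable (fun w : (ℝ × RN N) × RN N =>
        ‖fderiv ℝ u (w.1.2 + (w.1.1 * ε) • w.2)‖ₑ) := by
      refine Continuous.measurable ?_
      fun_prop
    exact this.lintegral_prod_right'
  have hsq : ∀ s x, a s x ^ (2 : ℝ)
      ≤ ∫⁻ y, ‖fderiv ℝ u (x + (s * ε) • y)‖ₑ ^ (2 : ℝ) ∂(unitBallMeasure N) := fun s x =>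
    lintegral_rpow_le_of_isProbabilityMeasure _
      (Continuous.measurable (by fun_prop)).aemeasurable one_le_two
  have hm2 : Measurable fun x => ‖fderiv ℝ u x‖ₑ ^ (2 : ℝ) :=
    (Continuous.measurable (by fun_prop)).pow_const _
  have hsup : ∀ s ∈ Set.Ioo (0 : ℝ) 1, ∀ x, a s x ^ (2 : ℝ)
      ≤ invBallVolume N * ENNReal.ofReal ((s * ε) ^ N)⁻¹ * H := fun s hs x =>
    (hsq s x).trans ((lintegral_unitBallMeasure_le _ hm2 x (mul_pos hs.1 hε)).trans
      (mul_le_mul_right (setLIntegral_le_lintegral _ _) _))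
  have hint : ∀ s ∈ Set.Ioo (0 : ℝ) 1, ∫⁻ x, a s x ^ σ
      ≤ invBallVolume N ^ k * ENNReal.ofReal (s ^ (-τ)) * ENNReal.ofReal (ε ^ (-τ)) * H ^ (σ / 2) := by
    intro s hs
    have h1 : ∀ x, a s x ^ σ
        ≤ (invBallVolume N * ENNReal.ofReal ((s * ε) ^ N)⁻¹ * H) ^ k
          * ∫⁻ y, ‖fderiv ℝ u (x + (s * ε) • y)‖ₑ ^ (2 : ℝ) ∂(unitBallMeasure N) := by
      intro x
      have : a s x ^ σ = (a s x ^ (2 : ℝ)) ^ k * a s x ^ (2 : ℝ) := by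
        rw [← ENNReal.rpow_mul, ← ENNReal.rpow_add_of_nonneg _ _ (by positivity) (by norm_num)]
        congr 1; rw [hk]; ring
      rw [this]
      exact mul_le_mul' (ENNReal.rpow_le_rpow (hsup s hs x) hk0) (hsq s x)
    refine (lintegral_mono h1).trans ?_
    have hmm : Measurable fun x : RN N => ∫⁻ y, ‖fderiv ℝ u (x + (s * ε) • y)‖ₑ ^ (2 : ℝ)
        ∂(unitBallMeasure N) := by
      have : Measurable (fun w : RN N × RN N =>
        ‖fderiv ℝ u (w.1 + (s * ε) • w.2)‖ₑ ^ (2 : ℝ)) :=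
          (Continuous.measurable (by fun_prop)).pow_const _
      exact this.lintegral_prod_right'
    rw [lintegral_const_mul _ hmm, lintegral_lintegral_unitBallMeasure _ hm2,
      ENNReal.mul_rpow_of_nonneg _ _ hk0, ENNReal.mul_rpow_of_nonneg _ _ hk0, mul_assoc, ← hH]
    have h3 : H ^ k * H = H ^ (σ / 2) := by
      nth_rewrite 2 [← ENNReal.rpow_one H]
      rw [← ENNReal.rpow_add_of_nonneg _ _ hk0 zero_le_one]
      congr 1; rw [hk]; ring
    have hsε : 0 < s * ε := mul_pos hs.1 hε
    have h4 : ENNReal.ofReal ((s * ε) ^ N)⁻¹ ^ k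
        = ENNReal.ofReal (s ^ (-τ)) * ENNReal.ofReal (ε ^ (-τ)) := by
      rw [ENNReal.ofReal_rpow_of_pos (by positivity), ← ENNReal.ofReal_mul
        (Real.rpow_nonneg hs.1.le _), ← Real.mul_rpow hs.1.le hε.le, ← Real.rpow_natCast,
        ← Real.rpow_neg hsε.le, ← Real.rpow_mul hsε.le, hτ]
      congr 2; ring
    rw [h3, h4]
    simp only [mul_assoc, le_refl]
  have hmain : ∀ x, ‖u x - ballAvg ε u x‖ₑ ^ σ ≤ ENNReal.ofReal (ε ^ σ) * (K *
      ∫⁻ s in Set.Ioo (0 : ℝ) 1, ENNReal.ofReal (s ^ b) * a s x ^ σ) := by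
    intro x
    refine (ENNReal.rpow_le_rpow (enorm_sub_ballAvg_le hu hε x) hσ0.le).trans ?_
    rw [ENNReal.mul_rpow_of_nonneg _ _ hσ0.le, ENNReal.ofReal_rpow_of_pos hε]
    exact mul_le_mul_right (hKle (fun s => a s x) hameas.of_uncurry_right) _
  refine (lintegral_mono hmain).trans ?_
  have hm3 : Measurable (Function.uncurry fun (x : RN N) (s : ℝ) =>
      ENNReal.ofReal (s ^ b) * a s x ^ σ) := by
    refine Measurable.mul (by fun_prop) ((hameas.comp measurable_swap).pow_const _)
  rw [lintegral_const_mul' _ _ ENNReal.ofReal_ne_top, lintegral_const_mul' _ _ hK,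
    lintegral_lintegral_swap hm3.aemeasurable]
  have h5 : ∫⁻ s in Set.Ioo (0 : ℝ) 1, ∫⁻ x, ENNReal.ofReal (s ^ b) * a s x ^ σ
      ≤ ∫⁻ s in Set.Ioo (0 : ℝ) 1, ENNReal.ofReal (s ^ (b - τ)) *
        (invBallVolume N ^ k * ENNReal.ofReal (ε ^ (-τ)) * H ^ (σ / 2)) := by
    refine setLIntegral_mono' measurableSet_Ioo fun s hs => ?_
    rw [lintegral_const_mul' _ _ ENNReal.ofReal_ne_top]
    refine (mul_le_mul_right (hint s hs) _).trans_eq ?_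
    rw [sub_eq_add_neg, Real.rpow_add hs.1, ENNReal.ofReal_mul (Real.rpow_nonneg hs.1.le _)]
    ring
  rw [lintegral_mul_const _ (by fun_prop)] at h5
  refine (mul_le_mul_right (mul_le_mul_right h5 _) _).trans_eq ?_
  rw [← hJ, sub_eq_add_neg σ τ, Real.rpow_add hε, ENNReal.ofReal_mul (Real.rpow_nonneg hε.le _)]
  ring

/-! ### Mollification, to pass from C¹ functions to weak gradients. -/

open ContinuousLinearMap in
/-- Mollification turns a weak gradient into a classical one, without increasing its `L²` norm. -/
theorem lintegral_fderiv_mollify_le {v : RN N → ℂ} {g : RN N → EuclideanSpace ℂ (Fin N)}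
    (hv : LocallyIntegrable v) (hgm : StronglyMeasurable g) (hg : LocallyIntegrable g)
    (hw : IsWeakGradient v g) (φ : ContDiffBump (0 : RN N)) :
    ContDiff ℝ 1 (convolution (φ.normed volume) v (lsmul ℝ ℝ) volume) ∧
    ∫⁻ x, ‖fderiv ℝ (convolution (φ.normed volume) v (lsmul ℝ ℝ) volume) x‖ₑ ^ (2 : ℝ)
      ≤ ∫⁻ x, ‖g x‖ₑ ^ (2 : ℝ) := by
  have hcs : HasCompactSupport (φ.normed volume) := φ.hasCompactSupport_normed
  have hsm : ContDiff ℝ ((⊤ : ℕ∞) : WithTop ℕ∞) (φ.normed volume) := φ.contDiff_normed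
  have hsm1 : ContDiff ℝ 1 (φ.normed (volume : Measure (RN N))) := φ.contDiff_normed
  refine ⟨hcs.contDiff_convolution_left _ hsm1 hv, ?_⟩
  set G : RN N → EuclideanSpace ℂ (Fin N) := fun x =>
    ∫ z, φ.normed volume (x - z) • g z with hG
  have hint : ∀ x, Integrable fun z => φ.normed volume (x - z) • g z := fun x =>
    hg.integrable_smul_left_of_hasCompactSupport (hsm.continuous.comp (by fun_prop))
      (hcs.comp_homeomorph (Homeomorph.subLeft x))
  have hfd : ∀ x i, fderiv ℝ (convolution (φ.normed volume) v (lsmul ℝ ℝ) volume) x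
      (EuclideanSpace.single i (1 : ℝ)) = G x i := by
    intro x i
    have h1 := hcs.hasFDerivAt_convolution_left (lsmul ℝ ℝ : ℝ →L[ℝ] ℂ →L[ℝ] ℂ) hsm1 hv x
    rw [h1.fderiv]
    have hψ : ContDiff ℝ ((⊤ : ℕ∞) : WithTop ℕ∞) (fun z => φ.normed volume (x - z)) :=
      hsm.comp (contDiff_const.sub contDiff_id)
    have hψc : HasCompactSupport (fun z => φ.normed volume (x - z)) :=
      hcs.comp_homeomorph (Homeomorph.subLeft x)
    -- The test function is the reflected kernel z ↦ φ(x - z); the sign from its derivative cancels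
    -- the sign in the definition of the weak gradient.
    have key := hw _ hψ hψc i
    have h2 : G x i = ∫ z, φ.normed volume (x - z) • g z i := by
      have := (EuclideanSpace.proj i : EuclideanSpace ℂ (Fin N) →L[ℂ] ℂ).restrictScalars
        ℝ |>.integral_comp_comm (hint x)
      simpa using this.symm
    rw [h2, ← neg_eq_iff_eq_neg.2 key, convolution_eq_swap, ← integral_neg,
      ContinuousLinearMap.integral_apply]
    · refine integral_congr_ae (Eventually.of_forall fun z => ?_)
      have h3 : fderiv ℝ (fun z => φ.normed volume (x - z)) z
          = - fderiv ℝ (φ.normed volume) (x - z) := by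
        have h5 := (hsm1.differentiable one_ne_zero (x - z)).hasFDerivAt.comp z
          ((hasFDerivAt_id z).const_sub x)
        refine h5.fderiv.trans ?_
        ext w; simp
      simp [h3]
    · have := (hcs.fderiv ℝ).convolutionExists_left ((lsmul ℝ ℝ : ℝ →L[ℝ] ℂ →L[ℝ] ℂ).precompL (RN N))
        (hsm.continuous_fderiv (by simp)) hv x
      exact this.integrable_swap
  have hle : ∀ x, ‖fderiv ℝ (convolution (φ.normed volume) v (lsmul ℝ ℝ) volume) x‖ ≤ ‖G x‖ := by
    intro x
    refine ContinuousLinearMap.opNorm_le_bound _ (norm_nonneg _) fun w => ?_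
    have hwx : w = ∑ i, w i • EuclideanSpace.single i (1 : ℝ) := by
      ext j; simp [Finset.sum_apply, Pi.single_apply]
    have h4 : fderiv ℝ (convolution (φ.normed volume) v (lsmul ℝ ℝ) volume) x w
        = ∑ i, w i • G x i := by
      conv_lhs => rw [hwx, map_sum]
      simp only [map_smul, hfd]
    rw [h4]
    refine (norm_sum_le _ _).trans ?_
    simp only [norm_smul]
    rw [mul_comm, EuclideanSpace.norm_eq, EuclideanSpace.norm_eq]
    exact Real.sum_mul_le_sqrt_mul_sqrt _ _ _
  -- The mollifier is regarded as a probability measure, so that Jensen followed by Tonelli gives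
  -- the L² contraction with constant exactly 1.
  set P : Measure (RN N) := volume.withDensity fun z => ENNReal.ofReal (φ.normed volume z) with hP
  have hmφ : Measurable fun z => ENNReal.ofReal (φ.normed (volume : Measure (RN N)) z) :=
    hsm.continuous.measurable.ennreal_ofReal
  have : IsProbabilityMeasure P := by
    refine ⟨?_⟩
    rw [hP, withDensity_apply _ MeasurableSet.univ, Measure.restrict_univ,
      ← ofReal_integral_eq_lintegral_ofReal φ.integrable_normed
        (Eventually.of_forall φ.nonneg_normed), φ.integral_normed, ENNReal.ofReal_one]
  have hGle : ∀ x, ‖G x‖ₑ ^ (2 : ℝ) ≤ ∫⁻ z, ‖g (x - z)‖ₑ ^ (2 : ℝ) ∂P := by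
    intro x
    refine le_trans (ENNReal.rpow_le_rpow ?_ zero_le_two)
      (lintegral_rpow_le_of_isProbabilityMeasure P (f := fun z => ‖g (x - z)‖ₑ)
      (hgm.measurable.comp (by fun_prop)).enorm.aemeasurable one_le_two)
    refine (enorm_integral_le_lintegral_enorm _).trans ?_
    have hgx : Measurable fun z => ‖g (x - z)‖ₑ :=
      (hgm.measurable.comp (measurable_const.sub measurable_id)).enorm
    rw [hP, lintegral_withDensity_eq_lintegral_mul _ hmφ hgx,
      ← lintegral_sub_left_eq_self _ x]
    refine lintegral_mono fun z => ?_
    simp only [enorm_smul, Pi.mul_apply, sub_sub_cancel]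
    rw [Real.enorm_of_nonneg (φ.nonneg_normed _)]
  calc _ ≤ ∫⁻ x, ∫⁻ z, ‖g (x - z)‖ₑ ^ (2 : ℝ) ∂P := by
        refine lintegral_mono fun x => le_trans (ENNReal.rpow_le_rpow ?_ zero_le_two) (hGle x)
        exact enorm_le_iff_norm_le.2 (hle x)
    _ = _ := by
        rw [lintegral_lintegral_swap]
        · simp only [lintegral_sub_right_eq_self (fun x => ‖g x‖ₑ ^ (2 : ℝ)), lintegral_const,
            measure_univ, mul_one]
        · exact ((hgm.measurable.comp (measurable_fst.sub measurable_snd)).enorm.pow_const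
            _).aemeasurable

theorem locallyIntegrable_ballAvg {v : RN N → ℂ} (hm : StronglyMeasurable v)
    (hv : LocallyIntegrable v) (ε : ℝ) : LocallyIntegrable (ballAvg ε v) := by
  refine locallyIntegrable_iff.2 fun k hk => ?_
  refine ⟨(stronglyMeasurable_ballAvg hm ε).aestronglyMeasurable, ?_⟩
  obtain ⟨R, hR⟩ := hk.isBounded.subset_closedBall 0
  have hmv := hm.measurable
  calc ∫⁻ x in k, ‖ballAvg ε v x‖ₑ
      ≤ ∫⁻ x in k, ∫⁻ y, ‖v (x + ε • y)‖ₑ ∂(unitBallMeasure N) :=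
        lintegral_mono fun x => enorm_ballAvg_le v ε x
    _ = ∫⁻ y, (∫⁻ x in k, ‖v (x + ε • y)‖ₑ) ∂(unitBallMeasure N) :=
        lintegral_lintegral_swap (by fun_prop)
    _ ≤ ∫⁻ _, (∫⁻ x in Metric.closedBall 0 (R + |ε|), ‖v x‖ₑ) ∂(unitBallMeasure N) := by
        refine lintegral_mono_ae ?_
        filter_upwards [ae_unitBallMeasure] with y hy
        rw [← lintegral_indicator hk.measurableSet, ← lintegral_indicator measurableSet_closedBall,
          ← lintegral_add_right_eq_self ((Metric.closedBall 0 (R + |ε|)).indicator _) (ε • y)]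
        refine lintegral_mono fun x => ?_
        by_cases hx : x ∈ k
        · have h1 : ‖x‖ ≤ R := by simpa using hR hx
          rw [Set.indicator_of_mem hx, Set.indicator_of_mem]
          simp only [Metric.mem_closedBall, dist_zero_right]
          refine (norm_add_le _ _).trans (add_le_add h1 ?_)
          rw [norm_smul, Real.norm_eq_abs]
          nlinarith [abs_nonneg ε]
        · rw [Set.indicator_of_notMem hx]; exact zero_le
    _ < ∞ := by
        rw [lintegral_const, measure_univ, mul_one]
        exact (hv.integrableOn_isCompact (isCompact_closedBall 0 (R + |ε|))).2

open ContinuousLinearMap in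
/-- Means over balls commute with mollification. -/
theorem ballAvg_mollify {v : RN N → ℂ} (hm : StronglyMeasurable v) (hv : LocallyIntegrable v)
    (ε : ℝ) (φ : ContDiffBump (0 : RN N)) (x : RN N) :
    ballAvg ε (convolution (φ.normed volume) v (lsmul ℝ ℝ) volume) x
      = convolution (φ.normed volume) (ballAvg ε v) (lsmul ℝ ℝ) volume x := by
  simp only [ballAvg, convolution, lsmul_apply]
  have hmv := hm.measurable
  have hcφ : Continuous (φ.normed (volume : Measure (RN N))) := φ.continuous_normed
  have hmφ := hcφ.measurable
  rw [integral_integral_swap]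
  · refine integral_congr_ae (Eventually.of_forall fun z => ?_)
    simp only [integral_smul]
    congr 1
    refine integral_congr_ae (Eventually.of_forall fun y => ?_)
    simp only [sub_add_eq_add_sub]
  · have hmeas : Measurable (Function.uncurry fun (y z : RN N) =>
        φ.normed volume z • v (x + ε • y - z)) := by fun_prop
    refine ⟨hmeas.aestronglyMeasurable, ?_⟩
    unfold HasFiniteIntegral
    rw [lintegral_prod _ hmeas.enorm.aemeasurable]
    obtain ⟨M, hM⟩ := hcφ.bounded_above_of_compact_support φ.hasCompactSupport_normed
    have hfin : ∫⁻ w in Metric.closedBall x (|ε| + φ.rOut), ‖v w‖ₑ < ∞ :=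
      (hv.integrableOn_isCompact (isCompact_closedBall x _)).2
    refine lt_of_le_of_lt (b := ∫⁻ _ : RN N, (ENNReal.ofReal M *
      ∫⁻ w in Metric.closedBall x (|ε| + φ.rOut), ‖v w‖ₑ) ∂(unitBallMeasure N)) ?_ ?_
    · refine lintegral_mono_ae ?_
      filter_upwards [ae_unitBallMeasure] with y hy
      rw [← lintegral_const_mul' _ _ ENNReal.ofReal_ne_top,
        ← lintegral_indicator measurableSet_closedBall,
        ← lintegral_sub_left_eq_self
          ((Metric.closedBall x (|ε| + φ.rOut)).indicator _) (x + ε • y)]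
      refine lintegral_mono fun z => ?_
      simp only [Function.uncurry_apply_pair, enorm_smul]
      by_cases hz : z ∈ Metric.ball (0 : RN N) φ.rOut
      · rw [Set.indicator_of_mem]
        · refine mul_le_mul_left ?_ _
          rw [← ofReal_norm]
          exact ENNReal.ofReal_le_ofReal (hM z)
        · rw [Metric.mem_ball, dist_zero_right] at hz
          rw [Metric.mem_closedBall, dist_eq_norm, show x + ε • y - z - x = ε • y - z by abel]
          refine (norm_sub_le _ _).trans (add_le_add ?_ hz.le)
          rw [norm_smul, Real.norm_eq_abs]
          nlinarith [abs_nonneg ε]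
      · have : φ.normed (volume : Measure (RN N)) z = 0 := by
          rw [← Function.notMem_support, φ.support_normed_eq]; exact hz
        simp [this]
    · simp only [lintegral_const, measure_univ, mul_one]
      exact ENNReal.mul_lt_top ENNReal.ofReal_lt_top hfin

/-! ### The Sobolev inequality and nonvanishing. -/

/-- Data of a locally integrable function with a weak gradient in `L²`. -/
structure HasL2Gradient (v : RN N → ℂ) (g : RN N → EuclideanSpace ℂ (Fin N)) : Prop where
  measurable : StronglyMeasurable v
  locallyIntegrable : LocallyIntegrable v
  memLp : MemLp g 2
  stronglyMeasurable_grad : StronglyMeasurable g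
  isWeakGradient : IsWeakGradient v g

theorem eLpNorm_two_eq {E : Type*} [NormedAddCommGroup E] (g : RN N → E) :
    eLpNorm g 2 volume = (∫⁻ x, ‖g x‖ₑ ^ (2 : ℝ)) ^ (1 / 2 : ℝ) := by
  rw [eLpNorm_eq_lintegral_rpow_enorm_toReal two_ne_zero ENNReal.ofNat_ne_top]; simp

theorem eLpNorm_ofReal_eq {α E : Type*} [MeasurableSpace α] {μ : Measure α} [NormedAddCommGroup E]
    (g : α → E) {σ : ℝ} (hσ : 0 < σ) :
    eLpNorm g (ENNReal.ofReal σ) μ = (∫⁻ x, ‖g x‖ₑ ^ σ ∂μ) ^ (1 / σ) := by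
  rw [eLpNorm_eq_lintegral_rpow_enorm_toReal (by simpa using hσ) ENNReal.ofReal_ne_top,
    ENNReal.toReal_ofReal hσ.le]

/-- A function with a gradient in `L²` is uniformly approximated in `L^σ`, for subcritical `σ`, by
its means over small balls. -/
theorem eLpNorm_sub_ballAvg_le {σ : ℝ} (hσ : 2 ≤ σ) (hsub : (N : ℝ) * ((σ - 2) / 2) < σ) :
    ∃ C : ℝ≥0∞, C ≠ ∞ ∧ ∃ θ : ℝ, 0 < θ ∧ ∀ ε : ℝ, 0 < ε →
      ∀ (v : RN N → ℂ) (g : RN N → EuclideanSpace ℂ (Fin N)), HasL2Gradient v g →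
      eLpNorm (fun x => v x - ballAvg ε v x) (ENNReal.ofReal σ) volume
        ≤ C * ENNReal.ofReal (ε ^ θ) * eLpNorm g 2 volume := by
  obtain ⟨C, hC, h⟩ := lintegral_sub_ballAvg_rpow_le_of_contDiff hσ hsub
  have hσ0 : 0 < σ := by linarith
  refine ⟨C ^ (1 / σ), ENNReal.rpow_ne_top_of_nonneg (by positivity) hC,
    (σ - N * ((σ - 2) / 2)) * (1 / σ), mul_pos (by linarith) (by positivity), ?_⟩
  intro ε hε v g hvg
  obtain ⟨hm, hv, hg, hgm, hw⟩ := hvg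
  have hgl : LocallyIntegrable g := hg.locallyIntegrable one_le_two
  -- The ratio of outer to inner radius is fixed at 2: a bounded ratio is what gives almost
  -- everywhere convergence for merely locally integrable functions.
  let φ : ℕ → ContDiffBump (0 : RN N) := fun n =>
    ⟨1 / ((n : ℝ) + 1), 2 / ((n : ℝ) + 1), by positivity, by gcongr; norm_num⟩
  have hφ : Tendsto (fun n => (φ n).rOut) atTop (𝓝 0) := by
    have := (tendsto_one_div_add_atTop_nhds_zero_nat (𝕜 := ℝ)).const_mul 2
    simpa [φ, mul_one_div, div_eq_mul_inv] using this
  have hφ' : ∀ᶠ n in atTop, (φ n).rOut ≤ 2 * (φ n).rIn :=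
    Eventually.of_forall fun n => by simp [φ, div_eq_mul_inv]
  set u : ℕ → RN N → ℂ := fun n =>
    convolution ((φ n).normed volume) v (ContinuousLinearMap.lsmul ℝ ℝ) volume with hu
  have hlim1 := ContDiffBump.ae_convolution_tendsto_right_of_locallyIntegrable hφ hφ' hv
  have hlim2 := ContDiffBump.ae_convolution_tendsto_right_of_locallyIntegrable hφ hφ'
    (locallyIntegrable_ballAvg hm hv ε)
  set H : ℝ≥0∞ := ∫⁻ x, ‖g x‖ₑ ^ (2 : ℝ) with hH
  have hbound : ∀ n, ∫⁻ x, ‖u n x - ballAvg ε (u n) x‖ₑ ^ σ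
      ≤ C * ENNReal.ofReal (ε ^ (σ - N * ((σ - 2) / 2))) * H ^ (σ / 2) := by
    intro n
    obtain ⟨h1, h2⟩ := lintegral_fderiv_mollify_le hv hgm hgl hw (φ n)
    exact (h ε hε _ h1).trans (mul_le_mul_right (ENNReal.rpow_le_rpow h2 (by positivity)) _)
  -- Means commute with mollification, so the mollified differences converge almost everywhere and
  -- Fatou carries over the uniform bound.
  have hfatou : ∫⁻ x, ‖v x - ballAvg ε v x‖ₑ ^ σ
      ≤ C * ENNReal.ofReal (ε ^ (σ - N * ((σ - 2) / 2))) * H ^ (σ / 2) := by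
    calc ∫⁻ x, ‖v x - ballAvg ε v x‖ₑ ^ σ
        = ∫⁻ x, liminf (fun n => ‖u n x - ballAvg ε (u n) x‖ₑ ^ σ) atTop := by
          refine lintegral_congr_ae ?_
          filter_upwards [hlim1, hlim2] with x h1 h2
          refine (Tendsto.liminf_eq ?_).symm
          refine (ENNReal.continuous_rpow_const.tendsto _).comp
            ((continuous_enorm.tendsto _).comp (h1.sub ?_))
          refine h2.congr fun n => ?_
          rw [hu, ballAvg_mollify hm hv]
      _ ≤ liminf (fun n => ∫⁻ x, ‖u n x - ballAvg ε (u n) x‖ₑ ^ σ) atTop := by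
          refine lintegral_liminf_le fun n => ?_
          have h1 := (lintegral_fderiv_mollify_le hv hgm hgl hw (φ n)).1.continuous
          exact (h1.measurable.sub
            (stronglyMeasurable_ballAvg h1.stronglyMeasurable ε).measurable).enorm.pow_const _
      _ ≤ _ := by
          refine liminf_le_of_frequently_le' (Frequently.of_forall hbound)
  rw [eLpNorm_ofReal_eq _ hσ0, eLpNorm_two_eq]
  refine (ENNReal.rpow_le_rpow hfatou (by positivity)).trans_eq ?_
  rw [ENNReal.mul_rpow_of_nonneg _ _ (by positivity), ENNReal.mul_rpow_of_nonneg _ _ (by positivity),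
    ENNReal.ofReal_rpow_of_pos (Real.rpow_pos_of_pos hε _), ← Real.rpow_mul hε.le,
    ← ENNReal.rpow_mul]
  congr 2
  field_simp

/-- Interpolation of the mean between `L^r` and `L^∞`. -/
theorem eLpNorm_ballAvg_le_of_bound {v : RN N → ℂ} (hm : StronglyMeasurable v) {r σ : ℝ}
    (hr : 1 ≤ r) (hrσ : r ≤ σ) (ε : ℝ) {S : ℝ≥0∞} (hS : ∀ x, ‖ballAvg ε v x‖ₑ ≤ S) :
    eLpNorm (ballAvg ε v) (ENNReal.ofReal σ) volume
      ≤ S ^ ((σ - r) / σ) * eLpNorm v (ENNReal.ofReal r) volume ^ (r / σ) := by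
  have hr0 : 0 < r := by linarith
  have hσ0 : 0 < σ := by linarith
  rw [eLpNorm_ofReal_eq _ hr0, eLpNorm_ofReal_eq _ hσ0]
  have h1 : ∫⁻ x, ‖ballAvg ε v x‖ₑ ^ σ ≤ S ^ (σ - r) * ∫⁻ x, ‖v x‖ₑ ^ r := by
    calc ∫⁻ x, ‖ballAvg ε v x‖ₑ ^ σ ≤ ∫⁻ x, S ^ (σ - r) * ‖ballAvg ε v x‖ₑ ^ r := by
          refine lintegral_mono fun x => ?_
          have : ‖ballAvg ε v x‖ₑ ^ σ = ‖ballAvg ε v x‖ₑ ^ (σ - r) * ‖ballAvg ε v x‖ₑ ^ r := by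
            rw [← ENNReal.rpow_add_of_nonneg _ _ (by linarith) hr0.le, sub_add_cancel]
          simp only [this]
          exact mul_le_mul_left (ENNReal.rpow_le_rpow (hS x) (by linarith)) _
      _ = S ^ (σ - r) * ∫⁻ x, ‖ballAvg ε v x‖ₑ ^ r :=
          lintegral_const_mul _ ((stronglyMeasurable_ballAvg hm ε).measurable.enorm.pow_const _)
      _ ≤ _ := mul_le_mul_right (lintegral_ballAvg_rpow_le hm ε hr) _
  refine (ENNReal.rpow_le_rpow h1 (by positivity)).trans_eq ?_
  rw [ENNReal.mul_rpow_of_nonneg _ _ (by positivity), ← ENNReal.rpow_mul, ← ENNReal.rpow_mul]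
  congr 2
  · ring
  · field_simp

theorem enorm_ballAvg_le_eLpNorm {v : RN N → ℂ} (hm : StronglyMeasurable v) {ε : ℝ}
    (hε : 0 < ε) {r : ℝ} (hr : 1 ≤ r) (x : RN N) :
    ‖ballAvg ε v x‖ₑ ≤ (invBallVolume N * ENNReal.ofReal (ε ^ N)⁻¹) ^ (1 / r)
      * eLpNorm v (ENNReal.ofReal r) volume := by
  have hr0 : 0 < r := by linarith
  have h := ENNReal.rpow_le_rpow (enorm_ballAvg_rpow_le_lintegral hm hε hr x)
    (one_div_nonneg.2 hr0.le)
  rw [← ENNReal.rpow_mul, mul_one_div_cancel hr0.ne', ENNReal.rpow_one,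
    ENNReal.mul_rpow_of_nonneg _ _ (by positivity)] at h
  rwa [eLpNorm_ofReal_eq _ hr0]

theorem eLpNorm_le_sub_ballAvg_add {v : RN N → ℂ} (hm : StronglyMeasurable v) {r : ℝ≥0∞}
    (hr : 1 ≤ r) (ε : ℝ) :
    eLpNorm v r volume
      ≤ eLpNorm (fun x => v x - ballAvg ε v x) r volume + eLpNorm (ballAvg ε v) r volume := by
  have h3 : v = (fun x => v x - ballAvg ε v x) + ballAvg ε v := by ext x; simp
  calc eLpNorm v r volume = eLpNorm ((fun x => v x - ballAvg ε v x) + ballAvg ε v) r volume := by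
        rw [← h3]
    _ ≤ _ := eLpNorm_add_le (hm.sub (stronglyMeasurable_ballAvg hm ε)).aestronglyMeasurable
        (stronglyMeasurable_ballAvg hm ε).aestronglyMeasurable hr

/-- The subcritical Sobolev inequality. -/
theorem eLpNorm_le_sobolev {r σ : ℝ} (hr : 1 ≤ r) (hrσ : r ≤ σ) (hσ : 2 ≤ σ)
    (hsub : (N : ℝ) * ((σ - 2) / 2) < σ) :
    ∃ C : ℝ≥0∞, C ≠ ∞ ∧ ∀ (v : RN N → ℂ) (g : RN N → EuclideanSpace ℂ (Fin N)),
      HasL2Gradient v g → eLpNorm v (ENNReal.ofReal σ) volume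
        ≤ C * (eLpNorm v (ENNReal.ofReal r) volume + eLpNorm g 2 volume) := by
  obtain ⟨C, hC, θ, hθ, h⟩ := eLpNorm_sub_ballAvg_le hσ hsub
  have hr0 : 0 < r := by linarith
  have hσ0 : 0 < σ := by linarith
  set D : ℝ≥0∞ := (invBallVolume N * ENNReal.ofReal (1 ^ N)⁻¹) ^ (1 / r) with hD
  have hDtop : D ≠ ∞ := ENNReal.rpow_ne_top_of_nonneg (by positivity)
    (ENNReal.mul_ne_top invBallVolume_ne_top ENNReal.ofReal_ne_top)
  have hD' : D ^ ((σ - r) / σ) ≠ ∞ :=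
    ENNReal.rpow_ne_top_of_nonneg (div_nonneg (by linarith) hσ0.le) hDtop
  refine ⟨C + D ^ ((σ - r) / σ), ENNReal.add_ne_top.2 ⟨hC, hD'⟩, fun v g hvg => ?_⟩
  have hm := hvg.measurable
  have h1 := h 1 one_pos v g hvg
  rw [Real.one_rpow, ENNReal.ofReal_one, mul_one] at h1
  -- With ε = 1 the mean is bounded by its L^r norm; interpolating with L^r itself, the powers
  -- (σ-r)/σ and r/σ add up to one.
  have h2 := eLpNorm_ballAvg_le_of_bound hm hr hrσ 1 (S := D * eLpNorm v (ENNReal.ofReal r) volume)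
    fun x => enorm_ballAvg_le_eLpNorm hm one_pos hr x
  rw [ENNReal.mul_rpow_of_nonneg _ _ (div_nonneg (by linarith) hσ0.le), mul_assoc,
    ← ENNReal.rpow_add_of_nonneg _ _ (div_nonneg (by linarith) hσ0.le) (by positivity),
    show (σ - r) / σ + r / σ = 1 by field_simp; ring, ENNReal.rpow_one] at h2
  calc eLpNorm v (ENNReal.ofReal σ) volume
      ≤ _ := eLpNorm_le_sub_ballAvg_add hm (by rw [ENNReal.one_le_ofReal]; linarith) 1
    _ ≤ C * eLpNorm g 2 volume + D ^ ((σ - r) / σ) * eLpNorm v (ENNReal.ofReal r) volume :=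
        add_le_add h1 h2
    _ ≤ (C + D ^ ((σ - r) / σ)) * eLpNorm g 2 volume
        + (C + D ^ ((σ - r) / σ)) * eLpNorm v (ENNReal.ofReal r) volume :=
        add_le_add (mul_le_mul_left le_self_add _) (mul_le_mul_left le_add_self _)
    _ = _ := by rw [← mul_add, add_comm (eLpNorm g 2 volume)]

theorem tendsto_mul_ofReal_rpow_mul {C D : ℝ≥0∞} (hC : C ≠ ∞) (hD : D ≠ ∞) {θ : ℝ} (hθ : 0 < θ) :
    Tendsto (fun ε : ℝ => C * ENNReal.ofReal (ε ^ θ) * D) (𝓝[>] 0) (𝓝 0) := by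
  have h1 : Tendsto (fun ε : ℝ => ENNReal.ofReal (ε ^ θ)) (𝓝[>] 0) (𝓝 0) := by
    have h0 : Tendsto (fun ε : ℝ => ε ^ θ) (𝓝 0) (𝓝 0) := by
      have := (Real.continuousAt_rpow_const 0 θ (Or.inr hθ.le)).tendsto
      rwa [Real.zero_rpow hθ.ne'] at this
    simpa using (ENNReal.tendsto_ofReal h0).mono_left nhdsWithin_le_nhds
  have h2 := ENNReal.Tendsto.const_mul (a := C) h1 (Or.inr hC)
  have h3 := ENNReal.Tendsto.mul_const (b := D) h2 (Or.inr hD)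
  simpa using h3

/-- Non-vanishing: a function that is bounded in the energy norm and not small in `L^σ` has a large
mean over some ball of a fixed radius. -/
theorem exists_ballAvg_ge {r σ : ℝ} (hr : 1 ≤ r) (hrσ : r < σ) (hσ : 2 ≤ σ)
    (hsub : (N : ℝ) * ((σ - 2) / 2) < σ) (M : ℝ) {η : ℝ} (hη : 0 < η) :
    ∃ ε δ : ℝ, 0 < ε ∧ 0 < δ ∧ ∀ (v : RN N → ℂ) (g : RN N → EuclideanSpace ℂ (Fin N)),
      HasL2Gradient v g → eLpNorm v (ENNReal.ofReal r) volume ≤ ENNReal.ofReal M →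
      eLpNorm g 2 volume ≤ ENNReal.ofReal M →
      ENNReal.ofReal η ≤ eLpNorm v (ENNReal.ofReal σ) volume → ∃ x, δ ≤ ‖ballAvg ε v x‖ := by
  obtain ⟨C, hC, θ, hθ, h⟩ := eLpNorm_sub_ballAvg_le hσ hsub
  have hr0 : 0 < r := by linarith
  have hσ0 : 0 < σ := by linarith
  have hη2 : (0 : ℝ≥0∞) < ENNReal.ofReal (η / 2) := by simpa using hη
  have hlim1 := tendsto_mul_ofReal_rpow_mul (D := ENNReal.ofReal M) hC ENNReal.ofReal_ne_top hθ
  have hlim2 : Tendsto (fun δ : ℝ => ENNReal.ofReal δ ^ ((σ - r) / σ) * ENNReal.ofReal M ^ (r / σ))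
      (𝓝[>] 0) (𝓝 0) := by
    have hpos : 0 < (σ - r) / σ := div_pos (by linarith) hσ0
    have h1 : Tendsto (fun δ : ℝ => ENNReal.ofReal δ ^ ((σ - r) / σ)) (𝓝[>] 0) (𝓝 0) := by
      have h0 : Tendsto (fun δ : ℝ => ENNReal.ofReal δ) (𝓝[>] 0) (𝓝 0) := by
        simpa using (ENNReal.continuous_ofReal.tendsto 0).mono_left nhdsWithin_le_nhds
      have := ((ENNReal.continuous_rpow_const (y := (σ - r) / σ)).tendsto 0).comp h0
      rwa [ENNReal.zero_rpow_of_pos hpos] at this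
    have h3 := ENNReal.Tendsto.mul_const (b := ENNReal.ofReal M ^ (r / σ)) h1
      (Or.inr (ENNReal.rpow_ne_top_of_nonneg (by positivity) ENNReal.ofReal_ne_top))
    simpa using h3
  -- The radius ε makes the deviation from the mean less than η/2 in L^σ. If all means were below δ,
  -- interpolation would make the mean itself less than η/2; this needs a positive power of δ, hence
  -- r < σ.
  obtain ⟨ε, hε1, hε⟩ := ((hlim1.eventually_lt_const hη2).and self_mem_nhdsWithin).exists
  obtain ⟨δ, hδ1, hδ⟩ := ((hlim2.eventually_lt_const hη2).and self_mem_nhdsWithin).exists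
  refine ⟨ε, δ, hε, hδ, fun v g hvg hvM hgM hvη => ?_⟩
  by_contra! hcon
  have hm := hvg.measurable
  have h1 := (h ε hε v g hvg).trans (mul_le_mul_right hgM _)
  have h2 := (eLpNorm_ballAvg_le_of_bound hm hr hrσ.le ε (S := ENNReal.ofReal δ) fun x => by
    rw [← ofReal_norm]; exact ENNReal.ofReal_le_ofReal (hcon x).le).trans
    (mul_le_mul_right (ENNReal.rpow_le_rpow hvM (by positivity)) _)
  have h4 := eLpNorm_le_sub_ballAvg_add hm (r := ENNReal.ofReal σ)
    (by rw [ENNReal.one_le_ofReal]; linarith) ε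
  have h5 := hvη.trans (h4.trans (add_le_add h1 h2))
  have h6 := h5.trans_lt (ENNReal.add_lt_add hε1 hδ1)
  rw [← ENNReal.ofReal_add (by linarith) (by linarith), add_halves] at h6
  exact lt_irrefl _ h6

/-! ### Weak limits and local compactness. -/

/-- Bounded sequences in a separable Hilbert space have weakly convergent subsequences. -/
theorem exists_weakly_convergent_subseq {H : Type*} [NormedAddCommGroup H] [InnerProductSpace ℂ H]
    [CompleteSpace H] [TopologicalSpace.SeparableSpace H] (x : ℕ → H) {M : ℝ}
    (hx : ∀ n, ‖x n‖ ≤ M) :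
    ∃ (a : H) (σ : ℕ → ℕ), StrictMono σ ∧
      ∀ y, Tendsto (fun n => inner ℂ y (x (σ n))) atTop (𝓝 (inner ℂ y a)) := by
  have hcpt := WeakDual.isSeqCompact_closedBall ℂ H (0 : StrongDual ℂ H) M
  obtain ⟨f, -, σ, hσ, hlim⟩ := hcpt
    (x := fun n => StrongDual.toWeakDual (InnerProductSpace.toDual ℂ H (x n)))
    (fun n => by
      simp only [Set.mem_preimage, mem_closedBall_zero_iff]
      have := hx n
      rwa [← (InnerProductSpace.toDual ℂ H).norm_map (x n)] at this)
  refine ⟨(InnerProductSpace.toDual ℂ H).symm (WeakDual.toStrongDual f), σ, hσ, fun y => ?_⟩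
  have h1 : Tendsto (fun n => inner ℂ (x (σ n)) y) atTop (𝓝 (f y)) :=
    ((WeakDual.eval_continuous y).tendsto f).comp hlim
  have h2 : f y = inner ℂ ((InnerProductSpace.toDual ℂ H).symm (WeakDual.toStrongDual f)) y := by
    rw [InnerProductSpace.toDual_symm_apply]; rfl
  rw [h2] at h1
  -- Under the Riesz isomorphism the sequence sits in the conjugate-linear slot; conjugation moves
  -- it to the other one.
  have h3 := (Complex.continuous_conj.tendsto _).comp h1
  simpa only [Function.comp_def, inner_conj_symm] using h3

/-- The density of `weightMeasure`. -/
def weight (x : RN N) : ℝ := (1 + ‖x‖) ^ (-((N : ℝ) + 1))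

theorem weight_pos (x : RN N) : 0 < weight x := Real.rpow_pos_of_pos (by positivity) _

theorem weight_le_one (x : RN N) : weight x ≤ 1 :=
  Real.rpow_le_one_of_one_le_of_nonpos (by linarith [norm_nonneg x]) (by
    have : (0 : ℝ) ≤ N := Nat.cast_nonneg N
    linarith)

theorem measurable_weight : Measurable (weight : RN N → ℝ) := by unfold weight; fun_prop

theorem inv_weight_le {R : ℝ} {x : RN N} (hx : ‖x‖ ≤ R) : (weight x)⁻¹ ≤ (1 + R) ^ ((N : ℝ) + 1) := by
  rw [weight, Real.rpow_neg (by positivity), inv_inv]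
  exact Real.rpow_le_rpow (by positivity) (by linarith) (by positivity)

/-- A finite measure equivalent to the Lebesgue measure. -/
def weightMeasure (N : ℕ) : Measure (RN N) := volume.withDensity fun x => ENNReal.ofReal (weight x)

/-- The decay exponent N + 1 exceeds the dimension, so the density is integrable at infinity. -/
instance : IsFiniteMeasure (weightMeasure N) := by
  refine isFiniteMeasure_withDensity_ofReal ?_
  exact (integrable_one_add_norm (by simp)).2

theorem weightMeasure_le : weightMeasure N ≤ volume := by
  refine Measure.le_iff.2 fun s hs => ?_
  rw [weightMeasure, withDensity_apply _ hs, ← setLIntegral_one]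
  refine lintegral_mono fun x => ?_
  rw [← ENNReal.ofReal_one]
  exact ENNReal.ofReal_le_ofReal (weight_le_one x)

theorem volume_ac_weightMeasure : (volume : Measure (RN N)) ≪ weightMeasure N :=
  withDensity_absolutelyContinuous' measurable_weight.ennreal_ofReal.aemeasurable
    (ae_of_all _ fun x => by simpa using weight_pos x)

theorem locallyIntegrable_of_integrable_weightMeasure {E : Type*} [NormedAddCommGroup E]
    {v : RN N → E} (hm : StronglyMeasurable v) (hv : Integrable v (weightMeasure N)) :
    LocallyIntegrable v := by
  refine locallyIntegrable_iff.2 fun k hk => ?_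
  obtain ⟨R, hR⟩ := hk.isBounded.subset_closedBall 0
  refine ⟨hm.aestronglyMeasurable, ?_⟩
  have hfin := hv.2
  unfold HasFiniteIntegral at hfin ⊢
  rw [weightMeasure, lintegral_withDensity_eq_lintegral_mul _ measurable_weight.ennreal_ofReal
    hm.enorm] at hfin
  have h1 : ∫⁻ x in k, ‖v x‖ₑ ≤ ∫⁻ x in k, ENNReal.ofReal ((1 + R) ^ ((N : ℝ) + 1)) *
      (ENNReal.ofReal (weight x) * ‖v x‖ₑ) := by
    refine setLIntegral_mono' hk.measurableSet fun x hx => ?_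
    have hxR : ‖x‖ ≤ R := by simpa using hR hx
    rw [← mul_assoc, ← ENNReal.ofReal_mul
      (Real.rpow_nonneg (by linarith [norm_nonneg x]) _)]
    have h2 : 1 ≤ (1 + R) ^ ((N : ℝ) + 1) * weight x := by
      rw [← div_le_iff₀ (weight_pos x), one_div]
      exact inv_weight_le hxR
    calc ‖v x‖ₑ = 1 * ‖v x‖ₑ := (one_mul _).symm
      _ ≤ _ := mul_le_mul_left (by rw [← ENNReal.ofReal_one]; exact ENNReal.ofReal_le_ofReal h2) _
  refine h1.trans_lt ?_
  rw [lintegral_const_mul' _ _ ENNReal.ofReal_ne_top]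
  exact ENNReal.mul_lt_top ENNReal.ofReal_lt_top ((setLIntegral_le_lintegral _ _).trans_lt hfin)

/-- Division by the weight yields the vector whose inner products in the weighted L² are unweighted
integrals against ψ. It is bounded because the weight is bounded below on the ball outside which ψ
vanishes. -/
theorem memLp_div_weight {ψ : RN N → ℝ} (hψ : Measurable ψ) {B R : ℝ} (hB : ∀ x, |ψ x| ≤ B)
    (hR : ∀ x, R < ‖x‖ → ψ x = 0) :
    MemLp (fun x => ((ψ x / weight x : ℝ) : ℂ)) 2 (weightMeasure N) := by
  have hB0 : 0 ≤ B := (abs_nonneg _).trans (hB 0)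
  refine MemLp.of_bound (C := B * (1 + |R|) ^ ((N : ℝ) + 1)) ?_ (ae_of_all _ fun x => ?_)
  · exact (Complex.measurable_ofReal.comp (hψ.div measurable_weight)).aestronglyMeasurable
  · rw [Complex.norm_real, Real.norm_eq_abs, abs_div, abs_of_pos (weight_pos x)]
    by_cases hx : R < ‖x‖
    · rw [hR x hx]; simp; positivity
    · rw [div_eq_mul_inv]
      exact mul_le_mul (hB x) (inv_weight_le ((not_lt.1 hx).trans (le_abs_self R)))
        (inv_nonneg.2 (weight_pos x).le) hB0

theorem inner_div_weight {ψ : RN N → ℝ}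
    (hψ : MemLp (fun x => ((ψ x / weight x : ℝ) : ℂ)) 2 (weightMeasure N))
    (f : Lp ℂ 2 (weightMeasure N)) :
    inner ℂ (hψ.toLp _) f = ∫ x, ψ x • f x := by
  rw [L2.inner_def]
  have h1 : ∫ x, inner ℂ (hψ.toLp _ x) (f x) ∂(weightMeasure N)
      = ∫ x, ((ψ x / weight x : ℝ) : ℂ) * f x ∂(weightMeasure N) := by
    refine integral_congr_ae ?_
    filter_upwards [hψ.coeFn_toLp] with x hx
    rw [hx]
    simp [mul_comm]
  rw [h1]
  refine (integral_withDensity_eq_integral_toReal_smul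
    measurable_weight.ennreal_ofReal (ae_of_all _ fun x => ENNReal.ofReal_lt_top) _).trans ?_
  refine integral_congr_ae (ae_of_all _ fun x => ?_)
  have hw := (weight_pos x).ne'
  simp only [ENNReal.toReal_ofReal (weight_pos x).le]
  rw [← Complex.real_smul, smul_smul, mul_div_cancel₀ _ hw]

/-- A mean over a ball is a pairing with a bounded function of bounded support, so weak convergence
implies pointwise convergence of means. -/
theorem ballAvg_eq_integral (v : RN N → ℂ) {ε : ℝ} (hε : 0 < ε) (x : RN N) :
    ballAvg ε v x = ∫ z, (Metric.ball x ε).indicator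
      (fun _ => (invBallVolume N).toReal * (ε ^ N)⁻¹) z • v z := by
  have h1 : ballAvg ε v x
      = (invBallVolume N).toReal • ∫ y, (Metric.ball x ε).indicator v (x + ε • y) := by
    rw [ballAvg, unitBallMeasure, integral_smul_measure, ← integral_indicator measurableSet_ball]
    congr 1
    refine integral_congr_ae (ae_of_all _ fun y => ?_)
    by_cases hy : y ∈ Metric.ball (0 : RN N) 1
    · have : x + ε • y ∈ Metric.ball x ε := by
        simp only [Metric.mem_ball, dist_zero_right] at hy
        simp only [Metric.mem_ball, dist_self_add_left, norm_smul, Real.norm_eq_abs, abs_of_pos hε]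
        nlinarith
      simp only [Set.indicator_of_mem hy, Set.indicator_of_mem this]
    · have : x + ε • y ∉ Metric.ball x ε := by
        simp only [Metric.mem_ball, dist_zero_right, not_lt] at hy
        simp only [Metric.mem_ball, dist_self_add_left, norm_smul, Real.norm_eq_abs, abs_of_pos hε,
          not_lt]
        nlinarith
      simp only [Set.indicator_of_notMem hy, Set.indicator_of_notMem this]
  have h2 := Measure.integral_comp_smul (volume : Measure (RN N))
    (fun z => (Metric.ball x ε).indicator v (x + z)) ε
  rw [integral_add_left_eq_self (fun z => (Metric.ball x ε).indicator v z) x] at h2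
  rw [h1, h2, smul_smul, ← integral_smul]
  refine integral_congr_ae (ae_of_all _ fun z => ?_)
  by_cases hz : z ∈ Metric.ball x ε
  · simp only [Set.indicator_of_mem hz]
    congr 2
    simp only [finrank_euclideanSpace, Fintype.card_fin]
    rw [abs_of_pos (by positivity)]
  · simp only [Set.indicator_of_notMem hz, smul_zero, zero_smul]

theorem HasL2Gradient.sub {v v' : RN N → ℂ} {g g' : RN N → EuclideanSpace ℂ (Fin N)}
    (h : HasL2Gradient v g) (h' : HasL2Gradient v' g') :
    HasL2Gradient (fun x => v x - v' x) (fun x => g x - g' x) where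
  measurable := h.measurable.sub h'.measurable
  locallyIntegrable := h.locallyIntegrable.sub h'.locallyIntegrable
  memLp := h.memLp.sub h'.memLp
  stronglyMeasurable_grad := h.stronglyMeasurable_grad.sub h'.stronglyMeasurable_grad
  isWeakGradient := by
    intro φ hφ hc i
    have hi : ∀ {v : RN N → ℂ}, LocallyIntegrable v → Integrable fun x =>
        fderiv ℝ φ x (EuclideanSpace.single i (1 : ℝ)) • v x := fun hv =>
      hv.integrable_smul_left_of_hasCompactSupport (continuous_partial hφ _)
        (hasCompactSupport_partial hc _)
    have hj : ∀ {g : RN N → EuclideanSpace ℂ (Fin N)}, MemLp g 2 → Integrable fun x =>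
        φ x • g x i := fun hg =>
      ((EuclideanSpace.proj i : EuclideanSpace ℂ (Fin N) →L[ℂ] ℂ).restrictScalars
        ℝ).integrable_comp ((hg.locallyIntegrable
          one_le_two).integrable_smul_left_of_hasCompactSupport hφ.continuous hc)
    simp only [smul_sub, PiLp.sub_apply]
    rw [integral_sub (hi h.locallyIntegrable) (hi h'.locallyIntegrable),
      integral_sub (hj h.memLp) (hj h'.memLp), h.isWeakGradient φ hφ hc i,
      h'.isWeakGradient φ hφ hc i]
    ring

theorem inner_single_eq_integral {φ : RN N → ℝ} {i : Fin N}
    (hφ : MemLp (fun x => EuclideanSpace.single i ((φ x : ℝ) : ℂ)) 2 (volume : Measure (RN N)))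
    (g : GradFun N) : inner ℂ (hφ.toLp _) g = ∫ x, φ x • g x i := by
  rw [L2.inner_def]
  refine integral_congr_ae ?_
  filter_upwards [hφ.coeFn_toLp] with x hx
  rw [hx, EuclideanSpace.inner_single_left]
  simp

theorem memLp_single {φ : RN N → ℝ} (hφ : Continuous φ) (hc : HasCompactSupport φ) (i : Fin N) :
    MemLp (fun x => EuclideanSpace.single i ((φ x : ℝ) : ℂ)) 2 (volume : Measure (RN N)) := by
  refine (hφ.memLp_of_hasCompactSupport hc (p := 2)).of_le (f := fun x =>
    EuclideanSpace.single i ((φ x : ℝ) : ℂ)) ?_ (ae_of_all _ fun x => ?_)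
  · have : Continuous fun x => EuclideanSpace.single i ((φ x : ℝ) : ℂ) := by
      simp only [← PiLp.toLp_single]
      have h1 : Continuous fun x => (Pi.single i ((φ x : ℝ) : ℂ) : Fin N → ℂ) :=
        (continuous_single i).comp (Complex.continuous_ofReal.comp hφ)
      exact (PiLp.continuous_toLp 2 _).comp h1
    exact this.aestronglyMeasurable
  · simp

/-- The weighted measure is finite and dominated by Lebesgue measure, so every L^r with r ≥ 2 embeds
into one separable Hilbert space. Weak compactness is used there only, for ω = 0 and ω > 0 alike. -/
theorem eLpNorm_weightMeasure_le {v : RN N → ℂ} (hm : StronglyMeasurable v) {r : ℝ} (hr : 2 ≤ r) :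
    eLpNorm v 2 (weightMeasure N) ≤ eLpNorm v (ENNReal.ofReal r) volume
      * weightMeasure N Set.univ ^ (1 / (2 : ℝ≥0∞).toReal - 1 / (ENNReal.ofReal r).toReal) := by
  have h2 : (2 : ℝ≥0∞) ≤ ENNReal.ofReal r := by
    rw [show (2 : ℝ≥0∞) = ENNReal.ofReal 2 by simp]; exact ENNReal.ofReal_le_ofReal hr
  exact (eLpNorm_le_eLpNorm_mul_rpow_measure_univ h2 hm.aestronglyMeasurable).trans
    (mul_le_mul_left (eLpNorm_mono_measure _ weightMeasure_le) _)

/-- Weak compactness: extraction of a weak limit together with its weak gradient. -/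
theorem exists_weak_limit {r : ℝ} (hr : 2 ≤ r) (v : ℕ → RN N → ℂ) (g : ℕ → GradFun N) {M : ℝ}
    (hvg : ∀ n, HasL2Gradient (v n) (g n))
    (hv : ∀ n, eLpNorm (v n) (ENNReal.ofReal r) volume ≤ ENNReal.ofReal M)
    (hg : ∀ n, ‖g n‖ ≤ M) :
    ∃ (v₀ : RN N → ℂ) (g₀ : GradFun N) (σ : ℕ → ℕ), StrictMono σ ∧ HasL2Gradient v₀ g₀ ∧
      (∀ ε, 0 < ε → ∀ x, Tendsto (fun n => ballAvg ε (v (σ n)) x) atTop (𝓝 (ballAvg ε v₀ x))) ∧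
      ∀ y : GradFun N, Tendsto (fun n => inner ℂ y (g (σ n))) atTop (𝓝 (inner ℂ y g₀)) := by
  have : Fact ((2 : ℝ≥0∞) ≠ ∞) := ⟨ENNReal.ofNat_ne_top⟩
  set D : ℝ≥0∞ := weightMeasure N Set.univ ^
    (1 / (2 : ℝ≥0∞).toReal - 1 / (ENNReal.ofReal r).toReal) with hD
  have hDtop : D ≠ ∞ := by
    refine ENNReal.rpow_ne_top_of_nonneg ?_ (measure_ne_top _ _)
    rw [ENNReal.toReal_ofReal (by linarith), ENNReal.toReal_ofNat, sub_nonneg]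
    exact one_div_le_one_div_of_le two_pos hr
  have hbd : ∀ n, eLpNorm (v n) 2 (weightMeasure N) ≤ ENNReal.ofReal M * D := fun n =>
    (eLpNorm_weightMeasure_le (hvg n).measurable hr).trans (mul_le_mul_left (hv n) _)
  have hmem : ∀ n, MemLp (v n) 2 (weightMeasure N) := fun n =>
    ⟨(hvg n).measurable.aestronglyMeasurable,
      (hbd n).trans_lt (ENNReal.mul_lt_top ENNReal.ofReal_lt_top hDtop.lt_top)⟩
  obtain ⟨F, σ₁, hσ₁, hF⟩ := exists_weakly_convergent_subseq (fun n => (hmem n).toLp (v n))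
    (M := (ENNReal.ofReal M * D).toReal) fun n => by
      rw [Lp.norm_toLp]
      exact ENNReal.toReal_mono (ENNReal.mul_ne_top ENNReal.ofReal_ne_top hDtop) (hbd n)
  obtain ⟨g₀, σ₂, hσ₂, hg₀⟩ := exists_weakly_convergent_subseq (fun n => g (σ₁ n)) (M := M)
    fun n => hg _
  have htest : ∀ ψ : RN N → ℝ, Measurable ψ → (∃ B, ∀ x, |ψ x| ≤ B) →
      (∃ R, ∀ x, R < ‖x‖ → ψ x = 0) →
      Tendsto (fun n => ∫ x, ψ x • v (σ₁ (σ₂ n)) x) atTop (𝓝 (∫ x, ψ x • F x)) := by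
    rintro ψ hψ ⟨B, hB⟩ ⟨R, hR⟩
    have h1 := (hF ((memLp_div_weight hψ hB hR).toLp _)).comp hσ₂.tendsto_atTop
    rw [inner_div_weight] at h1
    refine h1.congr fun n => ?_
    simp only [Function.comp_apply]
    rw [inner_div_weight]
    refine integral_congr_ae ?_
    filter_upwards [volume_ac_weightMeasure.ae_le (hmem (σ₁ (σ₂ n))).coeFn_toLp] with x hx
    rw [hx]
  have hFm : StronglyMeasurable (F : RN N → ℂ) := Lp.stronglyMeasurable F
  refine ⟨F, g₀, σ₁ ∘ σ₂, hσ₁.comp hσ₂, ⟨hFm, ?_, Lp.memLp g₀, Lp.stronglyMeasurable g₀, ?_⟩, ?_, hg₀⟩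
  · exact locallyIntegrable_of_integrable_weightMeasure hFm ((Lp.memLp F).integrable one_le_two)
  · intro φ hφ hc i
    have hc' := hasCompactSupport_partial hc (EuclideanSpace.single i (1 : ℝ))
    have hcont := continuous_partial hφ (EuclideanSpace.single i (1 : ℝ))
    have h1 := htest (fun x => fderiv ℝ φ x (EuclideanSpace.single i (1 : ℝ))) hcont.measurable
      (by
        obtain ⟨B, hB⟩ := hcont.bounded_above_of_compact_support hc'
        exact ⟨B, hB⟩)
      (by
        obtain ⟨R, hR⟩ := hc'.isCompact.isBounded.subset_closedBall 0
        refine ⟨R, fun x hx => image_eq_zero_of_notMem_tsupport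
          (f := fun x => fderiv ℝ φ x (EuclideanSpace.single i (1 : ℝ))) fun hxs => ?_⟩
        have := hR hxs
        rw [mem_closedBall_zero_iff] at this
        linarith)
    have h2 := (hg₀ ((memLp_single hφ.continuous hc i).toLp _)).neg
    simp only [inner_single_eq_integral] at h2
    -- Both sides of the weak gradient identity are pairings that converge, so the limit inherits
    -- the identity.
    refine tendsto_nhds_unique h1 (h2.congr fun n => ?_)
    exact ((hvg _).isWeakGradient φ hφ hc i).symm
  · intro ε hε x
    rw [ballAvg_eq_integral _ hε]
    simp only [ballAvg_eq_integral _ hε]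
    refine htest _ (measurable_const.indicator measurableSet_ball)
      ⟨|(invBallVolume N).toReal * (ε ^ N)⁻¹|, fun z => ?_⟩ ⟨‖x‖ + ε, fun z hz => ?_⟩
    · by_cases hz : z ∈ Metric.ball x ε
      · rw [Set.indicator_of_mem hz]
      · rw [Set.indicator_of_notMem hz, abs_zero]; exact abs_nonneg _
    · rw [Set.indicator_of_notMem]
      intro hzx
      rw [Metric.mem_ball, dist_eq_norm] at hzx
      have := norm_add_le (z - x) x
      rw [sub_add_cancel] at this
      linarith

/-- Dominated convergence, a constant being integrable for a finite measure. -/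
theorem tendsto_eLpNorm_ballAvg_weightMeasure {ε : ℝ} (w : ℕ → RN N → ℂ)
    (hm : ∀ n, StronglyMeasurable (w n)) {S : ℝ≥0∞} (hS : S ≠ ∞) (hb : ∀ n x, ‖ballAvg ε (w n) x‖ₑ ≤ S)
    (hlim : ∀ x, Tendsto (fun n => ballAvg ε (w n) x) atTop (𝓝 0)) :
    Tendsto (fun n => eLpNorm (ballAvg ε (w n)) 2 (weightMeasure N)) atTop (𝓝 0) := by
  have h1 : Tendsto (fun n => ∫⁻ x, ‖ballAvg ε (w n) x‖ₑ ^ (2 : ℝ) ∂(weightMeasure N)) atTop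
      (𝓝 (∫⁻ _, 0 ∂(weightMeasure N))) := by
    refine tendsto_lintegral_of_dominated_convergence (fun _ => S ^ (2 : ℝ))
      (fun n => (stronglyMeasurable_ballAvg (hm n) ε).measurable.enorm.pow_const _)
      (fun n => ae_of_all _ fun x => ENNReal.rpow_le_rpow (hb n x) zero_le_two) ?_
      (ae_of_all _ fun x => ?_)
    · rw [lintegral_const]
      exact ENNReal.mul_ne_top (ENNReal.rpow_ne_top_of_nonneg zero_le_two hS) (measure_ne_top _ _)
    · have h2 := (ENNReal.continuous_rpow_const (y := 2)).tendsto _ |>.comp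
        ((continuous_enorm.tendsto _).comp (hlim x))
      simpa [Function.comp_def] using h2
  have h3 := (ENNReal.continuous_rpow_const (y := 1 / 2)).tendsto _ |>.comp h1
  simp only [lintegral_zero, ENNReal.zero_rpow_of_pos (show (0 : ℝ) < 1 / 2 by norm_num)] at h3
  refine h3.congr fun n => ?_
  rw [eLpNorm_eq_lintegral_rpow_enorm_toReal two_ne_zero ENNReal.ofNat_ne_top]; simp

/-- Local compactness: a bounded sequence has a subsequence that converges almost everywhere to
its weak limit. -/
theorem exists_ae_limit {r : ℝ} (hr : 2 ≤ r) (v : ℕ → RN N → ℂ) (g : ℕ → GradFun N) {M : ℝ}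
    (hvg : ∀ n, HasL2Gradient (v n) (g n))
    (hv : ∀ n, eLpNorm (v n) (ENNReal.ofReal r) volume ≤ ENNReal.ofReal M)
    (hg : ∀ n, ‖g n‖ ≤ M) :
    ∃ (v₀ : RN N → ℂ) (g₀ : GradFun N) (σ : ℕ → ℕ), StrictMono σ ∧ HasL2Gradient v₀ g₀ ∧
      eLpNorm v₀ (ENNReal.ofReal r) volume ≤ ENNReal.ofReal M ∧
      (∀ᵐ x, Tendsto (fun n => v (σ n) x) atTop (𝓝 (v₀ x))) ∧
      (∀ ε, 0 < ε → ∀ x, Tendsto (fun n => ballAvg ε (v (σ n)) x) atTop (𝓝 (ballAvg ε v₀ x))) ∧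
      ∀ y : GradFun N, Tendsto (fun n => inner ℂ y (g (σ n))) atTop (𝓝 (inner ℂ y g₀)) := by
  obtain ⟨v₀, g₀, σ, hσ, hv₀, havg, hweak⟩ := exists_weak_limit hr v g hvg hv hg
  obtain ⟨C, hC, θ, hθ, hsub⟩ := eLpNorm_sub_ballAvg_le (N := N) (σ := 2) le_rfl (by simp)
  rw [show ENNReal.ofReal 2 = 2 by simp] at hsub
  set w : ℕ → RN N → ℂ := fun n x => v (σ n) x - v₀ x with hw
  have hwg : ∀ n, HasL2Gradient (w n) (fun x => g (σ n) x - g₀ x) := fun n => (hvg _).sub hv₀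
  set M' : ℝ≥0∞ := ENNReal.ofReal (M + ‖g₀‖) with hM'
  have hwM : ∀ n, eLpNorm (fun x => g (σ n) x - g₀ x) 2 volume ≤ M' := by
    intro n
    have h1 : eLpNorm (fun x => g (σ n) x - g₀ x) 2 volume = eLpNorm (g (σ n) - g₀ : GradFun N) 2 volume :=
      eLpNorm_congr_ae (Lp.coeFn_sub _ _).symm
    rw [h1, ← ENNReal.ofReal_toReal (Lp.eLpNorm_ne_top (g (σ n) - g₀)), ← Lp.norm_def]
    exact ENNReal.ofReal_le_ofReal ((norm_sub_le _ _).trans (by gcongr; exact hg _))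
  have havgsub : ∀ ε, 0 < ε → ∀ n x, ballAvg ε (w n) x = ballAvg ε (v (σ n)) x - ballAvg ε v₀ x :=
    fun ε hε n x => integral_sub
      (integrable_ballAvg (hvg _).measurable (hvg _).locallyIntegrable hε x)
      (integrable_ballAvg hv₀.measurable hv₀.locallyIntegrable hε x)
  -- The argument of Rellich's theorem: the difference between w_n and its means is small uniformly
  -- in n once ε is small, and for this fixed ε the means tend to 0.
  have hstrong : Tendsto (fun n => eLpNorm (w n) 2 (weightMeasure N)) atTop (𝓝 0) := by
    rw [ENNReal.tendsto_nhds_zero]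
    intro δ hδ
    have hlim1 := tendsto_mul_ofReal_rpow_mul (D := M') hC ENNReal.ofReal_ne_top hθ
    have hδ2 : 0 < δ / 2 := ENNReal.half_pos hδ.ne'
    obtain ⟨ε, hε1, hε⟩ := ((hlim1.eventually_lt_const hδ2).and self_mem_nhdsWithin).exists
    have hε0 : 0 < ε := hε
    set S : ℝ≥0∞ := (invBallVolume N * ENNReal.ofReal (ε ^ N)⁻¹) ^ (1 / r) * ENNReal.ofReal M with hS
    have hStop : S ≠ ∞ := ENNReal.mul_ne_top (ENNReal.rpow_ne_top_of_nonneg (by positivity)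
      (ENNReal.mul_ne_top invBallVolume_ne_top ENNReal.ofReal_ne_top)) ENNReal.ofReal_ne_top
    have hb1 : ∀ n x, ‖ballAvg ε (v n) x‖ₑ ≤ S := fun n x =>
      (enorm_ballAvg_le_eLpNorm (hvg n).measurable hε0 (by linarith) x).trans
        (mul_le_mul_right (hv n) _)
    have hb2 : ∀ x, ‖ballAvg ε v₀ x‖ₑ ≤ S := fun x =>
      le_of_tendsto ((continuous_enorm.tendsto _).comp (havg ε hε0 x))
        (Eventually.of_forall fun n => hb1 _ x)
    have h4 := tendsto_eLpNorm_ballAvg_weightMeasure w (fun n => (hwg n).measurable)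
      (S := S + S) (ENNReal.add_ne_top.2 ⟨hStop, hStop⟩) (ε := ε)
      (fun n x => by
        rw [havgsub ε hε0]
        exact (enorm_sub_le).trans (add_le_add (hb1 _ x) (hb2 x)))
      (fun x => by
        simp only [havgsub ε hε0]
        simpa using (havg ε hε0 x).sub_const (ballAvg ε v₀ x))
    filter_upwards [h4.eventually_le_const hδ2] with n hn
    have h5 : w n = (fun x => w n x - ballAvg ε (w n) x) + ballAvg ε (w n) := by ext x; simp
    calc eLpNorm (w n) 2 (weightMeasure N)
        = eLpNorm ((fun x => w n x - ballAvg ε (w n) x) + ballAvg ε (w n)) 2 (weightMeasure N) := by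
          rw [← h5]
      _ ≤ eLpNorm (fun x => w n x - ballAvg ε (w n) x) 2 (weightMeasure N)
          + eLpNorm (ballAvg ε (w n)) 2 (weightMeasure N) :=
          eLpNorm_add_le ((hwg n).measurable.sub
            (stronglyMeasurable_ballAvg (hwg n).measurable ε)).aestronglyMeasurable
            (stronglyMeasurable_ballAvg (hwg n).measurable ε).aestronglyMeasurable one_le_two
      _ ≤ δ / 2 + δ / 2 := by
          refine add_le_add ?_ hn
          refine (eLpNorm_mono_measure _ weightMeasure_le).trans ?_
          exact (hsub ε hε0 _ _ (hwg n)).trans ((mul_le_mul_right (hwM n) _).trans hε1.le)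
      _ = δ := ENNReal.add_halves δ
  have hmeas := tendstoInMeasure_of_tendsto_eLpNorm (μ := weightMeasure N) two_ne_zero
    (f := fun n => v (σ n)) (g := v₀)
    (fun n => (hvg _).measurable.aestronglyMeasurable) hv₀.measurable.aestronglyMeasurable hstrong
  obtain ⟨ρ, hρ, hae⟩ := hmeas.exists_seq_tendsto_ae
  -- The weight is positive everywhere, so null sets of the weighted measure are Lebesgue null sets.
  have hae' := volume_ac_weightMeasure.ae_le hae
  refine ⟨v₀, g₀, σ ∘ ρ, hσ.comp hρ, hv₀, ?_, hae',
    fun ε hε x => (havg ε hε x).comp hρ.tendsto_atTop, fun y => (hweak y).comp hρ.tendsto_atTop⟩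
  refine (Lp.eLpNorm_lim_le_liminf_eLpNorm
    (fun n => (hvg (σ (ρ n))).measurable.aestronglyMeasurable) v₀ hae').trans ?_
  exact liminf_le_of_frequently_le' (Frequently.of_forall fun n => hv _)

end DoublePowerNLS

namespace DoublePowerNLS

/-! ### Inequalities for powers and the Brezis–Lieb lemma. -/

/-- The graph of a power lies above its tangents. -/
theorem rpow_tangent_le {s x y : ℝ} (hs : 1 ≤ s) (hx : 0 ≤ x) (hy : 0 ≤ y) :
    x ^ s + s * x ^ (s - 1) * (y - x) ≤ y ^ s := by
  rcases hx.eq_or_lt with rfl | hx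
  · rcases hs.eq_or_lt with rfl | hs
    · simp
    · rw [Real.zero_rpow (by linarith), Real.zero_rpow (by linarith)]
      simpa using Real.rpow_nonneg hy s
  · have h := one_add_mul_self_le_rpow_one_add (s := y / x - 1)
      (by have := div_nonneg hy hx.le; linarith) hs
    rw [show 1 + (y / x - 1) = y / x by ring, Real.div_rpow hy hx.le,
      le_div_iff₀ (Real.rpow_pos_of_pos hx s)] at h
    refine le_of_eq_of_le ?_ h
    rw [Real.rpow_sub_one hx.ne']
    field_simp

theorem abs_rpow_sub_rpow_le {s x y z : ℝ} (hs : 1 ≤ s) (hx : 0 ≤ x) (hy : 0 ≤ y) (hxz : x ≤ z)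
    (hyz : y ≤ z) : |x ^ s - y ^ s| ≤ s * z ^ (s - 1) * |x - y| := by
  have key : ∀ {a b : ℝ}, 0 ≤ b → b ≤ a → a ≤ z → a ^ s - b ^ s ≤ s * z ^ (s - 1) * (a - b) := by
    intro a b hb hba haz
    have h1 := rpow_tangent_le hs (hb.trans hba) hb
    have h2 : a ^ (s - 1) ≤ z ^ (s - 1) := Real.rpow_le_rpow (hb.trans hba) haz (by linarith)
    have h3 : s * a ^ (s - 1) * (a - b) ≤ s * z ^ (s - 1) * (a - b) := by
      gcongr
    nlinarith
  rcases le_total y x with h | h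
  · rw [abs_of_nonneg (sub_nonneg.2 (Real.rpow_le_rpow hy h (by linarith))),
      abs_of_nonneg (sub_nonneg.2 h)]
    exact key hy h hxz
  · rw [abs_sub_comm, abs_sub_comm x y,
      abs_of_nonneg (sub_nonneg.2 (Real.rpow_le_rpow hx h (by linarith))),
      abs_of_nonneg (sub_nonneg.2 h)]
    exact key hx h hyz

/-- By the mean value bound, the change from ‖a‖^s to ‖a+b‖^s is at most s(‖a‖+‖b‖)^(s-1)‖b‖. If ‖b‖
≤ δ‖a‖ this is absorbed by ε‖a‖^s, otherwise ‖a‖ ≤ ‖b‖/δ and it is a multiple of ‖b‖^s. -/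
theorem abs_norm_add_rpow_sub_le {E : Type*} [NormedAddCommGroup E] {s : ℝ} (hs : 1 ≤ s) {ε : ℝ}
    (hε : 0 < ε) : ∃ C : ℝ, 0 ≤ C ∧ ∀ a b : E,
      |‖a + b‖ ^ s - ‖a‖ ^ s - ‖b‖ ^ s| ≤ ε * ‖a‖ ^ s + C * ‖b‖ ^ s := by
  set δ : ℝ := min 1 (ε / (s * 2 ^ (s - 1))) with hδ
  have h2pos : (0 : ℝ) < 2 ^ (s - 1) := Real.rpow_pos_of_pos two_pos _
  have hs0 : 0 < s := by linarith
  have hδ0 : 0 < δ := lt_min one_pos (by positivity)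
  have hδ1 : δ ≤ 1 := min_le_left _ _
  have hδε : s * δ * 2 ^ (s - 1) ≤ ε := by
    have := min_le_right 1 (ε / (s * 2 ^ (s - 1)))
    rw [← hδ, le_div_iff₀ (by positivity)] at this
    linarith
  refine ⟨s * (1 / δ + 1) ^ (s - 1) + 1, by positivity, fun a b => ?_⟩
  have h1 : |‖a + b‖ ^ s - ‖a‖ ^ s| ≤ s * (‖a‖ + ‖b‖) ^ (s - 1) * ‖b‖ := by
    refine (abs_rpow_sub_rpow_le hs (norm_nonneg _) (norm_nonneg _) (norm_add_le a b)
      (le_add_of_nonneg_right (norm_nonneg _))).trans ?_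
    gcongr
    simpa using abs_norm_sub_norm_le (a + b) a
  have h2 : |‖a + b‖ ^ s - ‖a‖ ^ s - ‖b‖ ^ s| ≤ |‖a + b‖ ^ s - ‖a‖ ^ s| + ‖b‖ ^ s := by
    refine (abs_sub _ _).trans ?_
    rw [abs_of_nonneg (Real.rpow_nonneg (norm_nonneg b) s)]
  have hpow : ∀ {t : ℝ}, 0 ≤ t → t ^ (s - 1) * t = t ^ s := by
    intro t ht
    rcases ht.eq_or_lt with rfl | ht
    · rw [Real.zero_rpow hs0.ne', mul_zero]
    · rw [Real.rpow_sub_one ht.ne']; field_simp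
  have h3 : s * (‖a‖ + ‖b‖) ^ (s - 1) * ‖b‖
      ≤ ε * ‖a‖ ^ s + s * (1 / δ + 1) ^ (s - 1) * ‖b‖ ^ s := by
    rcases le_total ‖b‖ (δ * ‖a‖) with hb | hb
    · have h4 : s * (‖a‖ + ‖b‖) ^ (s - 1) * ‖b‖ ≤ s * (2 * ‖a‖) ^ (s - 1) * (δ * ‖a‖) := by
        gcongr
        have : δ * ‖a‖ ≤ ‖a‖ := mul_le_of_le_one_left (norm_nonneg _) hδ1
        linarith
      have h5 : s * (2 * ‖a‖) ^ (s - 1) * (δ * ‖a‖) = (s * δ * 2 ^ (s - 1)) * ‖a‖ ^ s := by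
        rw [Real.mul_rpow two_pos.le (norm_nonneg _), ← hpow (norm_nonneg a)]; ring
      have h6 : (s * δ * 2 ^ (s - 1)) * ‖a‖ ^ s ≤ ε * ‖a‖ ^ s := by gcongr
      have h7 : 0 ≤ s * (1 / δ + 1) ^ (s - 1) * ‖b‖ ^ s := by positivity
      linarith
    · have h4 : s * (‖a‖ + ‖b‖) ^ (s - 1) * ‖b‖ ≤ s * ((1 / δ + 1) * ‖b‖) ^ (s - 1) * ‖b‖ := by
        gcongr
        have : ‖a‖ ≤ ‖b‖ / δ := by rw [le_div_iff₀ hδ0]; linarith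
        have h8 : (1 / δ + 1) * ‖b‖ = ‖b‖ / δ + ‖b‖ := by ring
        linarith
      have h5 : s * ((1 / δ + 1) * ‖b‖) ^ (s - 1) * ‖b‖ = s * (1 / δ + 1) ^ (s - 1) * ‖b‖ ^ s := by
        rw [Real.mul_rpow (by positivity) (norm_nonneg _), ← hpow (norm_nonneg b)]; ring
      have h7 : 0 ≤ ε * ‖a‖ ^ s := by positivity
      linarith
  linarith

variable {α : Type*} [MeasurableSpace α] {μ : Measure α}

theorem integrable_norm_rpow_of_memLp {E : Type*} [NormedAddCommGroup E] {f : α → E} {s : ℝ}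
    (hs : 0 < s) (hf : MemLp f (ENNReal.ofReal s) μ) : Integrable (fun x => ‖f x‖ ^ s) μ := by
  have := hf.integrable_norm_rpow (by simpa using hs) ENNReal.ofReal_ne_top
  rwa [ENNReal.toReal_ofReal hs.le] at this

/-- The Brezis–Lieb lemma. -/
theorem tendsto_integral_norm_rpow_sub {E : Type*} [NormedAddCommGroup E] {s : ℝ} (hs : 1 ≤ s)
    {f : ℕ → α → E} {f₀ : α → E} {M : ℝ}
    (hf : ∀ n, MemLp (f n) (ENNReal.ofReal s) μ) (hf₀ : MemLp f₀ (ENNReal.ofReal s) μ)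
    (hM : ∀ n, ∫ x, ‖f n x - f₀ x‖ ^ s ∂μ ≤ M)
    (hlim : ∀ᵐ x ∂μ, Tendsto (fun n => f n x) atTop (𝓝 (f₀ x))) :
    Tendsto (fun n => ∫ x, ‖f n x‖ ^ s ∂μ - ∫ x, ‖f n x - f₀ x‖ ^ s ∂μ) atTop
      (𝓝 (∫ x, ‖f₀ x‖ ^ s ∂μ)) := by
  have hs0 : 0 < s := by linarith
  have hi : ∀ n, Integrable (fun x => ‖f n x‖ ^ s) μ := fun n => integrable_norm_rpow_of_memLp hs0 (hf n)
  have hi₀ : Integrable (fun x => ‖f₀ x‖ ^ s) μ := integrable_norm_rpow_of_memLp hs0 hf₀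
  have hiw : ∀ n, Integrable (fun x => ‖f n x - f₀ x‖ ^ s) μ := fun n =>
    integrable_norm_rpow_of_memLp hs0 ((hf n).sub hf₀)
  have hM0 : 0 ≤ M := (integral_nonneg fun x => by positivity).trans (hM 0)
  set d : ℕ → α → ℝ := fun n x => |‖f n x‖ ^ s - ‖f n x - f₀ x‖ ^ s - ‖f₀ x‖ ^ s| with hd
  have hid : ∀ n, Integrable (d n) μ := fun n => (((hi n).sub (hiw n)).sub hi₀).abs
  rw [Metric.tendsto_atTop]
  intro η hη
  obtain ⟨C, hC, hCle⟩ := abs_norm_add_rpow_sub_le (E := E) hs (ε := η / (2 * (M + 1))) (by positivity)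
  set ε := η / (2 * (M + 1)) with hε
  have hdle : ∀ n x, d n x ≤ ε * ‖f n x - f₀ x‖ ^ s + C * ‖f₀ x‖ ^ s := by
    intro n x
    have := hCle (f n x - f₀ x) (f₀ x)
    rwa [sub_add_cancel] at this
  -- Subtracting the ε-part leaves a quantity dominated by C‖f₀‖^s, to which dominated convergence
  -- applies; the ε-part contributes at most εM ≤ η/2.
  set W : ℕ → α → ℝ := fun n x => max (d n x - ε * ‖f n x - f₀ x‖ ^ s) 0 with hW
  have hiW : ∀ n, Integrable (W n) μ := fun n =>
    ((hid n).sub ((hiw n).const_mul ε)).pos_part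
  have hW0 : Tendsto (fun n => ∫ x, W n x ∂μ) atTop (𝓝 (∫ _, (0 : ℝ) ∂μ)) := by
    refine tendsto_integral_of_dominated_convergence (fun x => C * ‖f₀ x‖ ^ s)
      (fun n => (hiW n).1) (hi₀.const_mul C) (fun n => ae_of_all _ fun x => ?_) ?_
    · rw [Real.norm_eq_abs, abs_of_nonneg (le_max_right _ _)]
      refine max_le (by linarith [hdle n x]) (by positivity)
    · filter_upwards [hlim] with x hx
      have h1 : Tendsto (fun n => ‖f n x‖ ^ s) atTop (𝓝 (‖f₀ x‖ ^ s)) :=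
        hx.norm.rpow_const (Or.inr hs0.le)
      have h2 : Tendsto (fun n => ‖f n x - f₀ x‖ ^ s) atTop (𝓝 0) := by
        have := ((hx.sub_const (f₀ x)).norm).rpow_const (p := s) (Or.inr hs0.le)
        simpa [Real.zero_rpow hs0.ne'] using this
      have h3 := (((h1.sub h2).sub_const (‖f₀ x‖ ^ s)).abs.sub (h2.const_mul ε)).max
        (tendsto_const_nhds (x := (0 : ℝ)))
      simpa using h3
  rw [integral_zero] at hW0
  obtain ⟨n₀, hn₀⟩ := (Metric.tendsto_atTop.1 hW0) (η / 2) (by positivity)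
  refine ⟨n₀, fun n hn => ?_⟩
  have h4 := hn₀ n hn
  rw [Real.dist_eq, sub_zero] at h4
  have h5 : dist (∫ x, ‖f n x‖ ^ s ∂μ - ∫ x, ‖f n x - f₀ x‖ ^ s ∂μ) (∫ x, ‖f₀ x‖ ^ s ∂μ)
      ≤ ∫ x, d n x ∂μ := by
    rw [Real.dist_eq, ← integral_sub (hi n) (hiw n)]
    have h9 := integral_sub ((hi n).sub (hiw n)) hi₀
    simp only [Pi.sub_apply] at h9
    rw [← h9]
    exact abs_integral_le_integral_abs
  have h6 : ∫ x, d n x ∂μ ≤ ∫ x, W n x ∂μ + ε * M := by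
    calc ∫ x, d n x ∂μ ≤ ∫ x, (W n x + ε * ‖f n x - f₀ x‖ ^ s) ∂μ := by
          refine integral_mono (hid n) ((hiW n).add ((hiw n).const_mul ε)) fun x => ?_
          have := le_max_left (d n x - ε * ‖f n x - f₀ x‖ ^ s) 0
          simp only [hW]
          linarith
      _ = ∫ x, W n x ∂μ + ε * ∫ x, ‖f n x - f₀ x‖ ^ s ∂μ := by
          rw [integral_add (hiW n) ((hiw n).const_mul ε), integral_const_mul]
      _ ≤ _ := by gcongr; exact hM n
  have h7 : ε * M ≤ η / 2 := by
    rw [hε, div_mul_eq_mul_div, div_le_div_iff₀ (by positivity) two_pos]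
    nlinarith
  have h8 := le_abs_self (∫ x, W n x ∂μ)
  linarith

/-- For m ≥ 1 this is the tangent inequality; for m ≤ 1 it is y/x ≤ (y/x)^m. The extra factor x
makes up for t ↦ t^m not being Lipschitz at 0 when m < 1, as happens for m = s - 2 with 2 < s < 3.
-/
theorem rpow_sub_mul_le {m x y : ℝ} (hm : 0 ≤ m) (hy : 0 ≤ y) (hyx : y ≤ x) :
    (x ^ m - y ^ m) * x ≤ max 1 m * x ^ m * (x - y) := by
  have hx := hy.trans hyx
  rcases hx.eq_or_lt with rfl | hx
  · have : y = 0 := le_antisymm hyx hy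
    simp [this]
  rcases le_total 1 m with h1 | h1
  · rw [max_eq_right h1]
    have h2 := rpow_tangent_le h1 hx.le hy
    have h3 : x ^ (m - 1) * x = x ^ m := by rw [Real.rpow_sub_one hx.ne']; field_simp
    have h4 : (x ^ m - y ^ m) * x ≤ (m * x ^ (m - 1) * (x - y)) * x := by
      gcongr
      linarith
    refine h4.trans_eq ?_
    rw [← h3]; ring
  · rw [max_eq_left h1]
    have h2 : y / x ≤ (y / x) ^ m := by
      have := Real.rpow_le_rpow_of_exponent_ge' (div_nonneg hy hx.le) ((div_le_one hx).2 hyx) hm h1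
      rwa [Real.rpow_one] at this
    rw [Real.div_rpow hy hx.le, div_le_div_iff₀ hx (Real.rpow_pos_of_pos hx m)] at h2
    linarith

/-- Second order Taylor estimate for `z ↦ ‖z‖ ^ s`. -/
theorem abs_norm_add_rpow_sub_sub_le {s : ℝ} (hs : 2 ≤ s) (z h : ℂ) :
    |‖z + h‖ ^ s - ‖z‖ ^ s - s * (‖z‖ ^ (s - 2) * inner ℝ z h)|
      ≤ (s * max 1 (s - 2) + s / 2) * ((‖z‖ + ‖h‖) ^ (s - 2) * ‖h‖ ^ (2 : ℝ)) := by
  have hs0 : 0 < s := by linarith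
  have hm : 0 ≤ s - 2 := by linarith
  set α := ‖z‖ with hα
  set β := ‖z + h‖ with hβ
  have hα0 : 0 ≤ α := norm_nonneg _
  have hβ0 : 0 ≤ β := norm_nonneg _
  have hβ2 : β ^ 2 - α ^ 2 = 2 * inner ℝ z h + ‖h‖ ^ 2 := by
    rw [hβ, hα, norm_add_sq_real]; ring
  have hr2 : ∀ t : ℝ, 0 ≤ t → (t ^ 2) ^ (s / 2) = t ^ s := fun t ht => by
    rw [← Real.rpow_natCast, ← Real.rpow_mul ht]; congr 1; push_cast; ring
  have hr2' : ∀ t : ℝ, 0 ≤ t → (t ^ 2) ^ (s / 2 - 1) = t ^ (s - 2) := fun t ht => by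
    rw [← Real.rpow_natCast, ← Real.rpow_mul ht]; congr 1; push_cast; ring
  -- The power s/2 is convex in the squared norm. The tangents at the two endpoints bound the
  -- increment from below and above, and their gap is (s/2)(β^(s-2) - α^(s-2))(β² - α²), estimated
  -- in `hmid`.
  have hlow := rpow_tangent_le (s := s / 2) (x := α ^ 2) (y := β ^ 2) (by linarith)
    (by positivity) (by positivity)
  have hup := rpow_tangent_le (s := s / 2) (x := β ^ 2) (y := α ^ 2) (by linarith)
    (by positivity) (by positivity)
  rw [hr2 _ hα0, hr2 _ hβ0, hr2' _ hα0] at hlow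
  rw [hr2 _ hα0, hr2 _ hβ0, hr2' _ hβ0] at hup
  have hαm : 0 ≤ α ^ (s - 2) := Real.rpow_nonneg hα0 _
  have hh2 : ‖h‖ ^ (2 : ℝ) = ‖h‖ ^ 2 := Real.rpow_two _
  have hmid : (β ^ (s - 2) - α ^ (s - 2)) * (β ^ 2 - α ^ 2)
      ≤ 2 * max 1 (s - 2) * ((α + ‖h‖) ^ (s - 2) * ‖h‖ ^ 2) := by
    have key : ∀ x y : ℝ, 0 ≤ y → y ≤ x → x ≤ α + ‖h‖ → x - y ≤ ‖h‖ →
        (x ^ (s - 2) - y ^ (s - 2)) * (x ^ 2 - y ^ 2)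
          ≤ 2 * max 1 (s - 2) * ((α + ‖h‖) ^ (s - 2) * ‖h‖ ^ 2) := by
      intro x y hy hyx hx hxy
      have hx0 := hy.trans hyx
      have hmono : 0 ≤ x ^ (s - 2) - y ^ (s - 2) := sub_nonneg.2 (Real.rpow_le_rpow hy hyx hm)
      have h1 := rpow_sub_mul_le hm hy hyx
      have h3 : x ^ (s - 2) ≤ (α + ‖h‖) ^ (s - 2) := Real.rpow_le_rpow hx0 hx hm
      have hmax : 0 ≤ max 1 (s - 2) := le_max_of_le_left zero_le_one
      calc (x ^ (s - 2) - y ^ (s - 2)) * (x ^ 2 - y ^ 2)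
          = ((x ^ (s - 2) - y ^ (s - 2)) * (x + y)) * (x - y) := by ring
        _ ≤ ((x ^ (s - 2) - y ^ (s - 2)) * (2 * x)) * (x - y) := by
            gcongr
            linarith
        _ = 2 * ((x ^ (s - 2) - y ^ (s - 2)) * x) * (x - y) := by ring
        _ ≤ 2 * (max 1 (s - 2) * x ^ (s - 2) * (x - y)) * (x - y) := by
            gcongr
        _ = 2 * max 1 (s - 2) * (x ^ (s - 2) * (x - y) ^ 2) := by ring
        _ ≤ _ := by
            gcongr
    rcases le_total α β with h' | h'
    · refine key β α hα0 h' (norm_add_le _ _) ?_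
      have := norm_add_le z h
      linarith
    · have h9 := key α β hβ0 h' (le_add_of_nonneg_right (norm_nonneg _)) ?_
      · linarith
      · have := norm_sub_norm_le z (z + h)
        rw [show z - (z + h) = -h by ring, norm_neg] at this
        linarith
  have hαle : α ^ (s - 2) * ‖h‖ ^ 2 ≤ (α + ‖h‖) ^ (s - 2) * ‖h‖ ^ 2 := by
    gcongr
    linarith [norm_nonneg h]
  have hαh : 0 ≤ α ^ (s - 2) * ‖h‖ ^ 2 := by positivity
  have hin : inner ℝ z h = (β ^ 2 - α ^ 2 - ‖h‖ ^ 2) / 2 := by rw [hβ2]; ring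
  rw [hh2, hin, abs_of_nonneg (by nlinarith)]
  nlinarith

end DoublePowerNLS

namespace DoublePowerNLS

/-! ### The action along rays and the Nehari manifold, abstractly. -/

section Fibre

variable {p q : ℝ}

/-- `t ↦ a t² + b t^{p+1} - c t^{q+1}`, divided by `t^{q+1}`. -/
theorem fibre_eq (a b c : ℝ) {t : ℝ} (ht : 0 < t) :
    a * t ^ 2 + b * t ^ (p + 1) - c * t ^ (q + 1)
      = t ^ (q + 1) * (a * t ^ (-(q - 1)) + b * t ^ (-(q - p)) - c) := by
  have h1 : t ^ (q + 1) * t ^ (-(q - 1)) = t ^ 2 := by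
    rw [← Real.rpow_add ht, ← Real.rpow_two]; congr 1; ring
  have h2 : t ^ (q + 1) * t ^ (-(q - p)) = t ^ (p + 1) := by
    rw [← Real.rpow_add ht]; congr 1; ring
  rw [← h1, ← h2]; ring

theorem fibre_strictAnti (hp : 1 < p) (hpq : p < q) {a b : ℝ} (ha : 0 ≤ a) (hb : 0 ≤ b)
    (hab : 0 < a + b) {s t : ℝ} (hs : 0 < s) (hst : s < t) :
    a * t ^ (-(q - 1)) + b * t ^ (-(q - p)) < a * s ^ (-(q - 1)) + b * s ^ (-(q - p)) := by
  have h1 : t ^ (-(q - 1)) < s ^ (-(q - 1)) := Real.rpow_lt_rpow_of_neg hs hst (by linarith)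
  have h2 : t ^ (-(q - p)) < s ^ (-(q - p)) := Real.rpow_lt_rpow_of_neg hs hst (by linarith)
  rcases ha.eq_or_lt with rfl | ha
  · have hb' : 0 < b := by linarith
    nlinarith
  · nlinarith

/-- After division by t^(q+1) the first two terms are large near 0 and tend to 0 at infinity, so
they take the value c > 0. -/
theorem exists_fibre_zero (hp : 1 < p) (hpq : p < q) {a b c : ℝ} (ha : 0 ≤ a) (hb : 0 ≤ b)
    (hab : 0 < a + b) (hc : 0 < c) :
    ∃ t, 0 < t ∧ a * t ^ 2 + b * t ^ (p + 1) - c * t ^ (q + 1) = 0 := by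
  set ψ : ℝ → ℝ := fun t => a * t ^ (-(q - 1)) + b * t ^ (-(q - p)) with hψ
  have hcont : ContinuousOn ψ (Set.Ioi 0) := by
    intro t ht
    have ht' : t ≠ 0 := ne_of_gt ht
    exact ((continuousAt_const.mul (Real.continuousAt_rpow_const _ _ (Or.inl ht'))).add
      (continuousAt_const.mul (Real.continuousAt_rpow_const _ _ (Or.inl ht')))).continuousWithinAt
  have htop : Tendsto ψ atTop (𝓝 0) := by
    have h1 := (tendsto_rpow_neg_atTop (y := q - 1) (by linarith)).const_mul a
    have h2 := (tendsto_rpow_neg_atTop (y := q - p) (by linarith)).const_mul b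
    have h3 := h1.add h2
    rwa [mul_zero, mul_zero, add_zero] at h3
  have hlarge : ∃ t, 0 < t ∧ ψ t < c :=
    ((eventually_gt_atTop 0).and (htop.eventually_lt_const hc)).exists
  have hsmall : ∃ t, 0 < t ∧ c < ψ t := by
    have hz : ∀ y : ℝ, 0 < y → Tendsto (fun t : ℝ => t ^ (-y)) (𝓝[>] 0) atTop := fun y hy =>
      tendsto_rpow_neg_nhdsGT_zero (by linarith)
    have h0 : Tendsto ψ (𝓝[>] 0) atTop := by
      rcases ha.eq_or_lt with rfl | ha
      · have hb' : 0 < b := by linarith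
        simpa [hψ] using (hz (q - p) (by linarith)).const_mul_atTop hb'
      · refine tendsto_atTop_mono' _ ?_ ((hz (q - 1) (by linarith)).const_mul_atTop ha)
        filter_upwards [self_mem_nhdsWithin] with t ht
        have : 0 ≤ b * t ^ (-(q - p)) := mul_nonneg hb (Real.rpow_nonneg (le_of_lt ht) _)
        simp only [hψ]
        linarith
    obtain ⟨t, h1, ht⟩ := ((h0.eventually_gt_atTop c).and self_mem_nhdsWithin).exists
    exact ⟨t, ht, h1⟩
  obtain ⟨t₁, ht₁, h1⟩ := hlarge
  obtain ⟨t₂, ht₂, h2⟩ := hsmall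
  obtain ⟨t, ht, htc⟩ := isPreconnected_Ioi.intermediate_value (Set.mem_Ioi.2 ht₁)
    (Set.mem_Ioi.2 ht₂) hcont ⟨h1.le, h2.le⟩
  refine ⟨t, ht, ?_⟩
  rw [fibre_eq a b c ht, show a * t ^ (-(q - 1)) + b * t ^ (-(q - p)) = c from htc, sub_self,
    mul_zero]

/-- The quotient by t^(q+1) is strictly decreasing, so K changes sign at most once along a ray, from
positive to negative. -/
theorem fibre_pos_of_lt (hp : 1 < p) (hpq : p < q) {a b c : ℝ} (ha : 0 ≤ a) (hb : 0 ≤ b)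
    (hab : 0 < a + b) {s t : ℝ} (hs : 0 < s) (hst : s < t)
    (ht0 : 0 ≤ a * t ^ 2 + b * t ^ (p + 1) - c * t ^ (q + 1)) :
    0 < a * s ^ 2 + b * s ^ (p + 1) - c * s ^ (q + 1) := by
  rw [fibre_eq a b c (hs.trans hst)] at ht0
  rw [fibre_eq a b c hs]
  have h1 := fibre_strictAnti hp hpq ha hb hab hs hst
  have h2 := nonneg_of_mul_nonneg_right ht0 (Real.rpow_pos_of_pos (hs.trans hst) _)
  exact mul_pos (Real.rpow_pos_of_pos hs _) (by linarith)

/-- Convexity of x ↦ x^(k/m), through its tangent at 1, evaluated at x = t^m. -/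
theorem one_sub_rpow_div_le {m k t : ℝ} (hm : 0 < m) (hmk : m ≤ k) (ht : 0 < t) :
    (1 - t ^ k) / k ≤ (1 - t ^ m) / m := by
  have h := rpow_tangent_le (s := k / m) (x := 1) (y := t ^ m) ((one_le_div hm).2 hmk) zero_le_one
    (Real.rpow_nonneg ht.le _)
  rw [← Real.rpow_mul ht.le, mul_div_cancel₀ _ hm.ne', Real.one_rpow, Real.one_rpow] at h
  have hk : 0 < k := hm.trans_le hmk
  rw [div_le_div_iff₀ hk hm]
  have h2 : k / m * (t ^ m - 1) * m = k * (t ^ m - 1) := by field_simp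
  nlinarith

/-- On the ray through a point of the Nehari manifold, the action is maximal at this point. -/
theorem fibre_le (hp : 1 < p) (hpq : p < q) {a b c : ℝ} (ha : 0 ≤ a) (hb : 0 ≤ b)
    (h : a + b = c) {t : ℝ} (ht : 0 < t) :
    1 / 2 * (a * t ^ 2) + 1 / (p + 1) * (b * t ^ (p + 1)) - 1 / (q + 1) * (c * t ^ (q + 1))
      ≤ 1 / 2 * a + 1 / (p + 1) * b - 1 / (q + 1) * c := by
  have h1 := one_sub_rpow_div_le (m := 2) (k := q + 1) two_pos (by linarith) ht
  have h2 := one_sub_rpow_div_le (m := p + 1) (k := q + 1) (by linarith) (by linarith) ht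
  rw [Real.rpow_two] at h1
  have h3 := mul_le_mul_of_nonneg_left h1 ha
  have h4 := mul_le_mul_of_nonneg_left h2 hb
  subst h
  simp only [div_eq_mul_inv] at *
  nlinarith

end Fibre

/-- Three functionals that are homogeneous of degrees `2 < p + 1 < q + 1`. -/
structure IsNehariTriple {E : Type*} [AddCommGroup E] [Module ℝ E] (p q : ℝ) (A B C : E → ℝ) :
    Prop where
  one_lt : 1 < p
  lt : p < q
  nonneg_A : ∀ v, 0 ≤ A v
  nonneg_B : ∀ v, 0 ≤ B v
  pos : ∀ v, v ≠ 0 → 0 < A v + B v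
  zero_C : C 0 = 0
  smul_A : ∀ (t : ℝ) (v : E), 0 < t → A (t • v) = A v * t ^ 2
  smul_B : ∀ (t : ℝ) (v : E), 0 < t → B (t • v) = B v * t ^ (p + 1)
  smul_C : ∀ (t : ℝ) (v : E), 0 < t → C (t • v) = C v * t ^ (q + 1)

namespace IsNehariTriple

section Algebra

variable {E : Type*} [AddCommGroup E] [Module ℝ E] {p q : ℝ} {A B C : E → ℝ}

theorem exists_smul (h : IsNehariTriple p q A B C) {v : E} (hC : 0 < C v) :
    ∃ t : ℝ, 0 < t ∧ t • v ≠ 0 ∧ A (t • v) + B (t • v) - C (t • v) = 0 := by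
  have hv : v ≠ 0 := fun h0 => by rw [h0, h.zero_C] at hC; exact lt_irrefl _ hC
  obtain ⟨t, ht, h0⟩ := exists_fibre_zero h.one_lt h.lt (h.nonneg_A v) (h.nonneg_B v) (h.pos v hv) hC
  refine ⟨t, ht, smul_ne_zero ht.ne' hv, ?_⟩
  rwa [h.smul_A t v ht, h.smul_B t v ht, h.smul_C t v ht]

/-- The part of the action that is controlled on the Nehari manifold. -/
theorem action_eq (A B C p q : ℝ) :
    1 / 2 * A + 1 / (p + 1) * B - 1 / (q + 1) * C
      = (1 / 2 - 1 / (q + 1)) * A + (1 / (p + 1) - 1 / (q + 1)) * B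
        + 1 / (q + 1) * (A + B - C) := by ring

theorem coeff_pos (h : IsNehariTriple p q A B C) :
    0 < 1 / 2 - 1 / (q + 1) ∧ 0 < 1 / (p + 1) - 1 / (q + 1) ∧
      1 / (p + 1) - 1 / (q + 1) ≤ 1 / 2 - 1 / (q + 1) := by
  have h1 := h.one_lt
  have h2 := h.lt
  refine ⟨?_, ?_, ?_⟩
  · rw [sub_pos]; exact one_div_lt_one_div_of_lt two_pos (by linarith)
  · rw [sub_pos]; exact one_div_lt_one_div_of_lt (by linarith) (by linarith)
  · have := one_div_le_one_div_of_le two_pos (show (2 : ℝ) ≤ p + 1 by linarith)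
    linarith

/-- If K(v) ≤ 0, the multiple tv on the Nehari manifold has t ≤ 1, and I = S there. As I is
increasing along rays, μ ≤ I(tv) ≤ I(v), with t < 1 and a strict inequality when K(v) < 0. Unlike
membership in the manifold, the condition K ≤ 0 can be used for weak limits and remainders. -/
theorem level_le (h : IsNehariTriple p q A B C) {μ : ℝ}
    (hμ : ∀ w, w ≠ 0 → A w + B w - C w = 0 →
      μ ≤ 1 / 2 * A w + 1 / (p + 1) * B w - 1 / (q + 1) * C w)
    {v : E} (hv : v ≠ 0) (hK : A v + B v - C v ≤ 0) :
    μ ≤ (1 / 2 - 1 / (q + 1)) * A v + (1 / (p + 1) - 1 / (q + 1)) * B v ∧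
    (A v + B v - C v < 0 →
      μ < (1 / 2 - 1 / (q + 1)) * A v + (1 / (p + 1) - 1 / (q + 1)) * B v) := by
  obtain ⟨hα, hβ, -⟩ := h.coeff_pos
  have hAB := h.pos v hv
  have hp := h.one_lt
  obtain ⟨t, ht, htv, h0⟩ := h.exists_smul (v := v) (by linarith)
  have hlev := hμ _ htv h0
  rw [action_eq, h0, mul_zero, add_zero] at hlev
  rw [h.smul_A t v ht, h.smul_B t v ht] at hlev
  rw [h.smul_A t v ht, h.smul_B t v ht, h.smul_C t v ht] at h0
  have hA := h.nonneg_A v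
  have hB := h.nonneg_B v
  have ht1 : t ≤ 1 := by
    by_contra! hlt
    have := fibre_pos_of_lt h.one_lt h.lt hA hB hAB one_pos hlt h0.ge
    simp only [one_pow, Real.one_rpow, mul_one] at this
    linarith
  have hmono : (1 / 2 - 1 / (q + 1)) * (A v * t ^ 2) + (1 / (p + 1) - 1 / (q + 1)) * (B v * t ^ (p + 1))
      ≤ (1 / 2 - 1 / (q + 1)) * A v + (1 / (p + 1) - 1 / (q + 1)) * B v := by
    have h1 : t ^ 2 ≤ 1 := pow_le_one₀ ht.le ht1
    have h2 : t ^ (p + 1) ≤ 1 := Real.rpow_le_one ht.le ht1 (by linarith)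
    have h3 : A v * t ^ 2 ≤ A v := mul_le_of_le_one_right hA h1
    have h4 : B v * t ^ (p + 1) ≤ B v := mul_le_of_le_one_right hB h2
    gcongr
  refine ⟨hlev.trans hmono, fun hlt => hlev.trans_lt ?_⟩
  have ht1' : t < 1 := by
    refine lt_of_le_of_ne ht1 fun h1 => ?_
    subst h1
    simp only [one_pow, Real.one_rpow, mul_one] at h0
    linarith
  have h1 : t ^ 2 < 1 := pow_lt_one₀ ht.le ht1' two_ne_zero
  have h2 : t ^ (p + 1) < 1 := Real.rpow_lt_one ht.le ht1' (by linarith)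
  rcases hA.eq_or_lt with hA0 | hA0
  · have hB0 : 0 < B v := by linarith
    rw [← hA0]
    have : B v * t ^ (p + 1) < B v := mul_lt_of_lt_one_right hB0 h2
    have := mul_lt_mul_of_pos_left this hβ
    linarith
  · have h3 : A v * t ^ 2 < A v := mul_lt_of_lt_one_right hA0 h1
    have h4 : B v * t ^ (p + 1) ≤ B v := mul_le_of_le_one_right hB h2.le
    have := mul_lt_mul_of_pos_left h3 hα
    have := mul_le_mul_of_nonneg_left h4 hβ.le
    linarith

end Algebra

variable {E : Type*} [NormedAddCommGroup E] [NormedSpace ℝ E] {p q : ℝ} {A B C : E → ℝ}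

theorem tendsto_slope {F : E → ℝ} {L : E →L[ℝ] ℝ} {v : E} (hF : HasFDerivAt F L v) (w : E) :
    Tendsto (fun ε : ℝ => ε⁻¹ * (F (v + ε • w) - F v)) (𝓝[>] 0) (𝓝 (L w)) := by
  have h1 : HasDerivAt (fun ε : ℝ => v + ε • w) w 0 := by
    simpa using ((hasDerivAt_id (0 : ℝ)).smul_const w).const_add v
  have h2 : HasDerivAt (fun ε : ℝ => F (v + ε • w)) (L w) 0 := by
    refine HasFDerivAt.comp_hasDerivAt (l := F) (0 : ℝ) ?_ h1
    simpa using hF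
  simpa using h2.tendsto_slope_zero_right

/-- A minimizer of the action on the Nehari manifold is a critical point of the action. -/
theorem hasFDerivAt_zero (h : IsNehariTriple p q A B C) {v : E} (hv : v ≠ 0)
    (hK : A v + B v - C v = 0)
    (hmin : ∀ w, w ≠ 0 → A w + B w - C w = 0 →
      1 / 2 * A v + 1 / (p + 1) * B v - 1 / (q + 1) * C v
        ≤ 1 / 2 * A w + 1 / (p + 1) * B w - 1 / (q + 1) * C w)
    (hA : DifferentiableAt ℝ A v) (hB : DifferentiableAt ℝ B v) (hC : DifferentiableAt ℝ C v) :
    HasFDerivAt (fun w => 1 / 2 * A w + 1 / (p + 1) * B w - 1 / (q + 1) * C w) (0 : E →L[ℝ] ℝ) v := by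
  have hp := h.one_lt
  have hpq := h.lt
  have hAB := h.pos v hv
  obtain ⟨A', hA'⟩ := hA
  obtain ⟨B', hB'⟩ := hB
  obtain ⟨C', hC'⟩ := hC
  set L : E →L[ℝ] ℝ := (1 / 2 : ℝ) • A' + (1 / (p + 1)) • B' - (1 / (q + 1)) • C' with hL
  have hder : HasFDerivAt (fun w => 1 / 2 * A w + 1 / (p + 1) * B w - 1 / (q + 1) * C w) L v :=
    ((hA'.const_mul _).add (hB'.const_mul _)).sub (hC'.const_mul _)
  -- A one-sided inequality suffices, since it applies to -w as well.
  have key : ∀ w, 0 ≤ L w := by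
    intro w
    have hline : Tendsto (fun ε : ℝ => v + ε • w) (𝓝[>] 0) (𝓝 v) := by
      have : Continuous fun ε : ℝ => v + ε • w := by fun_prop
      simpa using (this.tendsto 0).mono_left nhdsWithin_le_nhds
    have hAl : Tendsto (fun ε : ℝ => A (v + ε • w)) (𝓝[>] 0) (𝓝 (A v)) :=
      hA'.continuousAt.tendsto.comp hline
    have hBl : Tendsto (fun ε : ℝ => B (v + ε • w)) (𝓝[>] 0) (𝓝 (B v)) :=
      hB'.continuousAt.tendsto.comp hline
    have hCl : Tendsto (fun ε : ℝ => C (v + ε • w)) (𝓝[>] 0) (𝓝 (C v)) :=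
      hC'.continuousAt.tendsto.comp hline
    have hCpos : 0 < C v := by linarith
    have hex : ∀ᶠ ε in 𝓝[>] (0 : ℝ), ∃ t : ℝ, 0 < t ∧ t • (v + ε • w) ≠ 0 ∧
        A (t • (v + ε • w)) + B (t • (v + ε • w)) - C (t • (v + ε • w)) = 0 := by
      filter_upwards [hCl.eventually_const_lt hCpos] with ε hε using h.exists_smul hε
    obtain ⟨t, ht⟩ := hex.choice
    have hfib : ∀ s : ℝ, Tendsto (fun ε : ℝ => A (v + ε • w) * s ^ 2 + B (v + ε • w) * s ^ (p + 1)
        - C (v + ε • w) * s ^ (q + 1)) (𝓝[>] 0)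
        (𝓝 (A v * s ^ 2 + B v * s ^ (p + 1) - C v * s ^ (q + 1))) := fun s =>
      ((hAl.mul_const _).add (hBl.mul_const _)).sub (hCl.mul_const _)
    have hABl := (hAl.add hBl).eventually_const_lt hAB
    have hzero : ∀ᶠ ε in 𝓝[>] (0 : ℝ), 0 < t ε ∧ A (v + ε • w) * t ε ^ 2
        + B (v + ε • w) * t ε ^ (p + 1) - C (v + ε • w) * t ε ^ (q + 1) = 0 := by
      filter_upwards [ht] with ε hε
      obtain ⟨h1, -, h3⟩ := hε
      rw [h.smul_A _ _ h1, h.smul_B _ _ h1, h.smul_C _ _ h1] at h3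
      exact ⟨h1, h3⟩
    -- The fibre function of v changes sign at 1; the strict signs at a point below and a point
    -- above 1 persist for small ε and trap the zero t(ε).
    have htlim : Tendsto t (𝓝[>] 0) (𝓝 1) := by
      refine tendsto_order.2 ⟨fun a ha => ?_, fun a ha => ?_⟩
      · set s := max a (1 / 2) with hs
        have hs0 : 0 < s := lt_max_of_lt_right (by norm_num)
        have hs1 : s < 1 := max_lt ha (by norm_num)
        have hpos := fibre_pos_of_lt hp hpq (c := C v) (h.nonneg_A v) (h.nonneg_B v) hAB hs0 hs1
          (by simpa using hK.ge)
        filter_upwards [(hfib s).eventually_const_lt hpos, hzero, hABl] with ε h1 ⟨h2, h3⟩ h4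
        refine lt_of_le_of_lt (le_max_left a (1 / 2)) ?_
        by_contra! hle
        rcases hle.eq_or_lt with heq | hlt
        · rw [heq] at h3; exact h1.ne' h3
        · have := fibre_pos_of_lt hp hpq (h.nonneg_A _) (h.nonneg_B _) h4 h2 hlt h1.le
          linarith
      · have hneg : A v * a ^ 2 + B v * a ^ (p + 1) - C v * a ^ (q + 1) < 0 := by
          by_contra! hge
          have := fibre_pos_of_lt hp hpq (h.nonneg_A v) (h.nonneg_B v) hAB one_pos ha hge
          simp only [one_pow, Real.one_rpow, mul_one] at this
          linarith
        filter_upwards [(hfib a).eventually_lt_const hneg, hzero, hABl] with ε h1 ⟨h2, h3⟩ h4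
        by_contra! hle
        rcases hle.eq_or_lt with heq | hlt
        · rw [heq] at h1; exact h1.ne h3
        · have := fibre_pos_of_lt hp hpq (h.nonneg_A _) (h.nonneg_B _) h4
            (one_pos.trans ha) hlt h3.ge
          linarith
    have hq : Tendsto (fun ε : ℝ =>
        1 / 2 * (t ε ^ 2 * (ε⁻¹ * (A (v + ε • w) - A v)))
        + 1 / (p + 1) * (t ε ^ (p + 1) * (ε⁻¹ * (B (v + ε • w) - B v)))
        - 1 / (q + 1) * (t ε ^ (q + 1) * (ε⁻¹ * (C (v + ε • w) - C v)))) (𝓝[>] 0) (𝓝 (L w)) := by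
      have hr : ∀ s : ℝ, Tendsto (fun ε => t ε ^ s) (𝓝[>] 0) (𝓝 1) := fun s => by
        simpa using htlim.rpow_const (p := s) (Or.inl one_ne_zero)
      have h2 : Tendsto (fun ε => t ε ^ 2) (𝓝[>] 0) (𝓝 1) := by simpa using htlim.pow 2
      have := (((h2.mul (tendsto_slope hA' w)).const_mul (1 / 2)).add
        (((hr (p + 1)).mul (tendsto_slope hB' w)).const_mul (1 / (p + 1)))).sub
        (((hr (q + 1)).mul (tendsto_slope hC' w)).const_mul (1 / (q + 1)))
      simpa [hL] using this
    refine ge_of_tendsto hq ?_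
    filter_upwards [ht, self_mem_nhdsWithin] with ε ⟨h1, h2, h3⟩ hε
    have hε0 : (0 : ℝ) < ε := hε
    have h4 := hmin _ h2 h3
    rw [h.smul_A _ _ h1, h.smul_B _ _ h1, h.smul_C _ _ h1] at h4
    -- Comparing v + εw with v at the same factor t(ε), via S(tv) ≤ S(v) ≤ S(t(v + εw)), requires
    -- only continuity of t at 0, not differentiability.
    have h5 := fibre_le hp hpq (h.nonneg_A v) (h.nonneg_B v) (sub_eq_zero.1 hK) h1
    have h6 : 0 ≤ ε⁻¹ * (1 / 2 * (t ε ^ 2 * (A (v + ε • w) - A v))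
        + 1 / (p + 1) * (t ε ^ (p + 1) * (B (v + ε • w) - B v))
        - 1 / (q + 1) * (t ε ^ (q + 1) * (C (v + ε • w) - C v))) := by
      refine mul_nonneg (inv_nonneg.2 hε0.le) ?_
      have h7 := h5.trans h4
      rw [← sub_nonneg] at h7
      refine h7.trans_eq ?_
      ring
    refine h6.trans_eq ?_
    ring
  have hL0 : L = 0 := by
    ext w
    have h1 := key w
    have h2 := key (-w)
    rw [map_neg] at h2
    simp only [zero_apply]
    linarith
  rwa [hL0] at hder

/-- A critical point of the action satisfies the Nehari identity. -/
theorem eq_zero_of_hasFDerivAt_zero (h : IsNehariTriple p q A B C) {v : E}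
    (hcrit : HasFDerivAt (fun w => 1 / 2 * A w + 1 / (p + 1) * B w - 1 / (q + 1) * C w)
      (0 : E →L[ℝ] ℝ) v) : A v + B v - C v = 0 := by
  have hp := h.one_lt
  have hpq := h.lt
  have h1 : HasDerivAt (fun t : ℝ => t • v) v 1 := by
    simpa using (hasDerivAt_id (1 : ℝ)).smul_const v
  have h2 : HasDerivAt (fun t : ℝ => 1 / 2 * A (t • v) + 1 / (p + 1) * B (t • v)
      - 1 / (q + 1) * C (t • v)) 0 1 := by
    have := HasFDerivAt.comp_hasDerivAt (l := fun w => 1 / 2 * A w + 1 / (p + 1) * B w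
      - 1 / (q + 1) * C w) (l' := (0 : E →L[ℝ] ℝ)) (1 : ℝ) (by simpa only [one_smul] using hcrit) h1
    exact this
  have hpow : ∀ s : ℝ, HasDerivAt (fun t : ℝ => t ^ s) s 1 := fun s => by
    simpa using Real.hasDerivAt_rpow_const (x := 1) (p := s) (Or.inl one_ne_zero)
  have h3 : HasDerivAt (fun t : ℝ => 1 / 2 * (A v * t ^ 2) + 1 / (p + 1) * (B v * t ^ (p + 1))
      - 1 / (q + 1) * (C v * t ^ (q + 1)))
      (1 / 2 * (A v * 2) + 1 / (p + 1) * (B v * (p + 1)) - 1 / (q + 1) * (C v * (q + 1))) 1 := by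
    have h2' : HasDerivAt (fun t : ℝ => t ^ 2) 2 1 := by simpa using hasDerivAt_pow 2 (1 : ℝ)
    exact (((h2'.const_mul _).const_mul _).add (((hpow _).const_mul _).const_mul _)).sub
      (((hpow _).const_mul _).const_mul _)
  have h4 := h3.congr_of_eventuallyEq (f₁ := fun t : ℝ => 1 / 2 * A (t • v)
      + 1 / (p + 1) * B (t • v) - 1 / (q + 1) * C (t • v)) (by
    filter_upwards [lt_mem_nhds (zero_lt_one (α := ℝ))] with t ht
    rw [h.smul_A t v ht, h.smul_B t v ht, h.smul_C t v ht])
  have h5 := h4.unique h2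
  have hp1 : p + 1 ≠ 0 := by linarith
  have hq1 : q + 1 ≠ 0 := by linarith
  field_simp at h5
  linarith

end IsNehariTriple

end DoublePowerNLS

namespace DoublePowerNLS

/-! ### Differentiability of the integral of a power. -/

section LpDerivative

variable {α : Type*} [MeasurableSpace α] {μ : Measure α}

theorem integral_rpow_mul_rpow_le {E F : Type*} [NormedAddCommGroup E] [NormedAddCommGroup F]
    {f : α → E} {h : α → F} {s a b : ℝ} (hs : 0 < s) (ha : 0 ≤ a) (hb : 0 ≤ b) (hab : a + b = s)
    (hf : MemLp f (ENNReal.ofReal s) μ) (hh : MemLp h (ENNReal.ofReal s) μ) :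
    Integrable (fun x => ‖f x‖ ^ a * ‖h x‖ ^ b) μ ∧
    ∫ x, ‖f x‖ ^ a * ‖h x‖ ^ b ∂μ ≤ (eLpNorm f (ENNReal.ofReal s) μ).toReal ^ a
      * (eLpNorm h (ENNReal.ofReal s) μ).toReal ^ b := by
  have key : ∫⁻ x, ‖f x‖ₑ ^ a * ‖h x‖ₑ ^ b ∂μ
      ≤ eLpNorm f (ENNReal.ofReal s) μ ^ a * eLpNorm h (ENNReal.ofReal s) μ ^ b := by
    have h1 := ENNReal.lintegral_mul_norm_pow_le (μ := μ) (hf.1.enorm.pow_const s)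
      (hh.1.enorm.pow_const s) (p := a / s) (q := b / s) (by positivity) (by positivity)
      (by rw [← add_div, hab, div_self hs.ne'])
    simp only [← ENNReal.rpow_mul, mul_div_cancel₀ _ hs.ne'] at h1
    have h2 : ∀ t : ℝ, 1 / s * t = t / s := fun t => by ring
    rw [eLpNorm_ofReal_eq f hs, eLpNorm_ofReal_eq h hs, ← ENNReal.rpow_mul, ← ENNReal.rpow_mul, h2, h2]
    exact h1
  have htop : eLpNorm f (ENNReal.ofReal s) μ ^ a * eLpNorm h (ENNReal.ofReal s) μ ^ b ≠ ∞ :=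
    ENNReal.mul_ne_top (ENNReal.rpow_ne_top_of_nonneg ha hf.2.ne)
      (ENNReal.rpow_ne_top_of_nonneg hb hh.2.ne)
  have hen : ∀ x, ‖‖f x‖ ^ a * ‖h x‖ ^ b‖ₑ = ‖f x‖ₑ ^ a * ‖h x‖ₑ ^ b := fun x => by
    rw [enorm_mul, Real.enorm_rpow_of_nonneg (norm_nonneg _) ha,
      Real.enorm_rpow_of_nonneg (norm_nonneg _) hb, enorm_norm, enorm_norm]
  have hmeas : AEStronglyMeasurable (fun x => ‖f x‖ ^ a * ‖h x‖ ^ b) μ :=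
    ((hf.1.norm.aemeasurable.pow_const a).mul
      (hh.1.norm.aemeasurable.pow_const b)).aestronglyMeasurable
  refine ⟨⟨hmeas, ?_⟩, ?_⟩
  · unfold HasFiniteIntegral
    simp only [hen]
    exact key.trans_lt htop.lt_top
  · rw [integral_eq_lintegral_of_nonneg_ae (ae_of_all _ fun x => by positivity) hmeas]
    have h3 : ∀ x, ENNReal.ofReal (‖f x‖ ^ a * ‖h x‖ ^ b) = ‖f x‖ₑ ^ a * ‖h x‖ₑ ^ b := fun x => by
      rw [← hen, Real.enorm_of_nonneg (by positivity)]
    simp only [h3]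
    refine (ENNReal.toReal_mono htop key).trans_eq ?_
    rw [ENNReal.toReal_mul, ← ENNReal.toReal_rpow, ← ENNReal.toReal_rpow]

/-- The integrand is the candidate for the derivative at f in the direction h; Hölder makes it a
bounded functional of h. -/
theorem integrable_rpow_mul_inner {s : ℝ} (hs : 2 ≤ s) {f h : α → ℂ}
    (hf : MemLp f (ENNReal.ofReal s) μ) (hh : MemLp h (ENNReal.ofReal s) μ) :
    Integrable (fun x => s * (‖f x‖ ^ (s - 2) * inner ℝ (f x) (h x))) μ ∧
    |∫ x, s * (‖f x‖ ^ (s - 2) * inner ℝ (f x) (h x)) ∂μ|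
      ≤ s * (eLpNorm f (ENNReal.ofReal s) μ).toReal ^ (s - 1)
        * (eLpNorm h (ENNReal.ofReal s) μ).toReal := by
  have hs0 : 0 < s := by linarith
  obtain ⟨hi, hle⟩ := integral_rpow_mul_rpow_le (a := s - 1) (b := 1) hs0 (by linarith) zero_le_one
    (by ring) hf hh
  simp only [Real.rpow_one] at hi hle
  have hpt : ∀ x, ‖s * (‖f x‖ ^ (s - 2) * inner ℝ (f x) (h x))‖ ≤ s * (‖f x‖ ^ (s - 1) * ‖h x‖) := by
    intro x
    rw [norm_mul, norm_mul, Real.norm_of_nonneg hs0.le,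
      Real.norm_of_nonneg (Real.rpow_nonneg (norm_nonneg _) _)]
    have h1 : ‖f x‖ ^ (s - 1) = ‖f x‖ ^ (s - 2) * ‖f x‖ := by
      rcases (norm_nonneg (f x)).eq_or_lt with h0 | h0
      · rw [← h0, mul_zero, Real.zero_rpow (by linarith)]
      · rw [show s - 1 = s - 2 + 1 by ring, Real.rpow_add_one h0.ne']
    rw [h1, mul_assoc]
    gcongr
    exact norm_inner_le_norm _ _
  have hmeas : AEStronglyMeasurable (fun x => s * (‖f x‖ ^ (s - 2) * inner ℝ (f x) (h x))) μ :=
    (((hf.1.norm.aemeasurable.pow_const (s - 2)).mul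
      (hf.1.inner (𝕜 := ℝ) hh.1).aemeasurable).const_mul s).aestronglyMeasurable
  refine ⟨(hi.const_mul s).mono' hmeas (ae_of_all _ hpt), ?_⟩
  calc _ ≤ ∫ x, s * (‖f x‖ ^ (s - 1) * ‖h x‖) ∂μ :=
        norm_integral_le_of_norm_le (hi.const_mul s) (ae_of_all _ hpt)
    _ = s * ∫ x, ‖f x‖ ^ (s - 1) * ‖h x‖ ∂μ := integral_const_mul _ _
    _ ≤ _ := by rw [mul_assoc]; gcongr

/-- `f ↦ ∫ ‖f‖ ^ s` is differentiable on `L^s`. -/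
theorem differentiableAt_integral_norm_rpow {s : ℝ} (hs : 2 ≤ s) [Fact (1 ≤ ENNReal.ofReal s)]
    (f : Lp ℂ (ENNReal.ofReal s) μ) :
    DifferentiableAt ℝ (fun f : Lp ℂ (ENNReal.ofReal s) μ => ∫ x, ‖f x‖ ^ s ∂μ) f := by
  have hs0 : 0 < s := by linarith
  let L₀ : Lp ℂ (ENNReal.ofReal s) μ →ₗ[ℝ] ℝ :=
    { toFun := fun h => ∫ x, s * (‖f x‖ ^ (s - 2) * inner ℝ (f x) (h x)) ∂μ
      map_add' := fun h k => by
        rw [← integral_add (integrable_rpow_mul_inner hs (Lp.memLp f) (Lp.memLp h)).1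
          (integrable_rpow_mul_inner hs (Lp.memLp f) (Lp.memLp k)).1]
        refine integral_congr_ae ?_
        filter_upwards [Lp.coeFn_add h k] with x hx
        rw [hx, Pi.add_apply, inner_add_right]; ring
      map_smul' := fun c h => by
        rw [RingHom.id_apply, smul_eq_mul, ← integral_const_mul]
        refine integral_congr_ae ?_
        filter_upwards [Lp.coeFn_smul c h] with x hx
        rw [hx, Pi.smul_apply, inner_smul_right]; ring }
  let L : Lp ℂ (ENNReal.ofReal s) μ →L[ℝ] ℝ := L₀.mkContinuous
    (s * (eLpNorm f (ENNReal.ofReal s) μ).toReal ^ (s - 1))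
    fun h => (integrable_rpow_mul_inner hs (Lp.memLp f) (Lp.memLp h)).2
  refine ⟨L, ?_⟩
  rw [hasFDerivAt_iff_isLittleO_nhds_zero]
  refine Asymptotics.IsBigO.trans_isLittleO ?_
    (Asymptotics.isLittleO_norm_pow_id (E' := Lp ℂ (ENNReal.ofReal s) μ) one_lt_two)
  set c : ℝ := s * max 1 (s - 2) + s / 2 with hc
  have hc0 : 0 ≤ c := by positivity
  refine Asymptotics.IsBigO.of_bound (c * (‖f‖ + 1) ^ (s - 2)) ?_
  -- Restricting to ‖h‖ < 1 makes the factor (‖f‖ + ‖h‖)^(s-2) a constant, so the Taylor remainder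
  -- is O(‖h‖²).
  filter_upwards [Metric.ball_mem_nhds (0 : Lp ℂ (ENNReal.ofReal s) μ) one_pos] with h hh
  have hh1 : ‖h‖ < 1 := by simpa using hh
  have hsum : MemLp (fun x => ‖f x‖ + ‖h x‖) (ENNReal.ofReal s) μ :=
    (Lp.memLp f).norm.add (Lp.memLp h).norm
  have hsumN : (eLpNorm (fun x => ‖f x‖ + ‖h x‖) (ENNReal.ofReal s) μ).toReal ≤ ‖f‖ + ‖h‖ := by
    rw [Lp.norm_def, Lp.norm_def, ← ENNReal.toReal_add (Lp.eLpNorm_ne_top f) (Lp.eLpNorm_ne_top h)]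
    refine ENNReal.toReal_mono (ENNReal.add_ne_top.2 ⟨Lp.eLpNorm_ne_top f, Lp.eLpNorm_ne_top h⟩) ?_
    refine (eLpNorm_add_le (Lp.memLp f).1.norm (Lp.memLp h).1.norm Fact.out).trans_eq ?_
    rw [eLpNorm_norm, eLpNorm_norm]
  obtain ⟨hi, hle⟩ := integral_rpow_mul_rpow_le (a := s - 2) (b := 2) hs0 (by linarith) zero_le_two
    (by ring) hsum (Lp.memLp h)
  have hif := integrable_norm_rpow_of_memLp hs0 (Lp.memLp f)
  have hifh := integrable_norm_rpow_of_memLp hs0 (Lp.memLp (f + h))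
  have hiL := (integrable_rpow_mul_inner hs (Lp.memLp f) (Lp.memLp h)).1
  have heq : (∫ x, ‖(f + h : Lp ℂ (ENNReal.ofReal s) μ) x‖ ^ s ∂μ) - (∫ x, ‖f x‖ ^ s ∂μ) - L h
      = ∫ x, (‖(f + h : Lp ℂ (ENNReal.ofReal s) μ) x‖ ^ s - ‖f x‖ ^ s
        - s * (‖f x‖ ^ (s - 2) * inner ℝ (f x) (h x))) ∂μ := by
    have h1 := integral_sub (hifh.sub hif) hiL
    simp only [Pi.sub_apply] at h1
    rw [h1, integral_sub hifh hif]
    rfl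
  rw [heq]
  have hpt : ∀ᵐ x ∂μ, ‖‖(f + h : Lp ℂ (ENNReal.ofReal s) μ) x‖ ^ s - ‖f x‖ ^ s
        - s * (‖f x‖ ^ (s - 2) * inner ℝ (f x) (h x))‖
      ≤ c * (‖(‖f x‖ + ‖h x‖)‖ ^ (s - 2) * ‖h x‖ ^ (2 : ℝ)) := by
    filter_upwards [Lp.coeFn_add f h] with x hx
    rw [hx, Pi.add_apply, Real.norm_of_nonneg (by positivity : 0 ≤ ‖f x‖ + ‖h x‖)]
    exact abs_norm_add_rpow_sub_sub_le hs (f x) (h x)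
  refine (norm_integral_le_of_norm_le (hi.const_mul c) hpt).trans ?_
  rw [integral_const_mul, mul_assoc]
  refine mul_le_mul_of_nonneg_left (hle.trans ?_) hc0
  rw [norm_pow, norm_norm, Real.rpow_two, ← Lp.norm_def]
  gcongr
  linarith

end LpDerivative

end DoublePowerNLS

namespace DoublePowerNLS

/-! ### The functionals on the energy space. -/

variable {N : ℕ} {p q ω : ℝ}

/-- The exponent of the Lebesgue norm in `X_ω`, as a real number. -/
def massPower (p ω : ℝ) : ℝ := if ω = 0 then p + 1 else 2

theorem massExponent_eq (hp : 1 < p) (ω : ℝ) :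
    massExponent p ω = ENNReal.ofReal (massPower p ω) := by
  unfold massExponent massPower
  split_ifs
  · rw [ENNReal.ofReal_add (by linarith) zero_le_one, ENNReal.ofReal_one]
  · simp

theorem two_le_massPower (hp : 1 < p) (ω : ℝ) : 2 ≤ massPower p ω := by
  unfold massPower; split_ifs <;> linarith

theorem massPower_le (hp : 1 < p) (ω : ℝ) : massPower p ω ≤ p + 1 := by
  unfold massPower; split_ifs <;> linarith

/-- The conclusion is s < 2N/(N-2) with the denominator cleared; in this form it holds for every s ≥
2 when N ≤ 2. -/
theorem subcritical (hq : 3 ≤ N → q < 2 * (N : ℝ) / ((N : ℝ) - 2) - 1) {s : ℝ}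
    (hs : 2 ≤ s) (hsq : s ≤ q + 1) : (N : ℝ) * ((s - 2) / 2) < s := by
  rcases lt_or_ge N 3 with h | h
  · have : (N : ℝ) ≤ 2 := by exact_mod_cast Nat.lt_succ_iff.1 h
    nlinarith
  · have h3 : (3 : ℝ) ≤ N := by exact_mod_cast h
    have h1 := hq h
    have h2 : s < 2 * (N : ℝ) / ((N : ℝ) - 2) := by linarith
    rw [lt_div_iff₀ (by linarith)] at h2
    linarith

theorem X.hasL2Gradient (v : X N p ω) : HasL2Gradient v.toFun v.grad where
  measurable := Lp.stronglyMeasurable _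
  locallyIntegrable := (Lp.memLp v.1.1).locallyIntegrable (massExponent_fact p ω).out
  memLp := Lp.memLp _
  stronglyMeasurable_grad := Lp.stronglyMeasurable _
  isWeakGradient := v.2

theorem X.toFun_add (v w : X N p ω) : (v + w).toFun =ᵐ[volume] fun x => v.toFun x + w.toFun x :=
  Lp.coeFn_add v.1.1 w.1.1

theorem X.toFun_sub (v w : X N p ω) : (v - w).toFun =ᵐ[volume] fun x => v.toFun x - w.toFun x :=
  Lp.coeFn_sub v.1.1 w.1.1

theorem X.toFun_smul (c : ℝ) (v : X N p ω) : (c • v).toFun =ᵐ[volume] fun x => c • v.toFun x :=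
  Lp.coeFn_smul c v.1.1

theorem X.norm_eq (v : X N p ω) : ‖v‖ = max ‖v.1.1‖ ‖v.grad‖ := rfl

theorem X.eLpNorm_massPower (hp : 1 < p) (v : X N p ω) :
    eLpNorm v.toFun (ENNReal.ofReal (massPower p ω)) volume = ENNReal.ofReal ‖v.1.1‖ := by
  rw [← massExponent_eq hp, Lp.norm_def, ENNReal.ofReal_toReal (Lp.eLpNorm_ne_top _)]
  rfl

theorem eLpNorm_gradFun (g : GradFun N) : eLpNorm g 2 volume = ENNReal.ofReal ‖g‖ := by
  rw [Lp.norm_def, ENNReal.ofReal_toReal (Lp.eLpNorm_ne_top _)]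

/-- The embedding of `X_ω` into `L^s` for subcritical `s`. -/
theorem X.sobolev (N : ℕ) (hp : 1 < p) (ω : ℝ) {s : ℝ} (hs : 2 ≤ s) (hms : massPower p ω ≤ s)
    (hsub : (N : ℝ) * ((s - 2) / 2) < s) :
    ∃ C : ℝ, 0 ≤ C ∧ ∀ v : X N p ω, MemLp v.toFun (ENNReal.ofReal s) volume ∧
      (eLpNorm v.toFun (ENNReal.ofReal s) volume).toReal ≤ C * ‖v‖ := by
  obtain ⟨C, hC, h⟩ := eLpNorm_le_sobolev (N := N) (r := massPower p ω) (σ := s)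
    (by linarith [two_le_massPower hp ω]) hms hs hsub
  refine ⟨C.toReal * 2, by positivity, fun v => ?_⟩
  have h1 := h _ _ v.hasL2Gradient
  rw [v.eLpNorm_massPower hp, eLpNorm_gradFun, ← ENNReal.ofReal_add (norm_nonneg _) (norm_nonneg _)]
    at h1
  have h2 : ‖v.1.1‖ + ‖v.grad‖ ≤ 2 * ‖v‖ := by
    have := le_max_left ‖v.1.1‖ ‖v.grad‖
    have := le_max_right ‖v.1.1‖ ‖v.grad‖
    rw [X.norm_eq]
    linarith
  have htop : C * ENNReal.ofReal (‖v.1.1‖ + ‖v.grad‖) ≠ ∞ :=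
    ENNReal.mul_ne_top hC ENNReal.ofReal_ne_top
  refine ⟨⟨v.hasL2Gradient.measurable.aestronglyMeasurable, h1.trans_lt htop.lt_top⟩, ?_⟩
  refine (ENNReal.toReal_mono htop h1).trans ?_
  rw [ENNReal.toReal_mul, ENNReal.toReal_ofReal (by positivity), mul_assoc]
  exact mul_le_mul_of_nonneg_left h2 ENNReal.toReal_nonneg

theorem X.normPow_eq {s : ℝ} (hs : 0 < s) {v : X N p ω}
    (hv : MemLp v.toFun (ENNReal.ofReal s) volume) :
    v.normPow s = (eLpNorm v.toFun (ENNReal.ofReal s) volume).toReal ^ s := by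
  have h := hv.eLpNorm_eq_integral_rpow_norm (by simpa using hs) ENNReal.ofReal_ne_top
  rw [ENNReal.toReal_ofReal hs.le] at h
  have h0 : 0 ≤ ∫ x, ‖v.toFun x‖ ^ s := integral_nonneg fun x => by positivity
  rw [h, ENNReal.toReal_ofReal (Real.rpow_nonneg h0 _), ← Real.rpow_mul h0,
    inv_mul_cancel₀ hs.ne', Real.rpow_one]
  rfl

theorem X.normPow_nonneg (s : ℝ) (v : X N p ω) : 0 ≤ v.normPow s :=
  integral_nonneg fun x => by positivity

theorem X.normPow_smul (s : ℝ) {t : ℝ} (ht : 0 < t) (v : X N p ω) :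
    (t • v).normPow s = v.normPow s * t ^ s := by
  unfold X.normPow
  rw [mul_comm, ← integral_const_mul]
  refine integral_congr_ae ?_
  filter_upwards [X.toFun_smul t v] with x hx
  rw [hx, norm_smul, Real.norm_of_nonneg ht.le, Real.mul_rpow ht.le (norm_nonneg _)]

theorem X.normPow_translate (s : ℝ) (y : RN N) (v : X N p ω) :
    (v.translate y).normPow s = v.normPow s := by
  unfold X.normPow
  rw [← integral_sub_right_eq_self (fun x => ‖v.toFun x‖ ^ s) y]
  refine integral_congr_ae ?_
  filter_upwards [coeFn_translateLp y v.1.1] with x hx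
  have : (v.translate y).toFun x = v.toFun (x - y) := hx
  rw [this]

theorem X.norm_grad_translate (y : RN N) (v : X N p ω) : ‖(v.translate y).grad‖ = ‖v.grad‖ :=
  Lp.norm_compMeasurePreserving v.1.2 (measurePreserving_sub_right volume y)

theorem X.norm_translate (y : RN N) (v : X N p ω) : ‖v.translate y‖ = ‖v‖ := by
  rw [X.norm_eq, X.norm_eq, X.norm_grad_translate]
  congr 1
  exact Lp.norm_compMeasurePreserving v.1.1 (measurePreserving_sub_right volume y)

theorem ballAvg_congr_ae {v w : RN N → ℂ} (h : v =ᵐ[volume] w) {ε : ℝ} (hε : 0 < ε) (x : RN N) :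
    ballAvg ε v x = ballAvg ε w x := by
  rw [ballAvg_eq_integral _ hε, ballAvg_eq_integral _ hε]
  refine integral_congr_ae ?_
  filter_upwards [h] with z hz
  rw [hz]

theorem X.ballAvg_translate (y : RN N) (v : X N p ω) {ε : ℝ} (hε : 0 < ε) (x : RN N) :
    ballAvg ε (v.translate y).toFun x = ballAvg ε v.toFun (x - y) := by
  have h : (v.translate y).toFun =ᵐ[volume] fun x => v.toFun (x - y) := coeFn_translateLp y v.1.1
  rw [ballAvg_congr_ae h hε]
  simp only [ballAvg, sub_add_eq_add_sub]

theorem X.differentiableAt_normPow (hp : 1 < p) {s : ℝ} (hs : 2 ≤ s) (hms : massPower p ω ≤ s)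
    (hsub : (N : ℝ) * ((s - 2) / 2) < s) (v : X N p ω) :
    DifferentiableAt ℝ (fun w : X N p ω => w.normPow s) v := by
  have : Fact (1 ≤ ENNReal.ofReal s) := ⟨by rw [ENNReal.one_le_ofReal]; linarith⟩
  obtain ⟨C, hC, h⟩ := X.sobolev N hp ω hs hms hsub
  let ι₀ : X N p ω →ₗ[ℝ] Lp ℂ (ENNReal.ofReal s) (volume : Measure (RN N)) :=
    { toFun := fun w => (h w).1.toLp w.toFun
      map_add' := fun w w' => by
        rw [← MemLp.toLp_add, MemLp.toLp_eq_toLp_iff]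
        exact X.toFun_add w w'
      map_smul' := fun c w => by
        rw [RingHom.id_apply, ← MemLp.toLp_const_smul, MemLp.toLp_eq_toLp_iff]
        exact X.toFun_smul c w }
  let ι : X N p ω →L[ℝ] Lp ℂ (ENNReal.ofReal s) (volume : Measure (RN N)) :=
    ι₀.mkContinuous C fun w => by
      change ‖(h w).1.toLp w.toFun‖ ≤ _
      rw [Lp.norm_toLp]
      exact (h w).2
  have h1 : (fun w : X N p ω => w.normPow s)
      = (fun f : Lp ℂ (ENNReal.ofReal s) (volume : Measure (RN N)) => ∫ x, ‖f x‖ ^ s) ∘ ι := by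
    ext w
    refine integral_congr_ae ?_
    filter_upwards [(h w).1.coeFn_toLp] with x hx
    rw [← hx]
    rfl
  rw [h1]
  exact (differentiableAt_integral_norm_rpow hs (ι v)).comp v ι.differentiableAt

/-- The quadratic part `‖∇v‖² + ω ‖v‖²`. -/
def X.quad (v : X N p ω) : ℝ := ‖v.grad‖ ^ 2 + ω * v.normPow 2

theorem action_eq_quad (q : ℝ) (v : X N p ω) :
    action q v = 1 / 2 * v.quad + 1 / (p + 1) * v.normPow (p + 1)
      - 1 / (q + 1) * v.normPow (q + 1) := by
  unfold action X.quad; ring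

theorem nehari_eq_quad (q : ℝ) (v : X N p ω) :
    nehari q v = v.quad + v.normPow (p + 1) - v.normPow (q + 1) := rfl

theorem X.differentiableAt_quad (hp : 1 < p) (v : X N p ω) :
    DifferentiableAt ℝ (fun w : X N p ω => w.quad) v := by
  have h1 : DifferentiableAt ℝ (fun w : X N p ω => ‖w.grad‖ ^ 2) v := by
    let π : X N p ω →L[ℝ] GradFun N :=
      (ContinuousLinearMap.snd ℝ (LpFun N (massExponent p ω)) (GradFun N)).comp
        (sobolevSubmodule N (massExponent p ω)).subtypeL
    exact DifferentiableAt.norm_sq ℂ (f := fun w => π w) π.differentiableAt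
  refine h1.add ?_
  -- For ω = 0 the elements need not be square integrable, and the L² term disappears only through
  -- its zero coefficient.
  by_cases hω : ω = 0
  · simp only [hω, zero_mul]
    exact differentiableAt_const _
  · refine (X.differentiableAt_normPow hp le_rfl ?_ ?_ v).const_mul ω
    · simp [massPower, hω]
    · simp

theorem X.normPow_zero {s : ℝ} (hs : 0 < s) : (0 : X N p ω).normPow s = 0 := by
  refine integral_eq_zero_of_ae ?_
  filter_upwards [Lp.coeFn_zero ℂ (massExponent p ω) (volume : Measure (RN N))] with x hx
  have : (0 : X N p ω).toFun x = 0 := hx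
  simp [this, Real.zero_rpow hs.ne']

theorem X.normPow_pos {v : X N p ω} (hv : v.1.1 ≠ 0) {s : ℝ} (hs : 0 < s)
    (hmem : MemLp v.toFun (ENNReal.ofReal s) volume) : 0 < v.normPow s := by
  rw [X.normPow_eq hs hmem]
  refine Real.rpow_pos_of_pos (ENNReal.toReal_pos (fun h0 => hv ?_) hmem.2.ne) _
  rw [eLpNorm_eq_zero_iff hmem.1 (by simpa using hs)] at h0
  exact (Lp.eq_zero_iff_ae_eq_zero).2 h0

/-- The standing assumptions on the dimension, the powers and the frequency. -/
structure Admissible (N : ℕ) (p q ω : ℝ) : Prop where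
  one_lt : 1 < p
  lt : p < q
  subcritical : 3 ≤ N → q < 2 * (N : ℝ) / ((N : ℝ) - 2) - 1
  nonneg : 0 ≤ ω

namespace Admissible

theorem sobolev_of_le (h : Admissible N p q ω) {s : ℝ} (hs : 2 ≤ s) (hms : massPower p ω ≤ s)
    (hsq : s ≤ q + 1) : ∃ C : ℝ, 0 ≤ C ∧ ∀ v : X N p ω, MemLp v.toFun (ENNReal.ofReal s) volume ∧
      (eLpNorm v.toFun (ENNReal.ofReal s) volume).toReal ≤ C * ‖v‖ :=
  X.sobolev N h.one_lt ω hs hms (DoublePowerNLS.subcritical h.subcritical hs hsq)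

theorem sobolev_p (h : Admissible N p q ω) : ∃ C : ℝ, 0 ≤ C ∧ ∀ v : X N p ω,
    MemLp v.toFun (ENNReal.ofReal (p + 1)) volume ∧
      (eLpNorm v.toFun (ENNReal.ofReal (p + 1)) volume).toReal ≤ C * ‖v‖ :=
  h.sobolev_of_le (by linarith [h.one_lt]) (massPower_le h.one_lt ω) (by linarith [h.lt])

theorem sobolev_q (h : Admissible N p q ω) : ∃ C : ℝ, 0 ≤ C ∧ ∀ v : X N p ω,
    MemLp v.toFun (ENNReal.ofReal (q + 1)) volume ∧
      (eLpNorm v.toFun (ENNReal.ofReal (q + 1)) volume).toReal ≤ C * ‖v‖ :=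
  h.sobolev_of_le (by linarith [h.one_lt, h.lt])
    ((massPower_le h.one_lt ω).trans (by linarith [h.lt])) le_rfl

theorem quad_nonneg (h : Admissible N p q ω) (v : X N p ω) : 0 ≤ v.quad :=
  add_nonneg (by positivity) (mul_nonneg h.nonneg (v.normPow_nonneg 2))

theorem isNehariTriple (h : Admissible N p q ω) :
    IsNehariTriple (E := X N p ω) p q X.quad (X.normPow (p + 1)) (X.normPow (q + 1)) where
  one_lt := h.one_lt
  lt := h.lt
  nonneg_A := h.quad_nonneg
  nonneg_B := X.normPow_nonneg _
  pos := by
    intro v hv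
    obtain ⟨C, -, hC⟩ := h.sobolev_p
    by_cases h0 : v.1.1 = 0
    · have hg : v.grad ≠ 0 := fun hg => hv (Subtype.ext (Prod.ext h0 hg))
      have h1 : 0 < ‖v.grad‖ ^ 2 := by positivity
      have h2 := mul_nonneg h.nonneg (v.normPow_nonneg 2)
      have h3 := v.normPow_nonneg (p + 1)
      unfold X.quad
      linarith
    · have := X.normPow_pos h0 (s := p + 1) (by linarith [h.one_lt]) (hC v).1
      linarith [h.quad_nonneg v]
  zero_C := X.normPow_zero (by linarith [h.one_lt, h.lt])
  smul_A := by
    intro t v ht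
    have h1 : ‖(t • v).grad‖ = t * ‖v.grad‖ := by
      have : (t • v).grad = t • v.grad := rfl
      rw [this, norm_smul, Real.norm_of_nonneg ht.le]
    unfold X.quad
    rw [h1, X.normPow_smul 2 ht, Real.rpow_two]
    ring
  smul_B := fun t v ht => X.normPow_smul _ ht v
  smul_C := fun t v ht => X.normPow_smul _ ht v

/-- The energy controls the norm. -/
theorem norm_le_energy (h : Admissible N p q ω) : ∃ D : ℝ, 0 ≤ D ∧ ∀ v : X N p ω,
    ‖v‖ ≤ D * max ((v.quad + v.normPow (p + 1)) ^ (1 / 2 : ℝ))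
      ((v.quad + v.normPow (p + 1)) ^ (1 / (p + 1))) := by
  have hp := h.one_lt
  obtain ⟨C, -, hC⟩ := h.sobolev_p
  -- The factor ω^(-1/2) recovers the L² norm from ω‖v‖². For ω = 0 the convention 1/0 = 0 makes the
  -- maximum equal to 1.
  refine ⟨max 1 ((1 / ω) ^ (1 / 2 : ℝ)), by positivity, fun v => ?_⟩
  set E := v.quad + v.normPow (p + 1) with hE
  have hB := v.normPow_nonneg (p + 1)
  have h2 := v.normPow_nonneg 2
  have hω2 := mul_nonneg h.nonneg h2
  have hE0 : 0 ≤ E := add_nonneg (h.quad_nonneg v) hB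
  have hEq : E = ‖v.grad‖ ^ 2 + ω * v.normPow 2 + v.normPow (p + 1) := rfl
  have hsq : ∀ x : ℝ, 0 ≤ x → (x ^ 2) ^ (1 / 2 : ℝ) = x := fun x hx => by
    rw [← Real.sqrt_eq_rpow, Real.sqrt_sq hx]
  have hmax1 : E ^ (1 / 2 : ℝ) ≤ max (E ^ (1 / 2 : ℝ)) (E ^ (1 / (p + 1))) := le_max_left _ _
  have hmax0 : 0 ≤ max (E ^ (1 / 2 : ℝ)) (E ^ (1 / (p + 1))) :=
    (Real.rpow_nonneg hE0 _).trans hmax1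
  have hone : max (E ^ (1 / 2 : ℝ)) (E ^ (1 / (p + 1)))
      ≤ max 1 ((1 / ω) ^ (1 / 2 : ℝ)) * max (E ^ (1 / 2 : ℝ)) (E ^ (1 / (p + 1))) :=
    le_mul_of_one_le_left hmax0 (le_max_left _ _)
  rw [X.norm_eq]
  refine max_le ?_ ?_
  · have hN : ‖v.1.1‖ = (eLpNorm v.toFun (ENNReal.ofReal (massPower p ω)) volume).toReal := by
      rw [v.eLpNorm_massPower hp, ENNReal.toReal_ofReal (norm_nonneg _)]
    by_cases hω : ω = 0
    · have hmp : massPower p ω = p + 1 := by rw [massPower, if_pos hω]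
      rw [hmp] at hN
      have h3 := X.normPow_eq (by linarith) (hC v).1
      rw [← hN] at h3
      have h4 : ‖v.1.1‖ ≤ E ^ (1 / (p + 1)) := by
        have h5 : ‖v.1.1‖ = (v.normPow (p + 1)) ^ (1 / (p + 1)) := by
          rw [h3, ← Real.rpow_mul (norm_nonneg _), mul_one_div_cancel (by linarith), Real.rpow_one]
        rw [h5]
        refine Real.rpow_le_rpow hB ?_ (by positivity)
        rw [hEq]; nlinarith [sq_nonneg ‖v.grad‖]
      exact (h4.trans (le_max_right _ _)).trans hone
    · have hω0 : 0 < ω := lt_of_le_of_ne h.nonneg (Ne.symm hω)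
      have hmp : massPower p ω = 2 := by rw [massPower, if_neg hω]
      rw [hmp] at hN
      obtain ⟨C₂, -, hC₂⟩ := h.sobolev_of_le le_rfl hmp.le (by linarith [h.lt])
      have h3 := X.normPow_eq two_pos (hC₂ v).1
      rw [← hN, Real.rpow_two] at h3
      have h4 : ‖v.1.1‖ ≤ (1 / ω * E) ^ (1 / 2 : ℝ) := by
        rw [← hsq _ (norm_nonneg v.1.1), ← h3]
        refine Real.rpow_le_rpow h2 ?_ (by norm_num)
        rw [one_div, ← div_eq_inv_mul, le_div_iff₀ hω0, hEq]
        nlinarith [sq_nonneg ‖v.grad‖]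
      rw [Real.mul_rpow (by positivity) hE0] at h4
      refine h4.trans (mul_le_mul (le_max_right _ _) hmax1 (Real.rpow_nonneg hE0 _) (by positivity))
  · have h4 : ‖v.grad‖ ≤ E ^ (1 / 2 : ℝ) := by
      rw [← hsq _ (norm_nonneg v.grad)]
      refine Real.rpow_le_rpow (by positivity) ?_ (by norm_num)
      rw [hEq]; linarith
    exact (h4.trans hmax1).trans hone

/-- The energy is bounded below on the Nehari manifold. -/
theorem exists_energy_lower_bound (h : Admissible N p q ω) : ∃ e : ℝ, 0 < e ∧ ∀ v : X N p ω, v ≠ 0 →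
    v.quad + v.normPow (p + 1) ≤ v.normPow (q + 1) → e ≤ v.quad + v.normPow (p + 1) := by
  have hp := h.one_lt
  have hpq := h.lt
  obtain ⟨C, hC0, hC⟩ := h.sobolev_q
  obtain ⟨D, hD0, hD⟩ := h.norm_le_energy
  set c : ℝ := (C * D) ^ (q + 1) + 1 with hc
  have hc0 : 0 < c := by positivity
  -- For E < 1 the norm is at most D E^(1/(p+1)), so the Sobolev inequality gives E ≤ C(v) ≤ c
  -- E^(1+κ). As κ > 0, E cannot be small.
  set κ : ℝ := (q + 1) / (p + 1) - 1 with hκ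
  have hκ0 : 0 < κ := by rw [hκ, sub_pos, one_lt_div (by linarith)]; linarith
  refine ⟨min 1 ((1 / c) ^ (1 / κ)), by positivity, fun v hv hle => ?_⟩
  set E := v.quad + v.normPow (p + 1) with hE
  have hE0 : 0 < E := h.isNehariTriple.pos v hv
  by_contra! hlt
  have hE1 : E < 1 := hlt.trans_le (min_le_left _ _)
  have hE2 : E < (1 / c) ^ (1 / κ) := hlt.trans_le (min_le_right _ _)
  have hmax : max (E ^ (1 / 2 : ℝ)) (E ^ (1 / (p + 1))) = E ^ (1 / (p + 1)) := by
    refine max_eq_right (Real.rpow_le_rpow_of_exponent_ge hE0 hE1.le ?_)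
    exact one_div_le_one_div_of_le two_pos (by linarith)
  have h1 := hD v
  rw [← hE, hmax] at h1
  have h2 : v.normPow (q + 1) ≤ c * (E ^ κ * E) := by
    rw [X.normPow_eq (by linarith) (hC v).1]
    have h3 : (eLpNorm v.toFun (ENNReal.ofReal (q + 1)) volume).toReal
        ≤ C * D * E ^ (1 / (p + 1)) := by
      refine (hC v).2.trans ?_
      rw [mul_assoc]
      gcongr
    refine (Real.rpow_le_rpow ENNReal.toReal_nonneg h3 (by linarith)).trans ?_
    rw [Real.mul_rpow (by positivity) (by positivity), ← Real.rpow_mul hE0.le]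
    have h4 : E ^ (1 / (p + 1) * (q + 1)) = E ^ κ * E := by
      rw [← Real.rpow_add_one hE0.ne']; congr 1; rw [hκ]; ring
    rw [h4]
    gcongr
    linarith
  have h5 : E ^ κ < 1 / c := by
    have := Real.rpow_lt_rpow hE0.le hE2 hκ0
    rwa [← Real.rpow_mul (by positivity), one_div_mul_cancel hκ0.ne', Real.rpow_one] at this
  rw [lt_div_iff₀ hc0] at h5
  have h6 : c * (E ^ κ * E) = (E ^ κ * c) * E := by ring
  have h7 : (E ^ κ * c) * E < 1 * E := mul_lt_mul_of_pos_right h5 hE0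
  linarith

end Admissible

/-- A smooth function with compact support, as an element of `X_ω`. -/
theorem exists_toFun_ae_eq {φ : RN N → ℝ} (hφ : ContDiff ℝ ((⊤ : ℕ∞) : WithTop ℕ∞) φ)
    (hc : HasCompactSupport φ) : ∃ v : X N p ω, v.toFun =ᵐ[volume] fun x => (φ x : ℂ) := by
  have hcφ : Continuous fun x => (φ x : ℂ) := Complex.continuous_ofReal.comp hφ.continuous
  have hsφ : HasCompactSupport fun x => (φ x : ℂ) := hc.comp_left (g := fun t : ℝ => (t : ℂ)) (by simp)
  set g : RN N → EuclideanSpace ℂ (Fin N) := fun x =>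
    WithLp.toLp 2 fun i => ((fderiv ℝ φ x (EuclideanSpace.single i (1 : ℝ)) : ℝ) : ℂ) with hg
  have hcg : Continuous g := by
    refine (PiLp.continuous_toLp 2 _).comp (continuous_pi fun i => ?_)
    exact Complex.continuous_ofReal.comp (continuous_partial hφ _)
  have hsg : HasCompactSupport g :=
    (hc.fderiv ℝ).comp_left (g := fun L : RN N →L[ℝ] ℝ =>
      (WithLp.toLp 2 fun i => ((L (EuclideanSpace.single i (1 : ℝ)) : ℝ) : ℂ) :
        EuclideanSpace ℂ (Fin N))) (by ext i; simp)
  have hv := hcφ.memLp_of_hasCompactSupport (μ := volume) (p := massExponent p ω) hsφ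
  have hgm := hcg.memLp_of_hasCompactSupport (μ := volume) (p := 2) hsg
  refine ⟨⟨(hv.toLp _, hgm.toLp _), ?_⟩, hv.coeFn_toLp⟩
  intro ψ hψ hψc i
  have h1 : ∫ x, fderiv ℝ ψ x (EuclideanSpace.single i (1 : ℝ)) • (hv.toLp _ : RN N → ℂ) x
      = ((∫ x, φ x * fderiv ℝ ψ x (EuclideanSpace.single i (1 : ℝ)) : ℝ) : ℂ) := by
    rw [← integral_complex_ofReal]
    refine integral_congr_ae ?_
    filter_upwards [hv.coeFn_toLp] with x hx
    rw [hx, Complex.real_smul]; push_cast; ring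
  have h2 : ∫ x, ψ x • (hgm.toLp _ : RN N → EuclideanSpace ℂ (Fin N)) x i
      = ((∫ x, fderiv ℝ φ x (EuclideanSpace.single i (1 : ℝ)) * ψ x : ℝ) : ℂ) := by
    rw [← integral_complex_ofReal]
    refine integral_congr_ae ?_
    filter_upwards [hgm.coeFn_toLp] with x hx
    rw [hx, Complex.real_smul]; push_cast; rw [mul_comm]
  refine h1.trans (Eq.trans ?_ (congrArg Neg.neg h2.symm))
  rw [← Complex.ofReal_neg]
  congr 1
  have hd1 := continuous_partial hφ (EuclideanSpace.single i (1 : ℝ))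
  have hd2 := continuous_partial hψ (EuclideanSpace.single i (1 : ℝ))
  refine integral_mul_fderiv_eq_neg_fderiv_mul_of_integrable ?_ ?_ ?_
    (fun x _ => hφ.differentiable (by simp) x) (fun x _ => hψ.differentiable (by simp) x)
  · exact (hd1.mul hψ.continuous).integrable_of_hasCompactSupport hψc.mul_left
  · exact (hφ.continuous.mul hd2).integrable_of_hasCompactSupport hc.mul_right
  · exact (hφ.continuous.mul hψ.continuous).integrable_of_hasCompactSupport hc.mul_right

theorem Admissible.nehariManifold_nonempty (h : Admissible N p q ω) :
    (nehariManifold N p q ω).Nonempty := by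
  let φ : ContDiffBump (0 : RN N) := ⟨1, 2, one_pos, one_lt_two⟩
  obtain ⟨v, hv⟩ := exists_toFun_ae_eq (p := p) (ω := ω) (φ := φ) φ.contDiff φ.hasCompactSupport
  obtain ⟨C, -, hC⟩ := h.sobolev_q
  have hv0 : v.1.1 ≠ 0 := by
    intro h0
    have h1 : v.toFun =ᵐ[volume] 0 := (Lp.eq_zero_iff_ae_eq_zero).1 h0
    have h2 : ∀ᵐ x : RN N, φ x = 0 := by
      filter_upwards [hv, h1] with x h3 h4
      rw [h3] at h4
      simpa using h4
    have h3 : volume (Metric.closedBall (0 : RN N) 1) = 0 := by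
      refine measure_mono_null (fun x hx => ?_) h2
      have : φ x = 1 := φ.one_of_mem_closedBall hx
      simp [this]
    exact (Metric.measure_closedBall_pos volume (0 : RN N) one_pos).ne' h3
  have hpos := X.normPow_pos hv0 (s := q + 1) (by linarith [h.one_lt, h.lt]) (hC v).1
  obtain ⟨t, -, h1, h2⟩ := h.isNehariTriple.exists_smul hpos
  exact ⟨t • v, h1, h2⟩

/-! ### Minimizing sequences. -/

namespace Admissible

theorem action_eq_of_nehari_eq_zero {v : X N p ω} (hv : nehari q v = 0) :
    action q v = (1 / 2 - 1 / (q + 1)) * v.quad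
      + (1 / (p + 1) - 1 / (q + 1)) * v.normPow (p + 1) := by
  rw [action_eq_quad, IsNehariTriple.action_eq, ← nehari_eq_quad, hv, mul_zero, add_zero]

theorem bddBelow_action (h : Admissible N p q ω) :
    BddBelow (action q '' nehariManifold N p q ω) := by
  refine ⟨0, ?_⟩
  rintro _ ⟨v, ⟨-, hv⟩, rfl⟩
  obtain ⟨hα, hβ, -⟩ := h.isNehariTriple.coeff_pos
  rw [action_eq_of_nehari_eq_zero hv]
  exact add_nonneg (mul_nonneg hα.le (h.quad_nonneg v)) (mul_nonneg hβ.le (v.normPow_nonneg _))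

theorem nehariLevel_le (h : Admissible N p q ω) (w : X N p ω) (hw : w ≠ 0)
    (hK : w.quad + w.normPow (p + 1) - w.normPow (q + 1) = 0) :
    nehariLevel N p q ω ≤ 1 / 2 * w.quad + 1 / (p + 1) * w.normPow (p + 1)
      - 1 / (q + 1) * w.normPow (q + 1) := by
  rw [← action_eq_quad]
  exact csInf_le h.bddBelow_action ⟨w, ⟨hw, hK⟩, rfl⟩

theorem nehariLevel_pos (h : Admissible N p q ω) : 0 < nehariLevel N p q ω := by
  obtain ⟨e, he, hle⟩ := h.exists_energy_lower_bound
  obtain ⟨-, hβ, hαβ⟩ := h.isNehariTriple.coeff_pos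
  refine (mul_pos hβ he).trans_le (le_csInf (h.nehariManifold_nonempty.image _) ?_)
  rintro _ ⟨v, ⟨hv0, hv⟩, rfl⟩
  rw [action_eq_of_nehari_eq_zero hv]
  have h1 := hle v hv0 (by rw [nehari_eq_quad] at hv; linarith)
  have h2 := mul_le_mul_of_nonneg_left h1 hβ.le
  have h3 := mul_le_mul_of_nonneg_right hαβ (h.quad_nonneg v)
  linarith

theorem tendsto_zero_of_energy (h : Admissible N p q ω) {w : ℕ → X N p ω}
    (hw : Tendsto (fun n => (w n).quad + (w n).normPow (p + 1)) atTop (𝓝 0)) :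
    Tendsto w atTop (𝓝 0) := by
  have hp := h.one_lt
  obtain ⟨D, -, hD⟩ := h.norm_le_energy
  refine squeeze_zero_norm (fun n => hD (w n)) ?_
  have hr : ∀ s : ℝ, 0 < s → Tendsto (fun n => ((w n).quad + (w n).normPow (p + 1)) ^ s) atTop
      (𝓝 0) := fun s hs => by
    have := hw.rpow_const (p := s) (Or.inr hs.le)
    rwa [Real.zero_rpow hs.ne'] at this
  simpa using ((hr (1 / 2) (by norm_num)).max (hr (1 / (p + 1)) (by positivity))).const_mul D

/-- The splitting of the functionals along a weakly convergent sequence. -/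
theorem tendsto_normPow_sub {s : ℝ} (hs : 1 ≤ s) {C : ℝ} (hC0 : 0 ≤ C)
    (hC : ∀ v : X N p ω, MemLp v.toFun (ENNReal.ofReal s) volume ∧
      (eLpNorm v.toFun (ENNReal.ofReal s) volume).toReal ≤ C * ‖v‖)
    {v : ℕ → X N p ω} {v₀ : X N p ω} {M : ℝ} (hM : ∀ n, ‖v n‖ ≤ M)
    (hlim : ∀ᵐ x, Tendsto (fun n => (v n).toFun x) atTop (𝓝 (v₀.toFun x))) :
    Tendsto (fun n => (v n).normPow s - (v n - v₀).normPow s) atTop (𝓝 (v₀.normPow s)) := by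
  have hs0 : 0 < s := by linarith
  have heq : ∀ n, (v n - v₀).normPow s = ∫ x, ‖(v n).toFun x - v₀.toFun x‖ ^ s := fun n => by
    refine integral_congr_ae ?_
    filter_upwards [X.toFun_sub (v n) v₀] with x hx
    rw [hx]
  simp only [heq]
  refine tendsto_integral_norm_rpow_sub hs (M := (C * (M + ‖v₀‖)) ^ s) (fun n => (hC _).1) (hC _).1
    (fun n => ?_) hlim
  rw [← heq, X.normPow_eq hs0 (hC _).1]
  refine Real.rpow_le_rpow ENNReal.toReal_nonneg ((hC _).2.trans ?_) hs0.le
  gcongr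
  exact (norm_sub_le _ _).trans (by gcongr; exact hM n)

/-- No almost everywhere convergence of gradients is available: their part splits by expanding the
square and using weak convergence. The mass term, present only if ω ≠ 0, splits by Brezis–Lieb. -/
theorem tendsto_quad_sub (h : Admissible N p q ω) {v : ℕ → X N p ω} {v₀ : X N p ω} {M : ℝ}
    (hM : ∀ n, ‖v n‖ ≤ M)
    (hlim : ∀ᵐ x, Tendsto (fun n => (v n).toFun x) atTop (𝓝 (v₀.toFun x)))
    (hweak : ∀ y : GradFun N, Tendsto (fun n => inner ℂ y (v n).grad) atTop (𝓝 (inner ℂ y v₀.grad))) :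
    Tendsto (fun n => (v n).quad - (v n - v₀).quad) atTop (𝓝 v₀.quad) := by
  have h1 : Tendsto (fun n => ‖(v n).grad‖ ^ 2 - ‖(v n - v₀).grad‖ ^ 2) atTop
      (𝓝 (‖v₀.grad‖ ^ 2)) := by
    have heq : ∀ n, ‖(v n).grad‖ ^ 2 - ‖(v n - v₀).grad‖ ^ 2
        = 2 * RCLike.re (inner ℂ v₀.grad (v n).grad) - ‖v₀.grad‖ ^ 2 := fun n => by
      have h2 : (v n - v₀).grad = (v n).grad - v₀.grad := rfl
      rw [h2, norm_sub_rev, norm_sub_sq (𝕜 := ℂ)]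
      ring
    simp only [heq]
    have h3 := (((RCLike.continuous_re (K := ℂ)).tendsto _).comp (hweak v₀.grad)).const_mul 2
    have h4 := h3.sub_const (‖v₀.grad‖ ^ 2)
    rw [inner_self_eq_norm_sq (𝕜 := ℂ)] at h4
    rwa [two_mul (‖v₀.grad‖ ^ 2), add_sub_cancel_right] at h4
  by_cases hω : ω = 0
  · have : ∀ w : X N p ω, w.quad = ‖w.grad‖ ^ 2 := fun w => by
      unfold X.quad; rw [mul_eq_zero_of_left hω, add_zero]
    simpa only [this] using h1
  · obtain ⟨C, hC0, hC⟩ := h.sobolev_of_le (s := 2) le_rfl (by rw [massPower, if_neg hω])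
      (by linarith [h.one_lt, h.lt])
    have h2 := (tendsto_normPow_sub one_le_two hC0 hC hM hlim).const_mul ω
    refine (h1.add h2).congr fun n => ?_
    unfold X.quad
    ring

/-- A bounded sequence with nonvanishing `L^{q+1}` norm converges weakly, up to translations and
to extraction, to a nonzero limit. -/
theorem exists_weak_limit_translate (h : Admissible N p q ω) (v : ℕ → X N p ω) {M c : ℝ}
    (hM : ∀ n, ‖v n‖ ≤ M) (hc : 0 < c) (hv : ∀ᶠ n in atTop, c ≤ (v n).normPow (q + 1)) :
    ∃ (y : ℕ → RN N) (σ : ℕ → ℕ) (v₀ : X N p ω), StrictMono σ ∧ v₀ ≠ 0 ∧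
      (∀ᵐ x, Tendsto (fun n => ((v (σ n)).translate (y (σ n))).toFun x) atTop (𝓝 (v₀.toFun x))) ∧
      ∀ z : GradFun N, Tendsto (fun n => inner ℂ z ((v (σ n)).translate (y (σ n))).grad) atTop
        (𝓝 (inner ℂ z v₀.grad)) := by
  have hp := h.one_lt
  have hpq := h.lt
  have hq0 : 0 < q + 1 := by linarith
  obtain ⟨C, -, hC⟩ := h.sobolev_q
  have hmp2 := two_le_massPower hp ω
  obtain ⟨ε, δ, hε, hδ, hne⟩ := exists_ballAvg_ge (N := N) (r := massPower p ω) (σ := q + 1)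
    (by linarith) ((massPower_le hp ω).trans_lt (by linarith)) (by linarith)
    (DoublePowerNLS.subcritical h.subcritical (by linarith) le_rfl) M
    (η := c ^ (1 / (q + 1))) (by positivity)
  have hL : ∀ n, eLpNorm (v n).toFun (ENNReal.ofReal (massPower p ω)) volume ≤ ENNReal.ofReal M :=
    fun n => by
      rw [(v n).eLpNorm_massPower hp]
      exact ENNReal.ofReal_le_ofReal ((le_max_left _ _).trans (hM n))
  have hex : ∀ᶠ n in atTop, ∃ x, δ ≤ ‖ballAvg ε (v n).toFun x‖ := by
    filter_upwards [hv] with n hn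
    refine hne _ _ (v n).hasL2Gradient (hL n) ?_ ?_
    · rw [eLpNorm_gradFun]
      exact ENNReal.ofReal_le_ofReal ((le_max_right _ _).trans (hM n))
    · rw [X.normPow_eq hq0 (hC _).1] at hn
      have h1 := Real.rpow_le_rpow hc.le hn (one_div_nonneg.2 hq0.le)
      rw [← Real.rpow_mul ENNReal.toReal_nonneg, mul_one_div_cancel hq0.ne', Real.rpow_one] at h1
      exact (ENNReal.ofReal_le_ofReal h1).trans_eq (ENNReal.ofReal_toReal (hC _).1.2.ne)
  obtain ⟨x, hx⟩ := hex.choice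
  -- Translation by -x_n moves the ball with large mean to the origin. Means pass to the weak limit,
  -- so the mean of the limit over that ball has modulus at least δ and the limit is nonzero.
  set y : ℕ → RN N := fun n => -x n with hy
  set u : ℕ → X N p ω := fun n => (v n).translate (y n) with hu
  have huM : ∀ n, ‖u n‖ ≤ M := fun n => by rw [hu]; simp only [X.norm_translate]; exact hM n
  obtain ⟨w, g₀, σ, hσ, hwg, hwL, hae, havg, hweak⟩ := exists_ae_limit hmp2
    (fun n => (u n).toFun) (fun n => (u n).grad) (M := M) (fun n => (u n).hasL2Gradient)
    (fun n => by
      rw [(u n).eLpNorm_massPower hp]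
      exact ENNReal.ofReal_le_ofReal ((le_max_left _ _).trans (huM n)))
    (fun n => (le_max_right _ _).trans (huM n))
  have hwmem : MemLp w (massExponent p ω) volume := by
    rw [massExponent_eq hp]
    exact ⟨hwg.measurable.aestronglyMeasurable, hwL.trans_lt ENNReal.ofReal_lt_top⟩
  have hmem : (hwmem.toLp w, g₀) ∈ sobolevSubmodule N (massExponent p ω) := by
    intro φ hφ hc' i
    rw [← hwg.isWeakGradient φ hφ hc' i]
    refine integral_congr_ae ?_
    filter_upwards [hwmem.coeFn_toLp] with z hz
    rw [hz]
  set v₀ : X N p ω := ⟨(hwmem.toLp w, g₀), hmem⟩ with hv₀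
  have hv₀w : v₀.toFun =ᵐ[volume] w := hwmem.coeFn_toLp
  refine ⟨y, σ, v₀, hσ, ?_, ?_, hweak⟩
  · intro h0
    have h1 : v₀.toFun =ᵐ[volume] 0 := (Lp.eq_zero_iff_ae_eq_zero).1 (by rw [h0]; rfl)
    have h2 : ballAvg ε w 0 = 0 := by
      rw [ballAvg_congr_ae (hv₀w.symm.trans h1) hε]
      simp [ballAvg]
    have h3 := (havg ε hε 0).norm
    rw [h2, norm_zero] at h3
    refine (ge_of_tendsto h3 ?_).not_gt hδ
    filter_upwards [hσ.tendsto_atTop.eventually hx] with n hn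
    have h4 : ballAvg ε (u (σ n)).toFun 0 = ballAvg ε (v (σ n)).toFun (x (σ n)) := by
      rw [hu, X.ballAvg_translate _ _ hε, hy]
      simp
    rw [h4]
    exact hn
  · filter_upwards [hae, hv₀w] with z h1 h2
    rw [h2]
    exact h1

/-- Compactness of minimizing sequences, up to translations. -/
theorem exists_tendsto_translate (h : Admissible N p q ω) (v : ℕ → X N p ω)
    (hK : Tendsto (fun n => nehari q (v n)) atTop (𝓝 0))
    (hS : Tendsto (fun n => action q (v n)) atTop (𝓝 (nehariLevel N p q ω))) :
    ∃ (y : ℕ → RN N) (σ : ℕ → ℕ) (v₀ : X N p ω), StrictMono σ ∧ v₀ ∈ nehariMinimizers N p q ω ∧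
      Tendsto (fun j => (v (σ j)).translate (y (σ j))) atTop (𝓝 v₀) := by
  set μ := nehariLevel N p q ω with hμ
  have hμ0 : 0 < μ := h.nehariLevel_pos
  have htr := h.isNehariTriple
  have hp := h.one_lt
  have hpq := h.lt
  obtain ⟨hα, hβ, hαβ⟩ := htr.coeff_pos
  set α := 1 / 2 - 1 / (q + 1) with hαdef
  set β := 1 / (p + 1) - 1 / (q + 1) with hβdef
  set I : X N p ω → ℝ := fun w => α * w.quad + β * w.normPow (p + 1) with hI
  have hIle : ∀ w, β * (w.quad + w.normPow (p + 1)) ≤ I w := fun w => by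
    have := mul_le_mul_of_nonneg_right hαβ (h.quad_nonneg w)
    simp only [hI]; linarith
  have hIge : ∀ w, I w ≤ α * (w.quad + w.normPow (p + 1)) := fun w => by
    have := mul_le_mul_of_nonneg_right hαβ (w.normPow_nonneg (p + 1))
    simp only [hI]; linarith
  have hIeq : ∀ w : X N p ω, action q w = I w + 1 / (q + 1) * nehari q w := fun w => by
    rw [action_eq_quad, IsNehariTriple.action_eq, ← nehari_eq_quad]
  have hIlim : Tendsto (fun n => I (v n)) atTop (𝓝 μ) := by
    have h1 := hS.sub (hK.const_mul (1 / (q + 1)))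
    rw [mul_zero, sub_zero] at h1
    exact h1.congr fun n => by rw [hIeq]; ring
  obtain ⟨M, hM⟩ : ∃ M, ∀ n, ‖v n‖ ≤ M := by
    obtain ⟨R, hR⟩ := hIlim.bddAbove_range
    obtain ⟨D, hD0, hD⟩ := h.norm_le_energy
    refine ⟨D * max ((R / β) ^ (1 / 2 : ℝ)) ((R / β) ^ (1 / (p + 1))), fun n => (hD _).trans ?_⟩
    have hE0 : 0 ≤ (v n).quad + (v n).normPow (p + 1) :=
      add_nonneg (h.quad_nonneg _) ((v n).normPow_nonneg _)
    have hE : (v n).quad + (v n).normPow (p + 1) ≤ R / β := by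
      rw [le_div_iff₀ hβ]
      have := hR (Set.mem_range_self n)
      linarith [hIle (v n)]
    gcongr
  -- From I ≤ α(A + B) = α(K + C) follows I - αK ≤ αC, and the left side tends to μ > 0.
  have hClim : ∀ᶠ n in atTop, μ / (2 * α) ≤ (v n).normPow (q + 1) := by
    have h1 : Tendsto (fun n => I (v n) - α * nehari q (v n)) atTop (𝓝 μ) := by
      simpa using hIlim.sub (hK.const_mul α)
    filter_upwards [h1.eventually_const_lt (half_lt_self hμ0)] with n hn
    have h2 := hIge (v n)
    have h3 := nehari_eq_quad q (v n)
    rw [div_le_iff₀ (by positivity)]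
    rw [h3] at hn
    nlinarith
  obtain ⟨y, σ, v₀, hσ, hv₀, hae, hweak⟩ := h.exists_weak_limit_translate v hM
    (c := μ / (2 * α)) (by positivity) hClim
  set u : ℕ → X N p ω := fun n => (v (σ n)).translate (y (σ n)) with hu
  set w : ℕ → X N p ω := fun n => u n - v₀ with hw
  have huM : ∀ n, ‖u n‖ ≤ M := fun n => by
    simp only [hu, X.norm_translate]; exact hM _
  have hquad : ∀ n, (u n).quad = (v (σ n)).quad := fun n => by
    simp only [hu, X.quad, X.norm_grad_translate, X.normPow_translate]
  have hpow : ∀ s n, (u n).normPow s = (v (σ n)).normPow s := fun s n => X.normPow_translate s _ _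
  have hA := h.tendsto_quad_sub huM hae hweak
  obtain ⟨Cp, hCp0, hCp⟩ := h.sobolev_p
  obtain ⟨Cq, hCq0, hCq⟩ := h.sobolev_q
  have hB := tendsto_normPow_sub (by linarith) hCp0 hCp huM hae
  have hC := tendsto_normPow_sub (by linarith) hCq0 hCq huM hae
  have hKw : Tendsto (fun n => nehari q (w n)) atTop (𝓝 (-nehari q v₀)) := by
    have h1 := (hK.comp hσ.tendsto_atTop).sub ((hA.add hB).sub hC)
    rw [← nehari_eq_quad, zero_sub] at h1
    refine h1.congr fun n => ?_
    simp only [Function.comp_apply, nehari_eq_quad, ← hquad, ← hpow, hw]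
    ring
  have hIw : Tendsto (fun n => I (w n)) atTop (𝓝 (μ - I v₀)) := by
    have h1 := (hIlim.comp hσ.tendsto_atTop).sub ((hA.const_mul α).add (hB.const_mul β))
    refine h1.congr fun n => ?_
    simp only [Function.comp_apply, hI, ← hquad, ← hpow, hw]
    ring
  have hI0 : ∀ w, 0 ≤ I w := fun w =>
    add_nonneg (mul_nonneg hα.le (h.quad_nonneg w)) (mul_nonneg hβ.le (w.normPow_nonneg _))
  have hIv₀ : 0 < I v₀ := (mul_pos hβ (htr.pos v₀ hv₀)).trans_le (hIle v₀)
  have hlev := h.nehariLevel_le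
  -- If K(v₀) > 0, the remainder eventually has K < 0 and hence I ≥ μ, whereas its I tends to μ -
  -- I(v₀) < μ.
  have hKv₀ : nehari q v₀ ≤ 0 := by
    by_contra! hpos
    have h1 : ∀ᶠ n in atTop, μ ≤ I (w n) := by
      filter_upwards [hKw.eventually_lt_const (neg_lt_zero.2 hpos)] with n hn
      have hwn : w n ≠ 0 := by
        intro h0
        rw [h0, nehari_eq_quad] at hn
        have h2 := h.quad_nonneg (0 : X N p ω)
        rw [X.normPow_zero (by linarith), X.normPow_zero (by linarith)] at hn
        linarith
      exact (htr.level_le hlev hwn hn.le).1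
    have h2 := ge_of_tendsto hIw h1
    linarith
  obtain ⟨h1, h2⟩ := htr.level_le hlev hv₀ hKv₀
  have h3 := ge_of_tendsto' hIw fun n => hI0 (w n)
  -- I of the remainder is nonnegative in the limit, so I(v₀) ≤ μ; equality then excludes the strict
  -- case K(v₀) < 0.
  have hIμ : I v₀ = μ := le_antisymm (by linarith) h1
  have hK0 : nehari q v₀ = 0 := by
    refine le_antisymm hKv₀ ?_
    by_contra! hneg
    exact (h2 hneg).ne' hIμ
  refine ⟨y, σ, v₀, hσ, ⟨⟨hv₀, hK0⟩, ?_⟩, ?_⟩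
  · rw [hIeq, hK0, mul_zero, add_zero, hIμ]
  · rw [hIμ, sub_self] at hIw
    have h4 : Tendsto (fun n => (w n).quad + (w n).normPow (p + 1)) atTop (𝓝 0) := by
      refine squeeze_zero (g := fun n => I (w n) / β) (fun n => add_nonneg (h.quad_nonneg _)
        ((w n).normPow_nonneg _)) (fun n => ?_) (by simpa using hIw.div_const β)
      rw [le_div_iff₀ hβ]
      linarith [hIle (w n)]
    have h5 := (h.tendsto_zero_of_energy h4).add_const v₀
    simpa [hw] using h5

/-! ### Existence of minimizers and identification with ground states. -/

theorem nehariMinimizers_nonempty (h : Admissible N p q ω) : (nehariMinimizers N p q ω).Nonempty := by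
  obtain ⟨a, -, ha, hmem⟩ := exists_seq_tendsto_sInf (h.nehariManifold_nonempty.image (action q))
    h.bddBelow_action
  choose v hv hva using hmem
  obtain ⟨-, -, v₀, -, hv₀, -⟩ := h.exists_tendsto_translate v
    (tendsto_const_nhds.congr fun n => (hv n).2.symm) (by simp only [hva]; exact ha)
  exact ⟨v₀, hv₀⟩

theorem mem_criticalPoints (h : Admissible N p q ω) {v : X N p ω}
    (hv : v ∈ nehariMinimizers N p q ω) : v ∈ criticalPoints N p q ω := by
  obtain ⟨⟨hv0, hK⟩, hS⟩ := hv
  refine ⟨hv0, ?_⟩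
  have hp := h.one_lt
  have hpq := h.lt
  have hact : (action q : X N p ω → ℝ) = fun w => 1 / 2 * w.quad + 1 / (p + 1) * w.normPow (p + 1)
      - 1 / (q + 1) * w.normPow (q + 1) := funext (action_eq_quad q)
  rw [hact]
  refine h.isNehariTriple.hasFDerivAt_zero hv0 hK (fun w hw hKw => ?_)
    (X.differentiableAt_quad hp v) ?_ ?_
  · rw [← action_eq_quad, hS]
    exact h.nehariLevel_le w hw hKw
  · exact X.differentiableAt_normPow hp (by linarith) (massPower_le hp ω)
      (DoublePowerNLS.subcritical h.subcritical (by linarith) (by linarith)) v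
  · exact X.differentiableAt_normPow hp (by linarith) ((massPower_le hp ω).trans (by linarith))
      (DoublePowerNLS.subcritical h.subcritical (by linarith) le_rfl) v

theorem criticalPoints_subset (h : Admissible N p q ω) :
    criticalPoints N p q ω ⊆ nehariManifold N p q ω := by
  rintro v ⟨hv0, hv⟩
  have hact : (action q : X N p ω → ℝ) = fun w => 1 / 2 * w.quad + 1 / (p + 1) * w.normPow (p + 1)
      - 1 / (q + 1) * w.normPow (q + 1) := funext (action_eq_quad q)
  rw [hact] at hv
  exact ⟨hv0, h.isNehariTriple.eq_zero_of_hasFDerivAt_zero hv⟩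

/-- The infimum over the smaller set of critical points is no smaller, and it is attained at the
Nehari level because a Nehari minimizer exists and is critical. -/
theorem groundLevel_eq (h : Admissible N p q ω) : groundLevel N p q ω = nehariLevel N p q ω := by
  obtain ⟨v, hv⟩ := h.nehariMinimizers_nonempty
  have hcrit := h.mem_criticalPoints hv
  have hsub := Set.image_mono (f := action q) h.criticalPoints_subset
  refine le_antisymm ?_ (csInf_le_csInf h.bddBelow_action ⟨_, v, hcrit, rfl⟩ hsub)
  rw [← hv.2]
  exact csInf_le (h.bddBelow_action.mono hsub) ⟨v, hcrit, rfl⟩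

theorem groundStates_eq (h : Admissible N p q ω) :
    groundStates N p q ω = nehariMinimizers N p q ω := by
  ext v
  constructor
  · rintro ⟨h1, h2⟩
    exact ⟨h.criticalPoints_subset h1, h2.trans h.groundLevel_eq⟩
  · intro hv
    exact ⟨h.mem_criticalPoints hv, hv.2.trans h.groundLevel_eq.symm⟩

end Admissible

end DoublePowerNLS

end

theorem theorem2p1 (N : ℕ) (hN : 1 ≤ N) (p q : ℝ) (hp : 1 < p) (hpq : p < q)
    (hq : 3 ≤ N → q < 2 * (N : ℝ) / ((N : ℝ) - 2) - 1) (ω : ℝ) (hω : 0 ≤ ω) :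
    DoublePowerNLS.groundStates N p q ω = DoublePowerNLS.nehariMinimizers N p q ω ∧
    (DoublePowerNLS.groundStates N p q ω).Nonempty ∧
    DoublePowerNLS.groundLevel N p q ω = DoublePowerNLS.nehariLevel N p q ω ∧
    0 < DoublePowerNLS.nehariLevel N p q ω ∧
    ∀ v : ℕ → DoublePowerNLS.X N p ω,
      Tendsto (fun n => DoublePowerNLS.nehari q (v n)) atTop (𝓝 0) →
      Tendsto (fun n => DoublePowerNLS.action q (v n)) atTop
        (𝓝 (DoublePowerNLS.nehariLevel N p q ω)) →
      ∃ (y : ℕ → DoublePowerNLS.RN N) (σ : ℕ → ℕ) (v₀ : DoublePowerNLS.X N p ω),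
        StrictMono σ ∧ v₀ ∈ DoublePowerNLS.nehariMinimizers N p q ω ∧
        Tendsto (fun j => (v (σ j)).translate (y (σ j))) atTop (𝓝 v₀) := by
  have h : DoublePowerNLS.Admissible N p q ω := ⟨hp, hpq, hq, hω⟩
  exact ⟨h.groundStates_eq, h.groundStates_eq ▸ h.nehariMinimizers_nonempty, h.groundLevel_eq,
    h.nehariLevel_pos, h.exists_tendsto_translate⟩
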